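/- **Stability Lemma.** Let $n\ge 3$. *Conventions.* An $n$-gon $P$ is a closed topological disc in the plane whose boundary is a simple closed polygonal curve with vertices $v_1,\dots,v_n$ in cyclic order; edge $i$ is the segment $v_iv_{i+1}$. A *trajectory* on $P$ is a function $f:\mathbb R\to P$ which never meets a vertex, has constant nonzero velocity while it is in the interior of $P$, and whose velocity is reflected in the line carrying an edge (angle of incidence equals angle of reflection) whenever it strikes that edge. It is *periodic* if it has a period, and it is then parametrized so that $1$ is a period. A periodic trajectory $f$ on $P$ is *stable* if it persists on all nearby $n$-gons: there is $\varepsilon>0$ such that every $n$-gon $Q$ whose vertices are within $\varepsilon$ of the corresponding vertices of $P$ has a periodic trajectory that strikes, over the period $[0,1]$ and up to an increasing reparametrization of $\mathbb R$ commuting with $t\mapsto t+1$, the same labelled edges in the same order as $f$. Let $\mathcal DP$ be the surface obtained by gluing two copies of $P$ along corresponding edges, with the vertices removed. A *lift* of $f$ to $\mathcal DP$ is a continuous path $F:\mathbb R\to\mathcal DP$ over $f$ which changes from one copy of $P$ to the other exactly when $f$ strikes an edge. (1) Every periodic trajectory $f$ on an $n$-gon $P$ (with period $1$) has a lift to $\mathcal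 DP$ with period $2$. For every lift $F$ of $f$ and every period $T>0$ of $F$, the trajectory $f$ is stable if and only if the closed path $F|_{[0,T]}$ is null-homologous in $\mathcal DP$, i.e. is zero in $H_1(\mathcal DP;\mathbb Z)$. (2) Let $P_g$ be the generic $n$-gon, whose vertices $(x_i,y_i)$ have independent indeterminates as coordinates, let $R_i$ be the affine reflection (over the field $\mathbb Q(x_1,y_1,\dots,x_n,y_n)$) in the line carrying the $i$-th edge of $P_g$, and let $G_n$ be the group of affine maps generated by $R_1,\dots,R_n$. Let $\tau_n\subset G_n$ be the subgroup of the elements whose linear part is the identity, and $H_n\subset G_n$ the subgroup of the orientation-preserving elements (linear part of determinant $1$). Then $\tau_n=[H_n,H_n]$. -/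

import Mathlib

open Set Filter Topology

noncomputable section

/-! ### Polygons -/

/-- A polygon in the plane with `n` labelled edges: a closed topological disc `region` whose
boundary is the closed polygonal curve through the cyclically ordered points `vertex i`, this
curve being simple. Edge `i` joins `vertex i` to the cyclically next vertex. -/
structure NGon (n : ℕ) where
  vertex : Fin n → ℂ
  region : Set ℂ
  simple : Function.Injective fun p : Fin n × Ico (0 : ℝ) 1 =>
    AffineMap.lineMap (vertex p.1) (vertex (finRotate n p.1)) (p.2 : ℝ)
  frontier_eq : frontier region = ⋃ i, segment ℝ (vertex i) (vertex (finRotate n i))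
  disc : ∃ h : Metric.closedBall (0 : ℂ) 1 ≃ₜ region,
    ∀ z, (h z : ℂ) ∈ frontier region ↔ ‖(z : ℂ)‖ = 1

namespace NGon

variable {n : ℕ}

/-- The `i`-th edge without its endpoints. -/
def edge (P : NGon n) (i : Fin n) : Set ℂ :=
  openSegment ℝ (P.vertex i) (P.vertex (finRotate n i))

/-- The linear reflection of the plane that fixes the direction of the `i`-th edge. -/
def edgeReflection (P : NGon n) (i : Fin n) : ℂ ≃ₗᵢ[ℝ] ℂ :=
  (Submodule.span ℝ {P.vertex (finRotate n i) - P.vertex i}).reflection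

/-! ### Billiard trajectories -/

/-- A billiard trajectory: it stays in the polygon, never meets a vertex, moves with a constant
nonzero velocity while it is in the interior, and its velocity is reflected when it strikes an
edge. -/
structure IsTrajectory (P : NGon n) (f : ℝ → ℂ) : Prop where
  mem : ∀ t, f t ∈ P.region
  ne_vertex : ∀ t i, f t ≠ P.vertex i
  free : ∀ t, f t ∈ interior P.region →
    ∃ v : ℂ, v ≠ 0 ∧ ∀ᶠ s in 𝓝 t, f s = f t + (s - t) • v
  bounce : ∀ t i, f t ∈ P.edge i →
    ∃ v : ℂ, v ≠ 0 ∧ (∀ᶠ s in 𝓝[≤] t, f s = f t + (s - t) • v) ∧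
      ∀ᶠ s in 𝓝[≥] t, f s = f t + (s - t) • P.edgeReflection i v

/-- A periodic trajectory, parametrized so that `1` is a period (not necessarily the least). -/
def IsPeriodicTrajectory (P : NGon n) (f : ℝ → ℂ) : Prop :=
  P.IsTrajectory f ∧ Function.Periodic f 1

/-- Up to an orientation-preserving change of parameter that respects the period `1`, the paths
`f` on `P` and `g` on `Q` strike the same labelled edges in the same order, so that the unfoldings
along them consist of corresponding sequences of copies of `P` and of `Q`. -/
def SameItinerary (P : NGon n) (f : ℝ → ℂ) (Q : NGon n) (g : ℝ → ℂ) : Prop :=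
  ∃ φ : ℝ ≃o ℝ, (∀ t, φ (t + 1) = φ t + 1) ∧ ∀ t i, f t ∈ P.edge i ↔ g (φ t) ∈ Q.edge i

/-- A periodic trajectory on `P` is stable if it persists on all `n`-gons near `P`. -/
def IsStable (P : NGon n) (f : ℝ → ℂ) : Prop :=
  ∃ ε > 0, ∀ Q : NGon n, (∀ i, dist (Q.vertex i) (P.vertex i) < ε) →
    ∃ g, Q.IsPeriodicTrajectory g ∧ SameItinerary P f Q g

/-! ### The punctured double -/

/-- The polygon without its vertices. -/
def punctured (P : NGon n) : Set ℂ := P.region \ range P.vertex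

/-- The gluing of two copies (labelled by `Bool`) of the punctured polygon along the edges. -/
def gluing (P : NGon n) : Setoid (P.punctured × Bool) where
  r p q := p.1 = q.1 ∧ (p.2 = q.2 ∨ (p.1 : ℂ) ∈ frontier P.region)
  iseqv :=
    { refl := fun _ => ⟨rfl, Or.inl rfl⟩
      symm := fun {p q} h => ⟨h.1.symm, h.2.imp Eq.symm fun k => by rw [← h.1]; exact k⟩
      trans := fun {p q r} h k => ⟨h.1.trans k.1, by
        rcases h.2 with h2 | h2
        · rcases k.2 with k2 | k2
          · exact Or.inl (h2.trans k2)
          · exact Or.inr (by rw [h.1]; exact k2)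
        · exact Or.inr h2⟩ }

/-- The double of the polygon, punctured at the vertices, with the quotient topology. -/
def Double (P : NGon n) : Type := Quotient P.gluing

instance (P : NGon n) : TopologicalSpace P.Double :=
  inferInstanceAs (TopologicalSpace (Quotient P.gluing))

/-- The point of the double given by a point of the punctured polygon and a choice of copy. -/
def toDouble (P : NGon n) (p : P.punctured × Bool) : P.Double := Quotient.mk P.gluing p

/-- `F` is a lift of the trajectory `f` to the double: it lies over `f`, and it passes from one
copy of the polygon to the other exactly when `f` strikes an edge. -/
def IsLift (P : NGon n) (f : ℝ → ℂ) (F : C(ℝ, P.Double)) : Prop :=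
  ∃ sheet : ℝ → Bool,
    (∀ t, f t ∈ interior P.region → ∀ᶠ s in 𝓝 t, sheet s = sheet t) ∧
    (∀ t, f t ∈ frontier P.region → ∃ b,
      (∀ᶠ s in 𝓝[<] t, sheet s = b) ∧ ∀ᶠ s in 𝓝[>] t, sheet s = !b) ∧
    ∀ t, ∃ h : f t ∈ P.punctured, F t = P.toDouble (⟨f t, h⟩, sheet t)

end NGon

/-! ### Singular homology in degree one -/

/-- Singular `k`-chains of `X` with integer coefficients. -/
abbrev SingularChains (X : Type*) [TopologicalSpace X] (k : ℕ) : Type _ :=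
  C(stdSimplex ℝ (Fin (k + 1)), X) →₀ ℤ

/-- The inclusion of the `i`-th face (opposite to the `i`-th vertex) of a simplex. -/
def simplexFace (k : ℕ) (i : Fin (k + 2)) :
    C(stdSimplex ℝ (Fin (k + 1)), stdSimplex ℝ (Fin (k + 2))) :=
  ⟨stdSimplex.map i.succAbove, stdSimplex.continuous_map _⟩

/-- The singular boundary map. -/
def singularBoundary (X : Type*) [TopologicalSpace X] (k : ℕ) :
    SingularChains X (k + 1) →ₗ[ℤ] SingularChains X k :=
  Finsupp.linearCombination ℤ fun σ =>
    ∑ i : Fin (k + 2), Finsupp.single (σ.comp (simplexFace k i)) ((-1 : ℤ) ^ (i : ℕ))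

/-- The restriction of a path to `[0, T]`, as a singular `1`-simplex. -/
def pathSimplex {X : Type*} [TopologicalSpace X] (F : C(ℝ, X)) (T : ℝ) :
    C(stdSimplex ℝ (Fin 2), X) :=
  F.comp ⟨fun x => T * x.1 1,
    continuous_const.mul ((continuous_apply 1).comp continuous_subtype_val)⟩

/-- The path `F` on `[0, T]` (a loop when `F 0 = F T`) is null-homologous: it is the boundary of
an integral singular `2`-chain. -/
def IsNullHomologous {X : Type*} [TopologicalSpace X] (F : C(ℝ, X)) (T : ℝ) : Prop :=
  ∃ c : SingularChains X 2, singularBoundary X 1 c = Finsupp.single (pathSimplex F T) 1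

/-! ### The reflection group of the generic polygon -/

/-- The field of rational functions in the coordinates `x i = X (i, 0)`, `y i = X (i, 1)` of the
vertices of the generic `n`-gon. -/
abbrev GenericField (n : ℕ) : Type := FractionRing (MvPolynomial (Fin n × Fin 2) ℚ)

/-- The `i`-th vertex of the generic `n`-gon. -/
def genericVertex (n : ℕ) (i : Fin n) : Fin 2 → GenericField n := fun j =>
  algebraMap (MvPolynomial (Fin n × Fin 2) ℚ) (GenericField n) (MvPolynomial.X (i, j))

/-- A normal vector of the `i`-th edge of the generic `n`-gon. -/
def genericNormal (n : ℕ) (i : Fin n) : Fin 2 → GenericField n :=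
  let d := genericVertex n (finRotate n i) - genericVertex n i
  ![-d 1, d 0]

/-- `v ↦ v - 2 (u ⬝ v) / (u ⬝ u) u`: the linear reflection with normal vector `u`. -/
def linearReflection {K : Type*} [Field K] (u : Fin 2 → K) : (Fin 2 → K) →ₗ[K] (Fin 2 → K) where
  toFun v := v - (2 * (u ⬝ᵥ v) / (u ⬝ᵥ u)) • u
  map_add' v w := by
    rw [dotProduct_add, mul_add, add_div, add_smul]; abel
  map_smul' c v := by
    rw [dotProduct_smul, smul_eq_mul, RingHom.id_apply, smul_sub, smul_smul]
    congr 2; ring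

theorem linearReflection_involutive {K : Type*} [Field K] (u : Fin 2 → K) :
    Function.Involutive (linearReflection u) := by
  intro v
  change (v - (2 * (u ⬝ᵥ v) / (u ⬝ᵥ u)) • u) -
    (2 * (u ⬝ᵥ (v - (2 * (u ⬝ᵥ v) / (u ⬝ᵥ u)) • u)) / (u ⬝ᵥ u)) • u = v
  rw [dotProduct_sub, dotProduct_smul, smul_eq_mul, sub_sub, ← add_smul]
  by_cases h : u ⬝ᵥ u = 0
  · simp [h]
  · have : 2 * (u ⬝ᵥ v) / (u ⬝ᵥ u) +
        2 * (u ⬝ᵥ v - 2 * (u ⬝ᵥ v) / (u ⬝ᵥ u) * (u ⬝ᵥ u)) / (u ⬝ᵥ u) = 0 := by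
      field_simp; ring
    rw [this, zero_smul, sub_zero]

/-- The affine reflection `R i` in the line that carries the `i`-th edge of the generic `n`-gon. -/
def genericReflection (n : ℕ) (i : Fin n) :
    (Fin 2 → GenericField n) ≃ᵃ[GenericField n] (Fin 2 → GenericField n) :=
  AffineEquiv.mk'
    (fun x => linearReflection (genericNormal n i) (x - genericVertex n i) + genericVertex n i)
    (LinearEquiv.ofInvolutive (linearReflection (genericNormal n i))
      (linearReflection_involutive _))
    (genericVertex n i) (fun x => by simp)

/-- The group `G_n` generated by the reflections in the edges of the generic `n`-gon. -/
def genericG (n : ℕ) :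
    Subgroup ((Fin 2 → GenericField n) ≃ᵃ[GenericField n] (Fin 2 → GenericField n)) :=
  Subgroup.closure (range (genericReflection n))

/-- The subgroup `τ_n` of the elements of `G_n` with trivial linear part. -/
def genericTau (n : ℕ) :
    Subgroup ((Fin 2 → GenericField n) ≃ᵃ[GenericField n] (Fin 2 → GenericField n)) :=
  genericG n ⊓ AffineEquiv.linearHom.ker

/-- The subgroup `H_n` of the orientation-preserving elements of `G_n`. -/
def genericH (n : ℕ) :
    Subgroup ((Fin 2 → GenericField n) ≃ᵃ[GenericField n] (Fin 2 → GenericField n)) :=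
  genericG n ⊓ (LinearEquiv.det.comp AffineEquiv.linearHom).ker

end

/-! Let `w` be the sequence of edges struck by a periodic trajectory, and let C_i count the
occurrences of edge i with alternating signs over a period with an even number of hits. Stability
and null-homology are each equivalent to the vanishing of all C_i; the choice of the even period
does not matter, since it only rescales C (`altSum_eq_zero_iff`).

Homology. A sheet of the double is a disc with some boundary points removed, so an arc in sheet b
has class A_b(end) - A_b(start) for a potential A_b. Summation along a lift leaves at each hit, with
alternating sign, the difference of the two potentials, which is a constant δ_i along edge i. The
class is therefore ± Σ C_i δ_i. Conversely, a map from the double to the circle that sees only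
crossings of edge j recovers C_j up to sign (`exists_edge_cocycle`).

Necessity for stability. With the edge vectors d_i as complex numbers, a reflection is v ↦ (d_i /
conj d_i) conj v, so a velocity that returns after 2m hits gives ∏ (d_i / conj d_i) ^ C_i = 1. If
this persists for an open set of vertex positions, it is a polynomial identity in which z and conj z
may be treated as independent variables. Collapsing edge i in only one of the two forces C_i = 0
(`edgeForm_exponents_eq_zero`).

Sufficiency for stability. If C = 0, the 2m reflections compose to a translation for every nearby
polygon, so the line carrying the trajectory can be moved continuously to one that again closes up
(`foldPt_closed`). Its finitely many chords in the polygon survive a small perturbation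
(`eventually_isChord`). This last point needs nearby polygons to be images of P under homeomorphisms
near the identity (`exists_homeomorph`), and a polygon to be determined by its vertices
(`region_eq_of_vertex_eq`).

Generic group. The linear part of an even word is governed by the same product, so it is trivial
only if the alternating counts vanish. Modulo commutators an even word depends on these counts alone
(`genericWord_abelianization`). This gives τ_n ≤ [H_n, H_n]; the other inclusion holds because plane
rotations commute. -/

noncomputable section

/-! ### Homology classes of singular `1`-simplices -/

section Homology

variable {X : Type*} [TopologicalSpace X]

/-- The class of a singular `1`-simplex modulo the boundaries of singular `2`-chains. -/
def homClass (γ : C(stdSimplex ℝ (Fin 2), X)) :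
    SingularChains X 1 ⧸ LinearMap.range (singularBoundary X 1) :=
  Submodule.Quotient.mk (Finsupp.single γ 1)

theorem isNullHomologous_iff (F : C(ℝ, X)) (T : ℝ) :
    IsNullHomologous F T ↔ homClass (pathSimplex F T) = 0 := by
  rw [homClass, Submodule.Quotient.mk_eq_zero]
  rfl

/-- The boundary of one singular 2-simplex, read as an additivity law; the other relations between
classes of paths are deduced from it. -/
theorem homClass_faces (σ : C(stdSimplex ℝ (Fin 3), X)) :
    homClass (σ.comp (simplexFace 1 0)) + homClass (σ.comp (simplexFace 1 2)) =
      homClass (σ.comp (simplexFace 1 1)) := by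
  rw [← sub_eq_zero, homClass, homClass, homClass, ← Submodule.Quotient.mk_add,
    ← Submodule.Quotient.mk_sub, Submodule.Quotient.mk_eq_zero]
  refine ⟨Finsupp.single σ 1, ?_⟩
  rw [singularBoundary, Finsupp.linearCombination_single, one_smul, Fin.sum_univ_three]
  simp only [Fin.val_zero, pow_zero, Fin.val_one, pow_one, Fin.val_two, Finsupp.single_neg, even_two,
    Even.neg_pow, one_pow]
  abel

variable {E : Type*} [AddCommGroup E] [Module ℝ E] [TopologicalSpace E] [ContinuousAdd E]
  [ContinuousSMul ℝ E] {S : Set E}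

/-- The affine simplex with given vertices in a convex set. -/
def affineSimplex (hS : Convex ℝ S) {k : ℕ} (p : Fin (k + 1) → S) :
    C(stdSimplex ℝ (Fin (k + 1)), S) where
  toFun x := ⟨∑ i, x.1 i • (p i : E), hS.sum_mem (fun i _ => x.2.1 i) x.2.2 fun i _ => (p i).2⟩
  continuous_toFun := by
    refine Continuous.subtype_mk (continuous_finsetSum _ fun i _ => ?_) _
    exact ((continuous_apply i).comp continuous_subtype_val).smul continuous_const

theorem affineSimplex_comp_face (hS : Convex ℝ S) {k : ℕ} (p : Fin (k + 2) → S) (i : Fin (k + 2)) :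
    (affineSimplex hS p).comp (simplexFace k i) = affineSimplex hS (p ∘ i.succAbove) := by
  ext x
  change ∑ j, (FunOnFinite.linearMap ℝ ℝ i.succAbove x.1) j • (p j : E) =
    ∑ j, x.1 j • (p (i.succAbove j) : E)
  rw [Fin.sum_univ_succAbove _ i]
  have h0 : (FunOnFinite.linearMap ℝ ℝ i.succAbove x.1) i = 0 := by
    rw [FunOnFinite.linearMap_apply_apply]
    exact Finset.sum_eq_zero fun j hj => absurd (Finset.mem_filter.1 hj).2 (Fin.succAbove_ne i j)
  have h1 : ∀ j, (FunOnFinite.linearMap ℝ ℝ i.succAbove x.1) (i.succAbove j) = x.1 j := by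
    intro j
    rw [FunOnFinite.linearMap_apply_apply, Finset.sum_eq_single j]
    · intro b hb hbj
      exact absurd (Fin.succAbove_right_injective (Finset.mem_filter.1 hb).2) hbj
    · intro h
      simp at h
  simp [h0, h1]

/-- The image of the segment from `p` to `q` in a convex set. -/
def segSimplex (hS : Convex ℝ S) (G : C(S, X)) (p q : S) : C(stdSimplex ℝ (Fin 2), X) :=
  G.comp (affineSimplex hS ![p, q])

theorem homClass_seg_add (hS : Convex ℝ S) (G : C(S, X)) (p q r : S) :
    homClass (segSimplex hS G p q) + homClass (segSimplex hS G q r) =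
      homClass (segSimplex hS G p r) := by
  have h := homClass_faces (G.comp (affineSimplex hS ![p, q, r]))
  simp only [ContinuousMap.comp_assoc, affineSimplex_comp_face] at h
  have e0 : ![p, q, r] ∘ (0 : Fin 3).succAbove = ![q, r] := by ext j; fin_cases j <;> rfl
  have e1 : ![p, q, r] ∘ (1 : Fin 3).succAbove = ![p, r] := by ext j; fin_cases j <;> rfl
  have e2 : ![p, q, r] ∘ (2 : Fin 3).succAbove = ![p, q] := by ext j; fin_cases j <;> rfl
  rw [e0, e1, e2] at h
  exact (add_comm _ _).trans h

theorem homClass_const (x : X) : homClass (ContinuousMap.const _ x) = 0 := by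
  have h := homClass_faces (ContinuousMap.const (stdSimplex ℝ (Fin 3)) x)
  exact left_eq_add.1 h.symm

/-- A path in a convex set is homologous to the segment with the same endpoints. -/
theorem homClass_comp_path (hS : Convex ℝ S) (G : C(S, X)) (γ : C(stdSimplex ℝ (Fin 2), S)) :
    homClass (G.comp γ) =
      homClass (segSimplex hS G (γ (stdSimplex.vertex 0)) (γ (stdSimplex.vertex 1))) := by
  set a := stdSimplex.vertex (S := ℝ) (0 : Fin 2)
  set b := stdSimplex.vertex (S := ℝ) (1 : Fin 2)
  -- The straight-line homotopy `H` from γ to the segment is a map on this square. The diagonal from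
  -- `p00` to `p11` is compared with the two ways around the boundary; the sides `p01 p11` and `p00
  -- p10` go to constants.
  let Q : Set (ℝ × (Fin 2 → ℝ)) := Icc 0 1 ×ˢ stdSimplex ℝ (Fin 2)
  have hQ : Convex ℝ Q := (convex_Icc 0 1).prod (convex_stdSimplex ℝ (Fin 2))
  let H₁ : C(Q, S) := γ.comp ⟨fun z => ⟨z.1.2, z.2.2⟩, by fun_prop⟩
  let H₂ : C(Q, S) := (affineSimplex hS ![γ a, γ b]).comp ⟨fun z => ⟨z.1.2, z.2.2⟩, by fun_prop⟩
  let H : C(Q, S) := ⟨fun z => ⟨(1 - z.1.1) • (H₁ z : E) + z.1.1 • (H₂ z : E),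
    hS (H₁ z).2 (H₂ z).2 (by linarith [z.2.1.2]) z.2.1.1 (by ring)⟩, by fun_prop⟩
  let c : ℝ → Q → Prop := fun s z => z.1.1 = s
  let p00 : Q := ⟨(0, a.1), ⟨by simp, a.2⟩⟩
  let p01 : Q := ⟨(0, b.1), ⟨by simp, b.2⟩⟩
  let p10 : Q := ⟨(1, a.1), ⟨by simp, a.2⟩⟩
  let p11 : Q := ⟨(1, b.1), ⟨by simp, b.2⟩⟩
  have h1 := homClass_seg_add hQ (G.comp H) p00 p01 p11
  have h2 := homClass_seg_add hQ (G.comp H) p00 p10 p11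
  have key : ∀ x : stdSimplex ℝ (Fin 2), x.1 0 • a.1 + x.1 1 • b.1 = x.1 := by
    intro x
    ext j
    fin_cases j <;> simp [a, b]
  have e1 : segSimplex hQ (G.comp H) p00 p01 = G.comp γ := by
    ext x
    simp only [segSimplex, ContinuousMap.comp_apply]
    congr 1
    apply Subtype.ext
    simp [H, H₁, affineSimplex, p00, p01, Fin.sum_univ_two, key]
  have e2 : segSimplex hQ (G.comp H) p10 p11 = segSimplex hS G (γ a) (γ b) := by
    ext x
    simp only [segSimplex, ContinuousMap.comp_apply]
    congr 1
    apply Subtype.ext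
    have := x.2.2
    rw [Fin.sum_univ_two] at this
    simp [H, H₂, affineSimplex, p10, p11, Fin.sum_univ_two, this, key]
  have e3 : segSimplex hQ (G.comp H) p01 p11 = ContinuousMap.const _ (G (γ b)) := by
    ext x
    have := x.2.2
    rw [Fin.sum_univ_two] at this
    simp only [segSimplex, ContinuousMap.comp_apply, ContinuousMap.const_apply]
    congr 1
    apply Subtype.ext
    simp only [H, H₁, H₂, affineSimplex, p01, p11, ContinuousMap.comp_apply,
      ContinuousMap.coe_mk]
    simp [← add_smul, this, b]
  have e4 : segSimplex hQ (G.comp H) p00 p10 = ContinuousMap.const _ (G (γ a)) := by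
    ext x
    have := x.2.2
    rw [Fin.sum_univ_two] at this
    simp only [segSimplex, ContinuousMap.comp_apply, ContinuousMap.const_apply]
    congr 1
    apply Subtype.ext
    simp only [H, H₁, H₂, affineSimplex, p00, p10, ContinuousMap.comp_apply,
      ContinuousMap.coe_mk]
    simp [← add_smul, this, a]
  rw [e1, e3, homClass_const, add_zero] at h1
  rw [e2, e4, homClass_const, zero_add] at h2
  rw [h1, h2]

/-- The part of a path over the interval from `a` to `b`, as a singular `1`-simplex. -/
def arcSimplex (F : C(ℝ, X)) (a b : ℝ) : C(stdSimplex ℝ (Fin 2), X) :=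
  F.comp ⟨fun x => a * x.1 0 + b * x.1 1, by
    have := fun i : Fin 2 => (continuous_apply i).comp
      (continuous_subtype_val (p := fun x => x ∈ stdSimplex ℝ (Fin 2)))
    exact (continuous_const.mul (this 0)).add (continuous_const.mul (this 1))⟩

theorem pathSimplex_eq_arcSimplex (F : C(ℝ, X)) (T : ℝ) : pathSimplex F T = arcSimplex F 0 T := by
  ext x
  simp [pathSimplex, arcSimplex]

theorem homClass_arc_add (F : C(ℝ, X)) (a b c : ℝ) :
    homClass (arcSimplex F a b) + homClass (arcSimplex F b c) = homClass (arcSimplex F a c) := by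
  have e : ∀ p q : ℝ, arcSimplex F p q = segSimplex (convex_univ (𝕜 := ℝ) (E := ℝ))
      (F.comp ⟨Subtype.val, continuous_subtype_val⟩) ⟨p, trivial⟩ ⟨q, trivial⟩ := by
    intro p q
    ext x
    simp [arcSimplex, segSimplex, affineSimplex, Fin.sum_univ_two, mul_comm]
  rw [e, e, e, homClass_seg_add]

theorem homClass_arc_sum (F : C(ℝ, X)) (t : ℕ → ℝ) (N : ℕ) :
    homClass (arcSimplex F (t 0) (t N)) =
      ∑ k ∈ Finset.range N, homClass (arcSimplex F (t k) (t (k + 1))) := by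
  induction N with
  | zero =>
    have := homClass_arc_add F (t 0) (t 0) (t 0)
    simpa using this
  | succ N ih => rw [Finset.sum_range_succ, ← ih, homClass_arc_add]

/-- The arc from 0 to a + T is split at a and at T; by periodicity its piece from T to a + T is the
same simplex as its piece from 0 to a, and cancels. -/
theorem homClass_arc_shift (F : C(ℝ, X)) {T : ℝ} (hF : Function.Periodic F T) (a : ℝ) :
    homClass (arcSimplex F a (a + T)) = homClass (pathSimplex F T) := by
  have e : arcSimplex F T (a + T) = arcSimplex F 0 a := by
    ext x
    have := x.2.2
    rw [Fin.sum_univ_two] at this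
    simp only [arcSimplex, ContinuousMap.comp_apply, ContinuousMap.coe_mk]
    refine Eq.trans (congrArg F ?_) (hF _)
    linear_combination T * this
  rw [pathSimplex_eq_arcSimplex]
  have h1 := homClass_arc_add F 0 a (a + T)
  have h2 := homClass_arc_add F 0 T (a + T)
  rw [e] at h2
  rw [← h2, add_comm (homClass (arcSimplex F 0 T))] at h1
  exact add_left_cancel h1

/-! ### The degree cocycle of a map to the circle -/

/-- Together with local path-connectedness, this allows maps from simplices to be lifted through the
covering of the circle by the line. -/
instance simplyConnectedSpace_stdSimplex (k : ℕ) :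
    SimplyConnectedSpace (stdSimplex ℝ (Fin (k + 1))) := by
  have : ContractibleSpace (stdSimplex ℝ (Fin (k + 1))) :=
    (convex_stdSimplex ℝ (Fin (k + 1))).contractibleSpace ⟨_, (stdSimplex.vertex 0).2⟩
  infer_instance

instance locallyPathConnectedSpace_stdSimplex (k : ℕ) :
    LocallyPathConnectedSpace (stdSimplex ℝ (Fin (k + 1))) :=
  (convex_stdSimplex ℝ (Fin (k + 1))).locallyPathConnectedSpace

theorem exists_circle_lift {k : ℕ} (σ : C(stdSimplex ℝ (Fin (k + 1)), AddCircle (1 : ℝ))) :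
    ∃ g : C(stdSimplex ℝ (Fin (k + 1)), ℝ), ∀ x, (g x : AddCircle (1 : ℝ)) = σ x := by
  obtain ⟨e, he⟩ := QuotientAddGroup.mk_surjective (σ (stdSimplex.vertex 0))
  obtain ⟨g, ⟨-, hg⟩, -⟩ := (AddCircle.isCoveringMap_coe (1 : ℝ)).existsUnique_continuousMap_lifts σ
    (stdSimplex.vertex 0) e he
  exact ⟨g, fun x => congrFun hg x⟩

/-- After a shift of `g'` by the constant g x - g' x, whose class in the circle is zero, the two
lifts agree at x, hence everywhere by uniqueness of lifts. -/
theorem circle_lift_diff {g g' : C(stdSimplex ℝ (Fin 2), ℝ)}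
    (h : ∀ x, (g x : AddCircle (1 : ℝ)) = g' x) (x y : stdSimplex ℝ (Fin 2)) :
    g y - g x = g' y - g' x := by
  have := (AddCircle.isCoveringMap_coe (1 : ℝ)).eq_of_comp_eq
    (g₁ := g) (g₂ := fun z => g' z + (g x - g' x)) g.continuous (by fun_prop) (by
      funext z
      have := h x
      simp only [Function.comp_apply]
      rw [AddCircle.coe_add, AddCircle.coe_sub, h, h, sub_self, add_zero]) x (by ring)
  have := congrFun this y
  linarith

/-- The total change of a lift to the line of a path in the circle. -/
def circleChange (σ : C(stdSimplex ℝ (Fin 2), AddCircle (1 : ℝ))) : ℝ :=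
  (exists_circle_lift σ).choose (stdSimplex.vertex 1) -
    (exists_circle_lift σ).choose (stdSimplex.vertex 0)

theorem circleChange_eq {σ : C(stdSimplex ℝ (Fin 2), AddCircle (1 : ℝ))}
    (g : C(stdSimplex ℝ (Fin 2), ℝ)) (hg : ∀ x, (g x : AddCircle (1 : ℝ)) = σ x) :
    circleChange σ = g (stdSimplex.vertex 1) - g (stdSimplex.vertex 0) :=
  circle_lift_diff (fun x => by rw [(exists_circle_lift σ).choose_spec, hg]) _ _

/-- A 2-simplex mapped to the circle lifts to the line, and the changes of the lift along the three
faces, taken with signs, cancel. So the change kills boundaries and can detect nonzero homology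
classes. -/
theorem exists_degree_cocycle (θ : C(X, AddCircle (1 : ℝ))) :
    ∃ D : (SingularChains X 1 ⧸ LinearMap.range (singularBoundary X 1)) →ₗ[ℤ] ℝ,
      ∀ γ : C(stdSimplex ℝ (Fin 2), X), D (homClass γ) = circleChange (θ.comp γ) := by
  refine ⟨Submodule.liftQ _ (Finsupp.linearCombination ℤ fun γ => circleChange (θ.comp γ)) ?_,
    fun γ => ?_⟩
  · rw [LinearMap.range_le_ker_iff]
    ext σ
    obtain ⟨g, hg⟩ := exists_circle_lift (θ.comp σ)
    have h : ∀ i, circleChange (θ.comp (σ.comp (simplexFace 1 i))) =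
        g (simplexFace 1 i (stdSimplex.vertex 1)) - g (simplexFace 1 i (stdSimplex.vertex 0)) :=
      fun i => circleChange_eq (g.comp (simplexFace 1 i)) fun x => hg _
    have hv : ∀ (i : Fin 3) (j : Fin 2), simplexFace 1 i (stdSimplex.vertex j) =
        stdSimplex.vertex (i.succAbove j) := fun i j => stdSimplex.map_vertex _ _
    simp only [singularBoundary, LinearMap.comp_apply, Finsupp.lsingle_apply,
      Finsupp.linearCombination_single, one_smul, map_sum, h, hv]
    have e := Fin.sum_univ_three fun x : Fin 3 => (-1 : ℤ) ^ (x : ℕ) •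
      (g (stdSimplex.vertex (x.succAbove 1)) - g (stdSimplex.vertex (x.succAbove 0)))
    refine (Eq.trans ?_ e).trans ?_
    · rfl
    · simp [Fin.succAbove]
  · simp [homClass]

end Homology
end
noncomputable section

/-! ### The linear forms given by the edges of a polygon -/

theorem finRotate_ne {n : ℕ} (hn : 3 ≤ n) (i : Fin n) : finRotate n i ≠ i := by
  obtain ⟨m, rfl⟩ : ∃ m, n = m + 3 := ⟨n - 3, by omega⟩
  rw [finRotate_apply, Ne, add_eq_left]
  exact one_ne_zero

theorem finRotate_finRotate_ne {n : ℕ} (hn : 3 ≤ n) (i : Fin n) :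
    finRotate n (finRotate n i) ≠ i := by
  obtain ⟨m, rfl⟩ : ∃ m, n = m + 3 := ⟨n - 3, by omega⟩
  rw [finRotate_apply, finRotate_apply, add_assoc, Ne, add_eq_left, Fin.ext_iff,
    Fin.val_add, Fin.val_one, Fin.val_zero]
  rw [Nat.mod_eq_of_lt (by omega)]
  omega

/-- The `i`-th edge vector `x + s y` of the generic polygon in the complex coordinate given by
`s = ± I`. -/
def edgeForm (n : ℕ) (s : ℂ) (i : Fin n) : MvPolynomial (Fin n × Fin 2) ℂ :=
  (MvPolynomial.X (finRotate n i, 0) - MvPolynomial.X (i, 0)) +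
    MvPolynomial.C s * (MvPolynomial.X (finRotate n i, 1) - MvPolynomial.X (i, 1))

/-- At complex points the forms for I and -I are the edge vectors of two independent closed polygons
p and q. Let q have distinct vertices, and let p be q with vertex i + 1 moved onto vertex i. Then
exactly one of the 2n forms vanishes, and it occurs on just one side of the identity as soon as c i
is nonzero. -/
theorem edgeForm_exponents_eq_zero {n : ℕ} (hn : 3 ≤ n) (c : Fin n → ℤ)
    (h : ∏ i, (edgeForm n Complex.I i ^ (c i).toNat * edgeForm n (-Complex.I) i ^ (-c i).toNat) =
      ∏ i, (edgeForm n (-Complex.I) i ^ (c i).toNat * edgeForm n Complex.I i ^ (-c i).toNat)) :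
    c = 0 := by
  by_contra hc
  obtain ⟨i, hi⟩ := Function.ne_iff.1 hc
  rw [Pi.zero_apply] at hi
  let q : Fin n → ℂ := fun j => ((j : ℕ) : ℂ)
  let p : Fin n → ℂ := fun j => if j = finRotate n i then q i else q j
  have hq : Function.Injective q := fun a b hab => Fin.ext (Nat.cast_injective hab)
  -- The solution of x + I y = p, x - I y = q at each vertex.
  let x : Fin n × Fin 2 → ℂ := fun a =>
    if a.2 = 0 then (p a.1 + q a.1) / 2 else (p a.1 - q a.1) / (2 * Complex.I)
  have e1 : ∀ j, MvPolynomial.eval x (edgeForm n Complex.I j) = p (finRotate n j) - p j := by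
    intro j
    simp only [edgeForm, map_add, map_sub, map_mul, MvPolynomial.eval_X, MvPolynomial.eval_C, x]
    simp only [if_true, one_ne_zero, if_false]
    field_simp
    ring
  have e2 : ∀ j, MvPolynomial.eval x (edgeForm n (-Complex.I) j) = q (finRotate n j) - q j := by
    intro j
    simp only [edgeForm, map_add, map_sub, map_mul, MvPolynomial.eval_X, MvPolynomial.eval_C, x]
    simp only [if_true, one_ne_zero, if_false]
    field_simp
    ring
  have hq0 : ∀ j, q (finRotate n j) - q j ≠ 0 := fun j =>
    sub_ne_zero.2 fun h => finRotate_ne hn j (hq h)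
  have hpi : p (finRotate n i) - p i = 0 := by
    simp [p]
  have hp0 : ∀ j, j ≠ i → p (finRotate n j) - p j ≠ 0 := by
    intro j hj
    have h1 : finRotate n j ≠ finRotate n i := fun h => hj ((finRotate n).injective h)
    simp only [p, if_neg h1]
    split_ifs with h2
    -- The edge after i now runs from q i to the second successor of i, which must differ from i.
    · rw [h2]
      exact sub_ne_zero.2 fun h => finRotate_finRotate_ne hn i (hq h)
    · exact hq0 j
  have h' := congrArg (MvPolynomial.eval x) h
  simp only [map_prod, map_mul, map_pow, e1, e2] at h'
  rcases lt_or_gt_of_ne hi with hneg | hpos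
  · have h0 : (c i).toNat = 0 := by omega
    have h0' : (-c i).toNat ≠ 0 := by omega
    rw [Finset.prod_eq_zero (f := fun j => (q (finRotate n j) - q j) ^ (c j).toNat *
      (p (finRotate n j) - p j) ^ (-c j).toNat) (Finset.mem_univ i) (by rw [hpi, zero_pow h0']; ring)] at h'
    refine Finset.prod_ne_zero_iff.2 (fun j _ => ?_) h'
    refine mul_ne_zero ?_ (pow_ne_zero _ (hq0 j))
    by_cases hj : j = i
    · rw [hj, h0, pow_zero]; exact one_ne_zero
    · exact pow_ne_zero _ (hp0 j hj)
  · have h0 : (-c i).toNat = 0 := by omega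
    have h0' : (c i).toNat ≠ 0 := by omega
    rw [Finset.prod_eq_zero (f := fun j => (p (finRotate n j) - p j) ^ (c j).toNat *
      (q (finRotate n j) - q j) ^ (-c j).toNat) (Finset.mem_univ i) (by rw [hpi, zero_pow h0']; ring)] at h'
    refine Finset.prod_ne_zero_iff.2 (fun j _ => ?_) h'.symm
    refine mul_ne_zero (pow_ne_zero _ (hq0 j)) ?_
    by_cases hj : j = i
    · rw [hj, h0, pow_zero]; exact one_ne_zero
    · exact pow_ne_zero _ (hp0 j hj)

/-- Denominators are cleared by splitting each exponent into its positive and negative parts, so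
that a polynomial identity results. -/
theorem prod_toNat_eq_of_prod_zpow {ι F : Type*} [Fintype ι] [Field F] (a b : ι → F)
    (ha : ∀ i, a i ≠ 0) (hb : ∀ i, b i ≠ 0) (c : ι → ℤ) (h : ∏ i, (a i / b i) ^ c i = 1) :
    ∏ i, (a i ^ (c i).toNat * b i ^ (-c i).toNat) =
      ∏ i, (b i ^ (c i).toNat * a i ^ (-c i).toNat) := by
  have key : ∀ i, (a i / b i) ^ c i = (a i ^ (c i).toNat * b i ^ (-c i).toNat) /
      (b i ^ (c i).toNat * a i ^ (-c i).toNat) := by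
    intro i
    have ha' := ha i
    have hb' := hb i
    rcases le_total 0 (c i) with hc | hc
    · obtain ⟨k, hk⟩ := Int.eq_ofNat_of_zero_le hc
      simp [hk, div_pow]
    · obtain ⟨k, hk⟩ := Int.eq_ofNat_of_zero_le (neg_nonneg.2 hc)
      have hk' : c i = -(k : ℤ) := by omega
      simp [hk', div_pow]
  rw [Finset.prod_congr rfl fun i _ => key i, Finset.prod_div_distrib, div_eq_one_iff_eq] at h
  · exact h
  · exact Finset.prod_ne_zero_iff.2 fun i _ =>
      mul_ne_zero (pow_ne_zero _ (hb i)) (pow_ne_zero _ (ha i))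

/-! ### The reflection group of the generic polygon -/

section Generic

variable (n : ℕ)

/-- The field of rational functions with complex coefficients. -/
abbrev ComplexGenericField : Type := FractionRing (MvPolynomial (Fin n × Fin 2) ℂ)

theorem genericField_map_injective :
    Function.Injective ((algebraMap (MvPolynomial (Fin n × Fin 2) ℂ) (ComplexGenericField n)).comp
      (MvPolynomial.map (algebraMap ℚ ℂ))) := by
  rw [RingHom.coe_comp]
  exact (IsFractionRing.injective _ _).comp
    (MvPolynomial.map_injective _ (algebraMap ℚ ℂ).injective)

/-- Extension of scalars to `ℂ`. -/
def genericEmbedding : GenericField n →+* ComplexGenericField n :=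
  IsFractionRing.lift (genericField_map_injective n)

/-- The constants of the field of rational functions. -/
def genericConst (s : ℂ) : ComplexGenericField n :=
  algebraMap (MvPolynomial (Fin n × Fin 2) ℂ) _ (MvPolynomial.C s)

/-- The complex coordinate `v 0 + s v 1`, for `s = ± I`. -/
def genericCoord (s : ℂ) (v : Fin 2 → GenericField n) : ComplexGenericField n :=
  genericEmbedding n (v 0) + genericConst n s * genericEmbedding n (v 1)

/-- The edge vector in the complex coordinate given by `s`. -/
def genericEdge (s : ℂ) (i : Fin n) : ComplexGenericField n :=
  algebraMap (MvPolynomial (Fin n × Fin 2) ℂ) _ (edgeForm n s i)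

variable {n}

theorem genericConst_sq {s : ℂ} (hs : s ^ 2 = -1) : genericConst n s ^ 2 = -1 := by
  rw [genericConst, ← map_pow, ← MvPolynomial.C_pow, hs]
  simp

theorem genericConst_neg (s : ℂ) : genericConst n (-s) = -genericConst n s := by
  simp [genericConst]

theorem genericEdge_eq (s : ℂ) (i : Fin n) : genericEdge n s i =
    genericCoord n s (genericVertex n (finRotate n i) - genericVertex n i) := by
  have h : ∀ a, genericEmbedding n (algebraMap (MvPolynomial (Fin n × Fin 2) ℚ) _
      (MvPolynomial.X a)) = algebraMap (MvPolynomial (Fin n × Fin 2) ℂ) _ (MvPolynomial.X a) := by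
    intro a
    rw [genericEmbedding, IsFractionRing.lift_algebraMap]
    simp
  simp only [genericEdge, edgeForm, genericCoord, genericConst, genericVertex, Pi.sub_apply,
    map_sub, map_add, map_mul, h]

theorem edgeForm_ne_zero (hn : 3 ≤ n) (s : ℂ) (i : Fin n) : edgeForm n s i ≠ 0 := by
  intro h
  have := congrArg (MvPolynomial.eval fun a : Fin n × Fin 2 => if a = (i, 0) then (1 : ℂ) else 0) h
  simp [edgeForm, finRotate_ne hn i, -finRotate_apply] at this

theorem genericEdge_ne_zero (hn : 3 ≤ n) (s : ℂ) (i : Fin n) : genericEdge n s i ≠ 0 := by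
  rw [genericEdge, Ne, FaithfulSMul.algebraMap_eq_zero_iff]
  exact edgeForm_ne_zero hn s i

/-- The algebraic form of z ↦ (d / conj d) conj z: over the generic field, conjugation becomes the
exchange of the coordinates for s and -s. -/
theorem genericCoord_reflection (hn : 3 ≤ n) {s : ℂ} (hs : s ^ 2 = -1) (i : Fin n)
    (v : Fin 2 → GenericField n) :
    genericCoord n s (linearReflection (genericNormal n i) v) =
      genericEdge n s i / genericEdge n (-s) i * genericCoord n (-s) v := by
  have h1 := genericEdge_ne_zero hn s i
  have h2 := genericEdge_ne_zero hn (-s) i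
  have hI := genericConst_sq (n := n) hs
  rw [genericEdge_eq] at h1 h2
  rw [genericEdge_eq, genericEdge_eq]
  have hu : genericNormal n i = ![-(genericVertex n (finRotate n i) - genericVertex n i) 1,
    (genericVertex n (finRotate n i) - genericVertex n i) 0] := rfl
  rw [hu]
  generalize genericVertex n (finRotate n i) - genericVertex n i = d at h1 h2 ⊢
  simp only [linearReflection, LinearMap.coe_mk, AddHom.coe_mk, genericCoord, Pi.sub_apply,
    Pi.smul_apply, smul_eq_mul, dotProduct, Fin.sum_univ_two, Matrix.cons_val_zero,
    Matrix.cons_val_one, map_sub, map_mul, map_div₀, map_add, map_neg, map_ofNat,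
    genericConst_neg] at h1 h2 ⊢
  set a := genericEmbedding n (d 0)
  set b := genericEmbedding n (d 1)
  set x := genericEmbedding n (v 0)
  set y := genericEmbedding n (v 1)
  set I := genericConst n s
  have e : -b * -b + a * a = (a + I * b) * (a + -I * b) := by linear_combination b ^ 2 * hI
  rw [e]
  obtain ⟨m, hm⟩ : ∃ m, m = 2 * (-b * x + a * y) / ((a + I * b) * (a + -I * b)) := ⟨_, rfl⟩
  rw [← hm, div_mul_eq_mul_div, eq_div_iff h2]
  rw [eq_div_iff (mul_ne_zero h1 h2)] at hm
  apply mul_left_cancel₀ h1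
  linear_combination (b - I * a) * hm + (2 * a * b * y - 2 * b ^ 2 * x) * hI

theorem genericCoord_ext {v w : Fin 2 → GenericField n}
    (h1 : genericCoord n Complex.I v = genericCoord n Complex.I w)
    (h2 : genericCoord n (-Complex.I) v = genericCoord n (-Complex.I) w) : v = w := by
  simp only [genericCoord, genericConst_neg] at h1 h2
  have hI := genericConst_sq (n := n) (s := Complex.I) (by simp)
  have hinj := (genericEmbedding n).injective
  have h0 : genericEmbedding n (v 0) = genericEmbedding n (w 0) := by linear_combination (h1 + h2) / 2
  have h3 : genericEmbedding n (v 1) = genericEmbedding n (w 1) := by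
    linear_combination (-genericConst n Complex.I * (h1 - h2)) / 2 +
      (genericEmbedding n (v 1) - genericEmbedding n (w 1)) * hI
  ext j
  fin_cases j
  · exact hinj h0
  · exact hinj h3

/-- The alternating count of the letters of a word. -/
def altCount : List (Fin n) → Fin n → ℤ
  | [] => 0
  | a :: l => Pi.single a 1 - altCount l

/-- The product of the generic reflections over a word. -/
def genericWord (l : List (Fin n)) :
    (Fin 2 → GenericField n) ≃ᵃ[GenericField n] (Fin 2 → GenericField n) :=
  (l.map (genericReflection n)).prod

/-- Each reflection exchanges s and -s and so inverts the ratios contributed by the rest of the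
word; this is the source of the alternating signs. -/
theorem genericCoord_word (hn : 3 ≤ n) (l : List (Fin n)) : ∀ {s : ℂ}, s ^ 2 = -1 →
    ∀ v, genericCoord n s (AffineEquiv.linearHom (genericWord l) v) =
      (∏ i, (genericEdge n s i / genericEdge n (-s) i) ^ altCount l i) *
        genericCoord n ((-1) ^ l.length * s) v := by
  induction l with
  | nil =>
    intro s _ v
    simp only [genericWord, List.map_nil, List.prod_nil, map_one, altCount]
    simp
  | cons a l ih =>
    intro s hs v
    have e : AffineEquiv.linearHom (genericWord (a :: l)) v =
        linearReflection (genericNormal n a) (AffineEquiv.linearHom (genericWord l) v) := by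
      rw [genericWord, List.map_cons, List.prod_cons, map_mul]
      rfl
    have h1 := genericEdge_ne_zero hn s
    have h2 := genericEdge_ne_zero hn (-s)
    rw [e, genericCoord_reflection hn hs, ih (by rw [neg_sq, hs]), ← mul_assoc, neg_neg]
    congr 1
    · have : ∀ i, (genericEdge n s i / genericEdge n (-s) i) ^ altCount (a :: l) i =
          (genericEdge n s i / genericEdge n (-s) i) ^ (Pi.single a 1 : Fin n → ℤ) i *
          (genericEdge n (-s) i / genericEdge n s i) ^ altCount l i := by
        intro i
        rw [altCount, Pi.sub_apply, zpow_sub₀ (div_ne_zero (h1 i) (h2 i)), div_eq_mul_inv _ (_ ^ _),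
          ← inv_zpow, inv_div]
      rw [Finset.prod_congr rfl fun i _ => this i, Finset.prod_mul_distrib]
      congr 1
      rw [Finset.prod_eq_single a]
      · simp
      · intro b _ hb
        simp [hb]
      · simp
    · rw [List.length_cons, pow_succ]
      congr 1
      ring

theorem genericReflection_mul_self (i : Fin n) :
    genericReflection n i * genericReflection n i = 1 := by
  ext x : 1
  change linearReflection (genericNormal n i) ((linearReflection (genericNormal n i)
    (x - genericVertex n i) + genericVertex n i) - genericVertex n i) + genericVertex n i = x
  rw [add_sub_cancel_right, linearReflection_involutive, sub_add_cancel]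

theorem exists_genericWord {g : (Fin 2 → GenericField n) ≃ᵃ[GenericField n] (Fin 2 → GenericField n)}
    (hg : g ∈ genericG n) : ∃ l : List (Fin n), g = genericWord l := by
  induction hg using Subgroup.closure_induction with
  | mem x hx =>
    obtain ⟨i, rfl⟩ := hx
    exact ⟨[i], by simp [genericWord]⟩
  | one => exact ⟨[], by simp [genericWord]⟩
  | mul x y _ _ hx hy =>
    obtain ⟨l, rfl⟩ := hx
    obtain ⟨m, rfl⟩ := hy
    exact ⟨l ++ m, by simp [genericWord]⟩
  | inv x hx ih =>
    obtain ⟨l, rfl⟩ := ih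
    refine ⟨l.reverse, inv_eq_of_mul_eq_one_right ?_⟩
    clear hx
    induction l with
    | nil => simp [genericWord]
    | cons a l ih =>
      simp only [genericWord, List.map_cons, List.prod_cons, List.reverse_cons, List.map_append,
        List.prod_append, List.map_nil, List.prod_nil, mul_one] at ih ⊢
      calc _ = genericReflection n a * ((l.map (genericReflection n)).prod *
            (l.reverse.map (genericReflection n)).prod) * genericReflection n a := by group
        _ = 1 := by rw [ih, mul_one, genericReflection_mul_self]

theorem genericWord_mem (l : List (Fin n)) : genericWord l ∈ genericG n :=
  Subgroup.list_prod_mem _ fun x hx => by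
    obtain ⟨i, -, rfl⟩ := List.mem_map.1 hx
    exact Subgroup.subset_closure ⟨i, rfl⟩

theorem genericNormal_dotProduct_ne_zero (hn : 3 ≤ n) (i : Fin n) :
    genericNormal n i ⬝ᵥ genericNormal n i ≠ 0 := by
  have h1 := genericEdge_ne_zero hn Complex.I i
  have h2 := genericEdge_ne_zero hn (-Complex.I) i
  have hI := genericConst_sq (n := n) (s := Complex.I) (by simp)
  intro h0
  apply mul_ne_zero h1 h2
  rw [genericEdge_eq, genericEdge_eq]
  have := congrArg (genericEmbedding n) h0
  set d := genericVertex n (finRotate n i) - genericVertex n i with hd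
  have hu : genericNormal n i = ![-d 1, d 0] := rfl
  rw [hu] at this
  simp only [dotProduct, Fin.sum_univ_two, Matrix.cons_val_zero, Matrix.cons_val_one, map_add,
    map_mul, map_neg, map_zero] at this
  simp only [genericCoord, genericConst_neg]
  linear_combination this - genericEmbedding n (d 1) ^ 2 * hI

theorem linearReflection_det {K : Type*} [Field K] (u : Fin 2 → K) (hu : u ⬝ᵥ u ≠ 0) :
    LinearMap.det (linearReflection u) = -1 := by
  rw [← LinearMap.det_toMatrix', Matrix.det_fin_two]
  simp only [LinearMap.toMatrix'_apply, linearReflection, LinearMap.coe_mk, AddHom.coe_mk,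
    Pi.sub_apply, Pi.smul_apply, smul_eq_mul, dotProduct, Fin.sum_univ_two] at hu ⊢
  simp
  have hu' : u 0 ^ 2 + u 1 ^ 2 ≠ 0 := by rwa [sq, sq]
  rw [← sq, ← sq]
  field_simp
  ring

theorem genericWord_det (hn : 3 ≤ n) (l : List (Fin n)) :
    LinearEquiv.det (AffineEquiv.linearHom (genericWord l)) = (-1) ^ l.length := by
  induction l with
  | nil => rw [genericWord, List.map_nil, List.prod_nil, map_one, map_one, List.length_nil, pow_zero]
  | cons a l ih =>
    rw [genericWord, List.map_cons, List.prod_cons, map_mul, map_mul, List.length_cons, pow_succ']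
    refine congrArg₂ _ (Units.ext ?_) ih
    rw [LinearEquiv.coe_det, Units.val_neg, Units.val_one]
    exact linearReflection_det _ (genericNormal_dotProduct_ne_zero hn a)

theorem genericWord_mem_H (hn : 3 ≤ n) {l : List (Fin n)} (hl : Even l.length) :
    genericWord l ∈ genericH n := by
  refine ⟨genericWord_mem l, ?_⟩
  change LinearEquiv.det (AffineEquiv.linearHom (genericWord l)) = 1
  rw [genericWord_det hn, hl.neg_one_pow]

theorem exists_even_genericWord (hn : 3 ≤ n)
    {g : (Fin 2 → GenericField n) ≃ᵃ[GenericField n] (Fin 2 → GenericField n)}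
    (hg : g ∈ genericH n) : ∃ l : List (Fin n), Even l.length ∧ g = genericWord l := by
  obtain ⟨l, rfl⟩ := exists_genericWord hg.1
  refine ⟨l, ?_, rfl⟩
  by_contra h
  have h2 : LinearEquiv.det (AffineEquiv.linearHom (genericWord l)) = 1 := hg.2
  rw [genericWord_det hn, (Nat.not_even_iff_odd.1 h).neg_one_pow] at h2
  have := congrArg Units.val h2
  norm_num at this

theorem genericTau_le_genericH : genericTau n ≤ genericH n := by
  rintro g ⟨h1, h2⟩
  refine ⟨h1, ?_⟩
  have : AffineEquiv.linearHom g = 1 := h2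
  change LinearEquiv.det (AffineEquiv.linearHom g) = 1
  rw [this, map_one]

/-- A pair of letters satisfies R_a R_b = (R_a R_i₀) (R_b R_i₀)⁻¹, so it contributes +1 for a and -1
for b, and in the abelianization the order of the pairs is irrelevant. -/
theorem genericWord_abelianization (hn : 3 ≤ n) (i₀ : Fin n) :
    ∀ (l : List (Fin n)) (hl : Even l.length),
      Abelianization.of (⟨genericWord l, genericWord_mem_H hn hl⟩ : genericH n) =
        ∏ i, Abelianization.of (⟨genericWord [i, i₀], genericWord_mem_H hn even_two⟩ : genericH n) ^
          altCount l i
  | [], _ => by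
    simp only [altCount, Pi.zero_apply, zpow_zero, Finset.prod_const_one]
    exact map_one _
  | [a], hl => by simp at hl
  | a :: b :: l, hl => by
    have hl' : Even l.length := by simpa [Nat.even_add_one] using hl
    have e : (⟨genericWord (a :: b :: l), genericWord_mem_H hn hl⟩ : genericH n) =
        ⟨genericWord [a, i₀], genericWord_mem_H hn even_two⟩ *
        (⟨genericWord [b, i₀], genericWord_mem_H hn even_two⟩)⁻¹ *
        ⟨genericWord l, genericWord_mem_H hn hl'⟩ := by
      apply Subtype.ext
      simp only [genericWord, List.map_cons, List.prod_cons, List.map_nil, List.prod_nil, mul_one,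
        Subgroup.coe_mul, Subgroup.coe_inv, mul_inv_rev]
      have h0 := genericReflection_mul_self (n := n)
      rw [inv_eq_of_mul_eq_one_right (h0 b), inv_eq_of_mul_eq_one_right (h0 i₀)]
      calc _ = genericReflection n a * 1 * genericReflection n b *
            (l.map (genericReflection n)).prod := by group
        _ = _ := by rw [← h0 i₀]; group
    rw [e, map_mul, map_mul, map_inv, genericWord_abelianization hn i₀ l hl']
    have : ∀ i, altCount (a :: b :: l) i =
        (Pi.single a 1 : Fin n → ℤ) i + -(Pi.single b 1 : Fin n → ℤ) i + altCount l i := by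
      intro i
      simp only [altCount, Pi.sub_apply]
      ring
    simp only [this, zpow_add, Finset.prod_mul_distrib, zpow_neg, Finset.prod_inv_distrib]
    have hs : ∀ (f : Fin n → Abelianization (genericH n)) (a : Fin n),
        ∏ i, f i ^ (Pi.single a 1 : Fin n → ℤ) i = f a := by
      intro f a
      rw [Finset.prod_eq_single a]
      · simp
      · intro b _ hb
        simp [hb]
      · simp
    rw [hs, hs]

/-- A trivial linear part makes the product of edge ratios equal to 1, hence all alternating counts
0 and the class in the abelianization trivial. Conversely, linear parts of even words are scalars in
each of the two complex coordinates, so they commute. -/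
theorem genericTau_eq_commutator (hn : 3 ≤ n) : genericTau n = ⁅genericH n, genericH n⁆ := by
  apply le_antisymm
  · intro g hg
    obtain ⟨l, hl, rfl⟩ := exists_even_genericWord hn (genericTau_le_genericH hg)
    have hlin : AffineEquiv.linearHom (genericWord l) = 1 := hg.2
    have hI : Complex.I ^ 2 = -1 := Complex.I_sq
    -- The vector (1, 0) has complex coordinate 1, so its image is the rotation factor itself.
    have h := genericCoord_word hn l hI (Pi.single 0 1)
    rw [hlin, hl.neg_one_pow, one_mul] at h
    have hone : genericCoord n Complex.I (Pi.single 0 1) = 1 := by simp [genericCoord]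
    rw [LinearEquiv.coe_one, id, hone, mul_one] at h
    have h' := prod_toNat_eq_of_prod_zpow _ _ (genericEdge_ne_zero hn Complex.I)
      (genericEdge_ne_zero hn (-Complex.I)) (altCount l) h.symm
    have hc : altCount l = 0 := by
      apply edgeForm_exponents_eq_zero hn
      apply IsFractionRing.injective (MvPolynomial (Fin n × Fin 2) ℂ) (ComplexGenericField n)
      simpa [genericEdge] using h'
    have hab := genericWord_abelianization hn ⟨0, by omega⟩ l hl
    rw [hc] at hab
    simp only [Pi.zero_apply, zpow_zero, Finset.prod_const_one] at hab
    rw [← MonoidHom.mem_ker, Abelianization.ker_of] at hab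
    rw [← Subgroup.map_subtype_commutator]
    exact ⟨_, hab, rfl⟩
  · rw [Subgroup.commutator_le]
    intro g hg k hk
    refine ⟨(genericG n).mul_mem ((genericG n).mul_mem ((genericG n).mul_mem hg.1 hk.1)
      ((genericG n).inv_mem hg.1)) ((genericG n).inv_mem hk.1), ?_⟩
    obtain ⟨l, hl, rfl⟩ := exists_even_genericWord hn hg
    obtain ⟨m, hm, rfl⟩ := exists_even_genericWord hn hk
    change _ = _
    rw [map_commutatorElement, commutatorElement_eq_one_iff_mul_comm]
    ext1 v
    have key : ∀ s : ℂ, s ^ 2 = -1 → genericCoord n s ((AffineEquiv.linearHom (genericWord l) *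
        AffineEquiv.linearHom (genericWord m)) v) = genericCoord n s
        ((AffineEquiv.linearHom (genericWord m) * AffineEquiv.linearHom (genericWord l)) v) := by
      intro s hs
      rw [LinearEquiv.mul_apply, LinearEquiv.mul_apply]
      simp only [genericCoord_word hn _ hs, hl.neg_one_pow, hm.neg_one_pow, one_mul]
      ring
    exact genericCoord_ext (key _ Complex.I_sq) (key _ (by rw [neg_sq, Complex.I_sq]))

end Generic
end
noncomputable section

namespace NGon

variable {n : ℕ} (P : NGon n)

/-! ### Topology of a polygon and its edges -/

/-- The vector from the initial to the terminal vertex of the `i`-th edge. -/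
def dir (i : Fin n) : ℂ := P.vertex (finRotate n i) - P.vertex i

/-- The closed `i`-th edge. -/
def side (i : Fin n) : Set ℂ := segment ℝ (P.vertex i) (P.vertex (finRotate n i))

/-- The affine parametrization of the `i`-th edge. -/
def point (i : Fin n) (s : ℝ) : ℂ := AffineMap.lineMap (P.vertex i) (P.vertex (finRotate n i)) s

theorem point_eq (i : Fin n) (s : ℝ) : P.point i s = P.vertex i + s * P.dir i := by
  rw [point, AffineMap.lineMap_apply, dir, vsub_eq_sub, vadd_eq_add, Complex.real_smul, add_comm]

theorem point_zero (i : Fin n) : P.point i 0 = P.vertex i := by simp [point]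

theorem point_one (i : Fin n) : P.point i 1 = P.vertex (finRotate n i) := by
  simp [point, -finRotate_apply]

theorem mem_side {i : Fin n} {z : ℂ} : z ∈ P.side i ↔ ∃ s ∈ Icc (0 : ℝ) 1, P.point i s = z := by
  rw [side, segment_eq_image_lineMap]
  rfl

theorem mem_edge {i : Fin n} {z : ℂ} : z ∈ P.edge i ↔ ∃ s ∈ Ioo (0 : ℝ) 1, P.point i s = z := by
  rw [edge, openSegment_eq_image_lineMap]
  rfl

theorem point_inj {i j : Fin n} {s t : ℝ} (hs : s ∈ Ico (0 : ℝ) 1) (ht : t ∈ Ico (0 : ℝ) 1)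
    (h : P.point i s = P.point j t) : i = j ∧ s = t := by
  have := @P.simple (i, ⟨s, hs⟩) (j, ⟨t, ht⟩) h
  simpa using this

theorem vertex_injective : Function.Injective P.vertex := fun i j h =>
  (P.point_inj (s := 0) (t := 0) (by simp) (by simp) (by rw [point_zero, point_zero, h])).1

theorem edge_subset_side (i : Fin n) : P.edge i ⊆ P.side i := openSegment_subset_segment ℝ _ _

theorem eq_of_mem_edge_of_mem_side {i j : Fin n} {z : ℂ} (hi : z ∈ P.edge i) (hj : z ∈ P.side j) :
    j = i := by
  obtain ⟨s, hs, rfl⟩ := P.mem_edge.1 hi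
  obtain ⟨t, ht, h⟩ := P.mem_side.1 hj
  rcases ht.2.lt_or_eq with h1 | rfl
  · exact (P.point_inj ⟨ht.1, h1⟩ ⟨hs.1.le, hs.2⟩ h).1
  · rw [point_one, ← point_zero] at h
    exact absurd (P.point_inj (by simp) ⟨hs.1.le, hs.2⟩ h).2 hs.1.ne

theorem edge_unique {i j : Fin n} {z : ℂ} (hi : z ∈ P.edge i) (hj : z ∈ P.edge j) : j = i :=
  P.eq_of_mem_edge_of_mem_side hi (P.edge_subset_side j hj)

theorem eq_or_eq_of_vertex_mem_side {i j : Fin n} (h : P.vertex i ∈ P.side j) :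
    j = i ∨ finRotate n j = i := by
  obtain ⟨t, ht, h⟩ := P.mem_side.1 h
  rw [← P.point_zero i] at h
  rcases ht.2.lt_or_eq with h1 | rfl
  · exact Or.inl (P.point_inj ⟨ht.1, h1⟩ (by simp) h).1
  · rw [point_one, ← point_zero] at h
    exact Or.inr (P.point_inj (by simp) (by simp) h).1

theorem vertex_not_mem_edge {i j : Fin n} (h : P.vertex j ∈ P.edge i) : False := by
  obtain ⟨s, hs, h⟩ := P.mem_edge.1 h
  rw [← point_zero] at h
  exact hs.1.ne' (P.point_inj ⟨hs.1.le, hs.2⟩ (by simp) h).2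

theorem dir_ne_zero (hn : 3 ≤ n) (i : Fin n) : P.dir i ≠ 0 :=
  sub_ne_zero.2 fun h => finRotate_ne hn i (P.vertex_injective h)

theorem frontier_eq_iUnion_side : frontier P.region = ⋃ i, P.side i := P.frontier_eq

theorem side_subset_frontier (i : Fin n) : P.side i ⊆ frontier P.region := by
  rw [frontier_eq_iUnion_side]
  exact subset_iUnion _ i

theorem vertex_mem_side (i : Fin n) : P.vertex i ∈ P.side i := left_mem_segment ℝ _ _

theorem isClosed_side (i : Fin n) : IsClosed (P.side i) := by
  rw [side, segment_eq_image_lineMap]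
  exact (isCompact_Icc.image AffineMap.lineMap_continuous).isClosed

theorem mem_frontier_iff {z : ℂ} :
    z ∈ frontier P.region ↔ (∃ i, z ∈ P.edge i) ∨ z ∈ range P.vertex := by
  constructor
  · intro h
    rw [frontier_eq_iUnion_side] at h
    obtain ⟨i, hi⟩ := mem_iUnion.1 h
    obtain ⟨s, hs, rfl⟩ := P.mem_side.1 hi
    rcases hs.1.lt_or_eq with h0 | rfl
    · rcases hs.2.lt_or_eq with h1 | rfl
      · exact Or.inl ⟨i, P.mem_edge.2 ⟨s, ⟨h0, h1⟩, rfl⟩⟩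
      · exact Or.inr ⟨_, (P.point_one i).symm⟩
    · exact Or.inr ⟨_, (P.point_zero i).symm⟩
  · rintro (⟨i, hi⟩ | ⟨i, rfl⟩)
    · exact P.side_subset_frontier i (P.edge_subset_side i hi)
    · exact P.side_subset_frontier i (P.vertex_mem_side i)

theorem isCompact_region : IsCompact P.region := by
  obtain ⟨h, -⟩ := P.disc
  have : CompactSpace (Metric.closedBall (0 : ℂ) 1) :=
    isCompact_iff_compactSpace.1 (isCompact_closedBall _ _)
  rw [isCompact_iff_compactSpace]
  exact h.compactSpace

theorem isClosed_region : IsClosed P.region := P.isCompact_region.isClosed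

theorem mem_interior_or_mem_frontier {z : ℂ} (hz : z ∈ P.region) :
    z ∈ interior P.region ∨ z ∈ frontier P.region := by
  by_cases h : z ∈ interior P.region
  · exact Or.inl h
  · exact Or.inr ⟨subset_closure hz, h⟩

theorem not_mem_frontier_of_mem_interior {z : ℂ} (hz : z ∈ interior P.region) :
    z ∉ frontier P.region := fun h => h.2 hz

theorem frontier_subset_region : frontier P.region ⊆ P.region :=
  P.isClosed_region.frontier_subset

theorem interior_eq_image (h : Metric.closedBall (0 : ℂ) 1 ≃ₜ P.region)
    (hh : ∀ z, (h z : ℂ) ∈ frontier P.region ↔ ‖(z : ℂ)‖ = 1) :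
    interior P.region = (fun z => (h z : ℂ)) '' {z | ‖(z : ℂ)‖ < 1} := by
  ext w
  constructor
  · intro hw
    refine ⟨h.symm ⟨w, interior_subset hw⟩, ?_, by simp⟩
    have h1 : ‖((h.symm ⟨w, interior_subset hw⟩ : Metric.closedBall (0 : ℂ) 1) : ℂ)‖ ≤ 1 :=
      mem_closedBall_zero_iff.1 (h.symm ⟨w, interior_subset hw⟩).2
    refine lt_of_le_of_ne h1 fun h2 => ?_
    rw [← hh] at h2
    exact P.not_mem_frontier_of_mem_interior hw (by simpa using h2)
  · rintro ⟨z, hz, rfl⟩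
    refine (P.mem_interior_or_mem_frontier (h z).2).resolve_right fun h2 => ?_
    rw [hh] at h2
    exact (ne_of_lt hz) h2

theorem isPreconnected_interior : IsPreconnected (interior P.region) := by
  obtain ⟨h, hh⟩ := P.disc
  rw [P.interior_eq_image h hh]
  have e : {z : Metric.closedBall (0 : ℂ) 1 | ‖(z : ℂ)‖ < 1} =
      Subtype.val ⁻¹' Metric.ball (0 : ℂ) 1 := by ext; simp
  refine IsPreconnected.image ?_ _ (by fun_prop)
  rw [e, Topology.IsInducing.subtypeVal.isPreconnected_image.symm, Subtype.image_preimage_coe,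
    inter_eq_right.2 Metric.ball_subset_closedBall]
  exact (convex_ball (0 : ℂ) 1).isPreconnected

theorem interior_nonempty : (interior P.region).Nonempty := by
  obtain ⟨h, hh⟩ := P.disc
  rw [P.interior_eq_image h hh]
  exact ⟨_, ⟨0, by simp⟩, by simp, rfl⟩

/-- The density of the open unit disc in the closed one, transported by the homeomorphism of `disc`.
-/
theorem closure_interior : closure (interior P.region) = P.region := by
  apply subset_antisymm (closure_minimal interior_subset P.isClosed_region)
  obtain ⟨h, hh⟩ := P.disc
  intro w hw
  rw [P.interior_eq_image h hh]
  have hd : (h.symm ⟨w, hw⟩) ∈ closure {z : Metric.closedBall (0 : ℂ) 1 | ‖(z : ℂ)‖ < 1} := by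
    rw [closure_subtype]
    have e : Subtype.val '' {z : Metric.closedBall (0 : ℂ) 1 | ‖(z : ℂ)‖ < 1} =
        Metric.ball (0 : ℂ) 1 := by
      ext z
      simp only [mem_image, mem_ofPred_eq, Subtype.exists, Metric.mem_closedBall, Metric.mem_ball,
        dist_zero_right, exists_and_left, exists_prop, exists_eq_right_right]
      exact ⟨fun h => h.1, fun h => ⟨h, h.le⟩⟩
    rw [e, closure_ball _ one_ne_zero]
    exact (h.symm ⟨w, hw⟩).2
  have := image_closure_subset_closure_image (f := fun z => (h z : ℂ)) (by fun_prop)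
    (mem_image_of_mem _ hd)
  simpa using this

/-- A connected set cannot pass from the interior to the complement of the closed region without
meeting the frontier. Membership in the interior is propagated by this device throughout. -/
theorem subset_interior_of_disjoint_frontier {s : Set ℂ} (hs : IsPreconnected s)
    (hd : Disjoint s (frontier P.region)) (hne : (s ∩ interior P.region).Nonempty) :
    s ⊆ interior P.region := by
  refine hs.subset_left_of_subset_union isOpen_interior P.isClosed_region.isOpen_compl
    (disjoint_compl_right.mono_left interior_subset) (fun z hz => ?_) hne
  by_cases h : z ∈ P.region
  · exact Or.inl ((P.mem_interior_or_mem_frontier h).resolve_right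
      (disjoint_left.1 hd hz))
  · exact Or.inr h

/-- The affine coordinate on the plane in which the `i`-th edge is the segment `[0, 1]`. -/
def coord (i : Fin n) (z : ℂ) : ℂ := (z - P.vertex i) / P.dir i

theorem coord_point (hn : 3 ≤ n) (i : Fin n) (s : ℝ) : P.coord i (P.point i s) = s := by
  rw [coord, point_eq, add_sub_cancel_left, mul_div_cancel_right₀ _ (P.dir_ne_zero hn i)]

theorem coord_eq_iff (hn : 3 ≤ n) (i : Fin n) (z : ℂ) (s : ℝ) :
    P.coord i z = s ↔ z = P.point i s := by
  rw [coord, point_eq, div_eq_iff (P.dir_ne_zero hn i), sub_eq_iff_eq_add']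

theorem eq_point_of_coord_im (hn : 3 ≤ n) {i : Fin n} {z : ℂ} (h : (P.coord i z).im = 0) :
    z = P.point i (P.coord i z).re := by
  rw [← P.coord_eq_iff hn]
  exact Complex.ext (by simp) (by simp [h])

theorem coord_im_of_mem_side (hn : 3 ≤ n) {i : Fin n} {z : ℂ} (h : z ∈ P.side i) :
    (P.coord i z).im = 0 := by
  obtain ⟨s, -, rfl⟩ := P.mem_side.1 h
  rw [P.coord_point hn, Complex.ofReal_im]

/-- Around a point of an edge, all other edges are at a positive distance. -/
theorem exists_ball_frontier (hn : 3 ≤ n) {i : Fin n} {z : ℂ} (hz : z ∈ P.edge i) :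
    ∃ r > 0, Metric.ball z r ∩ frontier P.region ⊆ {w | (P.coord i w).im = 0} := by
  have hc : IsClosed (⋃ j ∈ {j | j ≠ i}, P.side j) :=
    (toFinite _).isClosed_biUnion fun j _ => P.isClosed_side j
  have hz' : z ∈ (⋃ j ∈ {j | j ≠ i}, P.side j)ᶜ := by
    intro h
    simp only [mem_iUnion] at h
    obtain ⟨j, hj, h⟩ := h
    exact hj (P.eq_of_mem_edge_of_mem_side hz h)
  obtain ⟨r, hr, h⟩ := Metric.isOpen_iff.1 hc.isOpen_compl z hz'
  refine ⟨r, hr, fun w hw => ?_⟩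
  have hw2 := hw.2
  rw [frontier_eq_iUnion_side] at hw2
  obtain ⟨j, hj⟩ := mem_iUnion.1 hw2
  by_cases hji : j = i
  · subst hji
    exact P.coord_im_of_mem_side hn hj
  · exact absurd (mem_biUnion (show j ∈ {j | j ≠ i} from hji) hj) (h hw.1)

theorem convex_ball_inter_coord (i : Fin n) (z : ℂ) (r σ : ℝ) :
    Convex ℝ (Metric.ball z r ∩ {w | 0 < σ * (P.coord i w).im}) := by
  refine (convex_ball z r).inter fun x hx y hy a b ha hb hab => ?_
  simp only [mem_ofPred_eq] at hx hy ⊢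
  have hab' : (a : ℂ) + b = 1 := by exact_mod_cast hab
  have e : P.coord i (a • x + b • y) = a • P.coord i x + b • P.coord i y := by
    simp only [coord, Complex.real_smul]
    linear_combination (P.vertex i / P.dir i) * hab'
  rw [e, Complex.add_im, Complex.smul_im, Complex.smul_im, smul_eq_mul, smul_eq_mul]
  rcases ha.lt_or_eq with h | rfl
  · nlinarith [mul_pos h hx, mul_nonneg hb hy.le]
  · have : b = 1 := by linarith
    subst this
    simpa using hy

end NGon
end
noncomputable section

namespace NGon

variable {n : ℕ} (P : NGon n)

/-! ### A polygon is determined by its vertices -/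

/-- Interior points accumulate at z, and each open half disc is convex and misses the frontier; a
half disc that contains one interior point is therefore interior. Nothing is claimed about the other
half. -/
theorem half_ball_subset (hn : 3 ≤ n) {i : Fin n} {z : ℂ} (hz : z ∈ P.edge i) {r : ℝ} (hr : 0 < r)
    (hb : Metric.ball z r ∩ frontier P.region ⊆ {w | (P.coord i w).im = 0}) :
    ∃ σ : ℝ, (σ = 1 ∨ σ = -1) ∧
      Metric.ball z r ∩ {w | 0 < σ * (P.coord i w).im} ⊆ interior P.region := by
  have hzr : z ∈ closure (interior P.region) := by
    rw [P.closure_interior]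
    exact P.frontier_subset_region (P.side_subset_frontier i (P.edge_subset_side i hz))
  obtain ⟨w, hw, hwi⟩ := mem_closure_iff.1 hzr _ Metric.isOpen_ball (Metric.mem_ball_self hr)
  have ho : IsOpen (Metric.ball z r ∩ interior P.region) := Metric.isOpen_ball.inter isOpen_interior
  have hex : ∃ w' ∈ Metric.ball z r ∩ interior P.region, (P.coord i w').im ≠ 0 := by
    -- The interior is open, so an interior point on the line of the edge can be pushed off it.
    by_cases h0 : (P.coord i w).im = 0
    · have hc : Tendsto (fun ε : ℝ => w + ε * (Complex.I * P.dir i)) (𝓝[≠] 0) (𝓝 w) := by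
        have : Continuous fun ε : ℝ => w + ε * (Complex.I * P.dir i) := by fun_prop
        have := this.tendsto 0
        simp only [Complex.ofReal_zero, zero_mul, add_zero] at this
        exact this.mono_left nhdsWithin_le_nhds
      obtain ⟨ε, h1, h2⟩ := ((hc.eventually (ho.mem_nhds ⟨hw, hwi⟩)).and
        self_mem_nhdsWithin).exists
      refine ⟨_, h1, ?_⟩
      have e : P.coord i (w + ε * (Complex.I * P.dir i)) = P.coord i w + ε * Complex.I := by
        have := P.dir_ne_zero hn i
        simp only [coord]
        field_simp
        ring
      rw [e]
      simpa [h0] using h2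
    · exact ⟨w, ⟨hw, hwi⟩, h0⟩
  obtain ⟨w', ⟨hw', hwi'⟩, hne⟩ := hex
  have key : ∀ σ : ℝ, 0 < σ * (P.coord i w').im →
      Metric.ball z r ∩ {w | 0 < σ * (P.coord i w).im} ⊆ interior P.region := by
    intro σ hσ
    refine P.subset_interior_of_disjoint_frontier (P.convex_ball_inter_coord i z r σ).isPreconnected
      (disjoint_left.2 fun x hx hxf => ?_) ⟨w', ⟨hw', hσ⟩, hwi'⟩
    have h0 : (P.coord i x).im = 0 := hb ⟨hx.1, hxf⟩
    have h1 : 0 < σ * (P.coord i x).im := hx.2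
    rw [h0, mul_zero] at h1
    exact lt_irrefl _ h1
  rcases lt_or_gt_of_ne hne with h | h
  · exact ⟨-1, Or.inr rfl, key _ (by linarith)⟩
  · exact ⟨1, Or.inl rfl, key _ (by linarith)⟩

/-- If the interiors were disjoint, the two polygons would lie on opposite sides of each edge, and
their union W would be a neighbourhood of every edge point. The interior of W would then be open and
closed in the plane minus the vertices, which is connected, so the plane would be bounded. -/
theorem interior_inter_interior_nonempty (hn : 3 ≤ n) (Q : NGon n) (h : P.vertex = Q.vertex) :
    (interior P.region ∩ interior Q.region).Nonempty := by
  by_contra hemp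
  rw [not_nonempty_iff_eq_empty] at hemp
  have hside : ∀ i, P.side i = Q.side i := fun i => by rw [side, side, h]
  have hedge : ∀ i, P.edge i = Q.edge i := fun i => by rw [edge, edge, h]
  have hcoord : ∀ i, P.coord i = Q.coord i := fun i => by
    funext z; rw [coord, coord, dir, dir, h]
  have hfr : frontier P.region = frontier Q.region := by
    rw [frontier_eq_iUnion_side, frontier_eq_iUnion_side]
    exact iUnion_congr hside
  set W := P.region ∪ Q.region with hW
  have hWc : IsCompact W := P.isCompact_region.union Q.isCompact_region
  have hedgeW : ∀ i, ∀ z ∈ P.edge i, z ∈ interior W := by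
    intro i z hz
    obtain ⟨r, hr, hb⟩ := P.exists_ball_frontier hn hz
    obtain ⟨σ, hσ, hσP⟩ := P.half_ball_subset hn hz hr hb
    obtain ⟨ρ, hρ, hρQ⟩ := Q.half_ball_subset hn (hedge i ▸ hz) hr (by rwa [← hfr, ← hcoord])
    have hoff : Metric.ball z r ∩ {w | (P.coord i w).im ≠ 0} ⊆ W := by
      intro w hw
      have hw2 : (P.coord i w).im ≠ 0 := hw.2
      -- Equal signs would place the same nonempty half disc in both interiors.
      have hne : ρ = -σ := by
        by_contra hne
        have heq : ρ = σ := by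
          rcases hσ with rfl | rfl <;> rcases hρ with rfl | rfl <;> simp at hne ⊢
        rw [heq, ← hcoord] at hρQ
        have hmem : ∃ x, x ∈ Metric.ball z r ∩ {w | 0 < σ * (P.coord i w).im} := by
          have hc : Tendsto (fun ε : ℝ => z + ε * (σ * Complex.I * P.dir i)) (𝓝[>] 0) (𝓝 z) := by
            have : Continuous fun ε : ℝ => z + ε * (σ * Complex.I * P.dir i) := by fun_prop
            have := this.tendsto 0
            simp only [Complex.ofReal_zero, zero_mul, add_zero] at this
            exact this.mono_left nhdsWithin_le_nhds
          obtain ⟨ε, h1, h2⟩ := ((hc.eventually (Metric.ball_mem_nhds z hr)).and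
            self_mem_nhdsWithin).exists
          refine ⟨_, h1, ?_⟩
          have e : P.coord i (z + ε * (σ * Complex.I * P.dir i)) =
              P.coord i z + (ε * σ : ℝ) * Complex.I := by
            have := P.dir_ne_zero hn i
            simp only [coord]
            push_cast
            field_simp
            ring
          have h0 := P.coord_im_of_mem_side hn (P.edge_subset_side i hz)
          have hε : 0 < ε := h2
          change 0 < σ * (P.coord i (z + ε * (σ * Complex.I * P.dir i))).im
          rw [e, Complex.add_im, h0, Complex.mul_im, Complex.ofReal_re, Complex.ofReal_im,
            Complex.I_im, Complex.I_re]
          rcases hσ with rfl | rfl <;> simp [hε]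
        obtain ⟨x, hx⟩ := hmem
        have : x ∈ interior P.region ∩ interior Q.region := ⟨hσP hx, hρQ hx⟩
        rw [hemp] at this
        exact this
      rcases lt_or_ge 0 (σ * (P.coord i w).im) with h1 | h1
      · exact Or.inl (interior_subset (hσP ⟨hw.1, h1⟩))
      · refine Or.inr (interior_subset (hρQ ⟨hw.1, ?_⟩))
        rw [← hcoord, hne]
        have h3 : σ * (P.coord i w).im ≠ 0 := by
          refine mul_ne_zero ?_ hw2
          rcases hσ with rfl | rfl <;> norm_num
        change 0 < -σ * (P.coord i w).im
        rw [neg_mul]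
        exact neg_pos.2 (lt_of_le_of_ne h1 h3)
    rw [mem_interior]
    refine ⟨Metric.ball z r, fun w hw => ?_, Metric.isOpen_ball, Metric.mem_ball_self hr⟩
    -- Points on the line of the edge belong to W because they are limits of points off it and W is
    -- closed.
    by_cases h0 : (P.coord i w).im = 0
    · have hc : Tendsto (fun ε : ℝ => w + ε * (Complex.I * P.dir i)) (𝓝[≠] 0) (𝓝 w) := by
        have : Continuous fun ε : ℝ => w + ε * (Complex.I * P.dir i) := by fun_prop
        have := this.tendsto 0
        simp only [Complex.ofReal_zero, zero_mul, add_zero] at this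
        exact this.mono_left nhdsWithin_le_nhds
      refine hWc.isClosed.mem_of_tendsto hc ?_
      filter_upwards [hc.eventually (Metric.isOpen_ball.mem_nhds hw), self_mem_nhdsWithin]
        with ε h1 h2
      refine hoff ⟨h1, ?_⟩
      have e : P.coord i (w + ε * (Complex.I * P.dir i)) = P.coord i w + ε * Complex.I := by
        have := P.dir_ne_zero hn i
        simp only [coord]
        field_simp
        ring
      change (P.coord i (w + ε * (Complex.I * P.dir i))).im ≠ 0
      rw [e]
      simpa [h0] using h2
    · exact hoff ⟨hw, h0⟩
  have hrank : 1 < Module.rank ℝ ℂ := by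
    rw [Complex.rank_real_complex]
    exact Nat.one_lt_ofNat
  have hVc := ((finite_range P.vertex).countable.isConnected_compl_of_one_lt_rank hrank)
  have hsub : (range P.vertex)ᶜ ⊆ interior W := by
    refine hVc.isPreconnected.subset_left_of_subset_union isOpen_interior hWc.isClosed.isOpen_compl
      (disjoint_compl_right.mono_left interior_subset) (fun z hz => ?_) ?_
    · by_cases hzW : z ∈ W
      · left
        have hint : z ∈ interior P.region ∨ z ∈ interior Q.region ∨ z ∈ frontier P.region := by
          rcases hzW with h1 | h1
          · rcases P.mem_interior_or_mem_frontier h1 with h2 | h2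
            · exact Or.inl h2
            · exact Or.inr (Or.inr h2)
          · rcases Q.mem_interior_or_mem_frontier h1 with h2 | h2
            · exact Or.inr (Or.inl h2)
            · exact Or.inr (Or.inr (hfr ▸ h2))
        rcases hint with h1 | h1 | h1
        · exact interior_mono subset_union_left h1
        · exact interior_mono subset_union_right h1
        · rcases P.mem_frontier_iff.1 h1 with ⟨i, hi⟩ | h2
          · exact hedgeW i z hi
          · exact absurd h2 hz
      · exact Or.inr hzW
    · obtain ⟨z, hz⟩ := P.interior_nonempty
      refine ⟨z, fun h1 => ?_, interior_mono subset_union_left hz⟩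
      exact P.not_mem_frontier_of_mem_interior hz (P.mem_frontier_iff.2 (Or.inr h1))
  have hb : Bornology.IsBounded (univ : Set ℂ) := by
    rw [← compl_union_self (range P.vertex)]
    exact (hWc.isBounded.subset (hsub.trans interior_subset)).union
      (finite_range P.vertex).isBounded
  exact NormedSpace.unbounded_univ ℝ ℂ hb

/-- The interiors are connected, meet, and avoid the common frontier, so each contains the other.
This identifies an arbitrary polygon near P with the one obtained by deforming P. -/
theorem region_eq_of_vertex_eq (hn : 3 ≤ n) (Q : NGon n) (h : P.vertex = Q.vertex) :
    P.region = Q.region := by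
  have hfr : frontier P.region = frontier Q.region := by
    rw [frontier_eq_iUnion_side, frontier_eq_iUnion_side]
    exact iUnion_congr fun i => by rw [side, side, h]
  have hne := P.interior_inter_interior_nonempty hn Q h
  have h1 : interior P.region ⊆ interior Q.region :=
    Q.subset_interior_of_disjoint_frontier P.isPreconnected_interior
      (by rw [← hfr]; exact disjoint_interior_frontier) hne
  have h2 : interior Q.region ⊆ interior P.region :=
    P.subset_interior_of_disjoint_frontier Q.isPreconnected_interior
      (by rw [hfr]; exact disjoint_interior_frontier) (by rwa [inter_comm])
  rw [← P.closure_interior, ← Q.closure_interior, h1.antisymm h2]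

/-! ### Perturbation of the vertices -/

/-- The image of a polygon under a homeomorphism of the plane which is affine on the edges. -/
def mapHomeomorph (Φ : ℂ ≃ₜ ℂ) (q : Fin n → ℂ)
    (hΦ : ∀ i, ∀ s ∈ Icc (0 : ℝ) 1, Φ (P.point i s) = AffineMap.lineMap (q i) (q (finRotate n i)) s) :
    NGon n where
  vertex := q
  region := Φ '' P.region
  simple := by
    intro a b hab
    have ha := hΦ a.1 a.2 ⟨a.2.2.1, a.2.2.2.le⟩
    have hb := hΦ b.1 b.2 ⟨b.2.2.1, b.2.2.2.le⟩
    exact P.simple (Φ.injective (ha.trans (Eq.trans hab hb.symm)))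
  frontier_eq := by
    rw [← Φ.image_frontier, P.frontier_eq, image_iUnion]
    refine iUnion_congr fun i => ?_
    rw [segment_eq_image_lineMap, segment_eq_image_lineMap, image_image]
    exact image_congr (hΦ i)
  disc := by
    obtain ⟨h, hh⟩ := P.disc
    refine ⟨h.trans (Φ.image P.region), fun z => ?_⟩
    rw [← hh, ← Φ.image_frontier]
    exact Φ.injective.mem_set_image

/-- Consecutive edges do not fold back on each other, so the distance between points on them
controls the sum of the distances to the shared vertex. By homogeneity, κ is the minimum over s + t
= 1. -/
theorem exists_angle_bound (hn : 3 ≤ n) (i : Fin n) : ∃ κ > 0, ∀ s t : ℝ, 0 ≤ s → 0 ≤ t →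
    κ * (s + t) ≤ ‖(s : ℂ) * P.dir i + t * P.dir (finRotate n i)‖ := by
  obtain ⟨s, hs, hmin⟩ := (isCompact_Icc (a := (0 : ℝ)) (b := 1)).exists_isMinOn ⟨0, by simp⟩
    (f := fun s : ℝ => ‖(s : ℂ) * P.dir i + (1 - s : ℝ) * P.dir (finRotate n i)‖)
    (by fun_prop)
  refine ⟨‖(s : ℂ) * P.dir i + (1 - s : ℝ) * P.dir (finRotate n i)‖,
    norm_pos_iff.2 fun h0 => ?_, fun a b ha hb => ?_⟩
  · rcases hs.1.lt_or_eq with h1 | rfl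
    · rcases hs.2.lt_or_eq with h2 | rfl
      -- A vanishing convex combination of the two directions would make these two points of
      -- different edges coincide.
      · have e : P.point i (1 - s) = P.point (finRotate n i) (1 - s) := by
          have hd : P.dir i = P.vertex (finRotate n i) - P.vertex i := rfl
          rw [point_eq, point_eq]
          push_cast at h0 ⊢
          linear_combination hd - h0
        exact finRotate_ne hn i (P.point_inj ⟨by linarith, by linarith⟩
          ⟨by linarith, by linarith⟩ e).1.symm
      · simp at h0
        exact P.dir_ne_zero hn _ h0
    · simp [-finRotate_apply] at h0
      exact P.dir_ne_zero hn _ h0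
  · rcases (add_nonneg ha hb).eq_or_lt with h | h
    · rw [← h, mul_zero]
      exact norm_nonneg _
    · have hm : a / (a + b) ∈ Icc (0 : ℝ) 1 :=
        ⟨by positivity, by rw [div_le_one h]; linarith⟩
      have := hmin hm
      simp only [mem_ofPred_eq] at this
      rw [← le_div_iff₀ h]
      refine this.trans_eq ?_
      have hC : (a : ℂ) + b ≠ 0 := by exact_mod_cast h.ne'
      have e : (a : ℂ) * P.dir i + b * P.dir (finRotate n i) = ((a + b : ℝ) : ℂ) *
          (((a / (a + b) : ℝ) : ℂ) * P.dir i +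
            ((1 - a / (a + b) : ℝ) : ℂ) * P.dir (finRotate n i)) := by
        push_cast
        field_simp
        ring
      rw [e, norm_mul, Complex.norm_real, Real.norm_of_nonneg h.le, mul_div_cancel_left₀ _ h.ne']

/-- A function that is affine along the edges extends to a Lipschitz function on the plane. -/
theorem exists_lipschitz_extension (hn : 3 ≤ n) (y : Fin n → ℝ) :
    ∃ (K : NNReal) (τ : ℂ → ℝ), LipschitzWith K τ ∧ ∀ i, ∀ s ∈ Icc (0 : ℝ) 1,
      τ (P.point i s) = y i + s * (y (finRotate n i) - y i) := by
  obtain ⟨τ, hτ⟩ : ∃ τ : ℂ → ℝ, ∀ i, ∀ s ∈ Ico (0 : ℝ) 1,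
      τ (P.point i s) = y i + s * (y (finRotate n i) - y i) := by
    -- Simplicity of the curve is injectivity on half-open edges, so the prescribed values are
    -- consistent.
    refine ⟨Function.extend (fun p : Fin n × Ico (0 : ℝ) 1 => P.point p.1 p.2)
      (fun p => y p.1 + p.2 * (y (finRotate n p.1) - y p.1)) 0, fun i s hs => ?_⟩
    exact (show Function.Injective fun p : Fin n × Ico (0 : ℝ) 1 => P.point p.1 p.2 from
      P.simple).extend_apply _ _ (i, ⟨s, hs⟩)
  have hτ' : ∀ i, ∀ s ∈ Icc (0 : ℝ) 1,
      τ (P.point i s) = y i + s * (y (finRotate n i) - y i) := by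
    intro i s hs
    rcases hs.2.lt_or_eq with h | rfl
    · exact hτ i s ⟨hs.1, h⟩
    · rw [point_one, ← point_zero, hτ _ 0 (by simp)]
      ring
  -- Lipschitz on two consecutive edges
  have hpair : ∀ i, ∃ K : NNReal, LipschitzOnWith K τ (P.side i ∪ P.side (finRotate n i)) := by
    intro i
    obtain ⟨κ, hκ, hang⟩ := P.exists_angle_bound hn i
    have hone : ∀ j, ∀ s ∈ Icc (0 : ℝ) 1, ∀ t ∈ Icc (0 : ℝ) 1,
        |τ (P.point j s) - τ (P.point j t)| ≤
          |y (finRotate n j) - y j| / ‖P.dir j‖ * ‖P.point j s - P.point j t‖ := by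
      intro j s hs t ht
      have hd := norm_pos_iff.2 (P.dir_ne_zero hn j)
      have e1 : τ (P.point j s) - τ (P.point j t) = (s - t) * (y (finRotate n j) - y j) := by
        rw [hτ' j s hs, hτ' j t ht]
        ring
      have e2 : P.point j s - P.point j t = ((s - t : ℝ) : ℂ) * P.dir j := by
        rw [point_eq, point_eq]
        push_cast
        ring
      rw [e1, e2, abs_mul, norm_mul, Complex.norm_real, Real.norm_eq_abs]
      apply le_of_eq
      field_simp
    set M : ℝ := |y (finRotate n i) - y i| +
      |y (finRotate n (finRotate n i)) - y (finRotate n i)| with hM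
    have hM0 : 0 ≤ M := by positivity
    have htwo : ∀ s ∈ Icc (0 : ℝ) 1, ∀ t ∈ Icc (0 : ℝ) 1,
        |τ (P.point i s) - τ (P.point (finRotate n i) t)| ≤
          M / κ * ‖P.point i s - P.point (finRotate n i) t‖ := by
      intro s hs t ht
      have h1 := hang (1 - s) t (by linarith [hs.2]) ht.1
      have e1 : P.point i s - P.point (finRotate n i) t =
          -(((1 - s : ℝ) : ℂ) * P.dir i + t * P.dir (finRotate n i)) := by
        rw [point_eq, point_eq, dir]
        push_cast
        ring
      rw [e1, norm_neg]
      have e2 : τ (P.point i s) - τ (P.point (finRotate n i) t) =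
          -((1 - s) * (y (finRotate n i) - y i) +
            t * (y (finRotate n (finRotate n i)) - y (finRotate n i))) := by
        rw [hτ' i s hs, hτ' _ t ht]
        ring
      rw [e2, abs_neg]
      have h2 : |(1 - s) * (y (finRotate n i) - y i) +
            t * (y (finRotate n (finRotate n i)) - y (finRotate n i))| ≤ M * (1 - s + t) := by
        refine (abs_add_le _ _).trans ?_
        rw [abs_mul, abs_mul, abs_of_nonneg ht.1, abs_of_nonneg (show 0 ≤ 1 - s by linarith [hs.2])]
        have := mul_nonneg (abs_nonneg (y (finRotate n i) - y i)) ht.1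
        have := mul_nonneg (abs_nonneg (y (finRotate n (finRotate n i)) - y (finRotate n i)))
          (show 0 ≤ 1 - s by linarith [hs.2])
        rw [hM]
        linarith
      refine h2.trans ?_
      rw [div_mul_eq_mul_div, le_div_iff₀ hκ]
      calc M * (1 - s + t) * κ = M * (κ * (1 - s + t)) := by ring
        _ ≤ _ := by gcongr
    set K : ℝ := |y (finRotate n i) - y i| / ‖P.dir i‖ +
      |y (finRotate n (finRotate n i)) - y (finRotate n i)| / ‖P.dir (finRotate n i)‖ + M / κ
    have hK1 : |y (finRotate n i) - y i| / ‖P.dir i‖ ≤ K := by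
      have : 0 ≤ M / κ := by positivity
      have : 0 ≤ |y (finRotate n (finRotate n i)) - y (finRotate n i)| /
        ‖P.dir (finRotate n i)‖ := by positivity
      linarith
    have hK2 : |y (finRotate n (finRotate n i)) - y (finRotate n i)| /
        ‖P.dir (finRotate n i)‖ ≤ K := by
      have : 0 ≤ M / κ := by positivity
      have : 0 ≤ |y (finRotate n i) - y i| / ‖P.dir i‖ := by positivity
      linarith
    have hK3 : M / κ ≤ K := by
      have : 0 ≤ |y (finRotate n i) - y i| / ‖P.dir i‖ := by positivity
      have : 0 ≤ |y (finRotate n (finRotate n i)) - y (finRotate n i)| /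
        ‖P.dir (finRotate n i)‖ := by positivity
      linarith
    have hK0 : 0 ≤ K := le_trans (by positivity) hK1
    refine ⟨⟨K, hK0⟩, LipschitzOnWith.of_dist_le_mul fun a ha b hb => ?_⟩
    rw [Real.dist_eq, dist_eq_norm]
    change _ ≤ K * _
    rcases ha with ha | ha <;> rcases hb with hb | hb <;>
      obtain ⟨s, hs, rfl⟩ := P.mem_side.1 ha <;> obtain ⟨t, ht, rfl⟩ := P.mem_side.1 hb
    · exact (hone i s hs t ht).trans (by gcongr)
    · exact (htwo s hs t ht).trans (by gcongr)
    · rw [abs_sub_comm, norm_sub_rev]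
      exact (htwo t ht s hs).trans (by gcongr)
    · exact (hone _ s hs t ht).trans (by gcongr)
  -- Near any of its points the frontier is contained in two consecutive edges. Compactness then
  -- gives a global Lipschitz constant, and a real Lipschitz function extends to the plane.
  have hloc : LocallyLipschitzOn (frontier P.region) τ := by
    have key : ∀ x ∈ frontier P.region, ∀ i, (∀ j, x ∈ P.side j → j = i ∨ j = finRotate n i) →
        ∃ K : NNReal, ∃ t ∈ 𝓝[frontier P.region] x, LipschitzOnWith K τ t := by
      intro x hx i hi
      obtain ⟨K, hK⟩ := hpair i
      refine ⟨K, P.side i ∪ P.side (finRotate n i), ?_, hK⟩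
      have hc : IsClosed (⋃ j ∈ {j | j ≠ i ∧ j ≠ finRotate n i}, P.side j) :=
        (toFinite _).isClosed_biUnion fun j _ => P.isClosed_side j
      have hx' : x ∈ (⋃ j ∈ {j | j ≠ i ∧ j ≠ finRotate n i}, P.side j)ᶜ := by
        intro h
        simp only [mem_iUnion] at h
        obtain ⟨j, hj, h⟩ := h
        rcases hi j h with h1 | h1
        · exact hj.1 h1
        · exact hj.2 h1
      filter_upwards [self_mem_nhdsWithin, nhdsWithin_le_nhds (hc.isOpen_compl.mem_nhds hx')]
        with z hz hz'
      rw [frontier_eq_iUnion_side] at hz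
      obtain ⟨j, hj⟩ := mem_iUnion.1 hz
      by_contra hcon
      rw [mem_union, not_or] at hcon
      refine hz' (mem_biUnion (show j ∈ {j | j ≠ i ∧ j ≠ finRotate n i} from ⟨?_, ?_⟩) hj)
      · rintro rfl; exact hcon.1 hj
      · rintro rfl; exact hcon.2 hj
    intro x hx
    rcases P.mem_frontier_iff.1 hx with ⟨i, hi⟩ | ⟨i, rfl⟩
    · exact key x hx i fun j hj => Or.inl (P.eq_of_mem_edge_of_mem_side hi hj)
    · obtain ⟨i, rfl⟩ := (finRotate n).surjective i
      refine key _ hx i fun j hj => ?_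
      rcases P.eq_or_eq_of_vertex_mem_side hj with h | h
      · exact Or.inr h
      · exact Or.inl ((finRotate n).injective h)
  have hfc : IsCompact (frontier P.region) :=
    P.isCompact_region.of_isClosed_subset isClosed_frontier P.frontier_subset_region
  obtain ⟨K, hK⟩ := hloc.exists_lipschitzOnWith_of_compact hfc
  obtain ⟨g, hg, hgτ⟩ := hK.extend_real
  exact ⟨K, g, hg, fun i s hs => (hgτ (P.side_subset_frontier i (P.mem_side.2 ⟨s, hs, rfl⟩))).symm.trans
    (hτ' i s hs)⟩

/-- Polygons near `P` are images of `P` under homeomorphisms of the plane near the identity. -/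
theorem exists_homeomorph (hn : 3 ≤ n) : ∃ Ψ : (Fin n → ℂ) → ℂ → ℂ,
    Continuous (fun p : (Fin n → ℂ) × ℂ => Ψ p.1 p.2) ∧ (∀ z, Ψ P.vertex z = z) ∧
    ∀ᶠ q in 𝓝 P.vertex, ∃ Φ : ℂ ≃ₜ ℂ, (∀ z, Φ z = Ψ q z) ∧
      (∀ z w, dist z w ≤ 2 * dist (Φ z) (Φ w)) ∧
      ∀ i, ∀ s ∈ Icc (0 : ℝ) 1, Φ (P.point i s) = AffineMap.lineMap (q i) (q (finRotate n i)) s := by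
  choose K τ hτ hτp using fun j => P.exists_lipschitz_extension hn (Pi.single j 1)
  -- On the boundary, `τ j` is the hat function of vertex j, so Ψ q interpolates the displacements
  -- of the vertices linearly along the edges.
  let Ψ : (Fin n → ℂ) → ℂ → ℂ := fun q z => z + ∑ j, (τ j z : ℂ) * (q j - P.vertex j)
  have hτc : ∀ j, Continuous (τ j) := fun j => (hτ j).continuous
  refine ⟨Ψ, by fun_prop, fun z => by simp [Ψ], ?_⟩
  -- A displacement with Lipschitz constant 1/2 < 1 leaves Ψ q a homeomorphism; the value 1/2 also
  -- yields the factor 2 in the expansion bound.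
  have hsmall : ∀ᶠ q in 𝓝 P.vertex, ∑ j, (K j : ℝ) * ‖q j - P.vertex j‖ < 1 / 2 := by
    have hc : Continuous fun q : Fin n → ℂ => ∑ j, (K j : ℝ) * ‖q j - P.vertex j‖ := by fun_prop
    refine hc.tendsto' _ 0 (by simp) |>.eventually (gt_mem_nhds (by norm_num))
  filter_upwards [hsmall] with q hq
  have hlip : ∀ z w, ‖(Ψ q z - Ψ q w) - (z - w)‖ ≤ 1 / 2 * ‖z - w‖ := by
    intro z w
    have e : (Ψ q z - Ψ q w) - (z - w) = ∑ j, ((τ j z - τ j w : ℝ) : ℂ) * (q j - P.vertex j) := by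
      have : ∀ j, ((τ j z - τ j w : ℝ) : ℂ) * (q j - P.vertex j) =
          (τ j z : ℂ) * (q j - P.vertex j) - (τ j w : ℂ) * (q j - P.vertex j) := by
        intro j
        push_cast
        ring
      rw [Finset.sum_congr rfl fun j _ => this j, Finset.sum_sub_distrib]
      ring
    rw [e]
    calc _ ≤ ∑ j, ‖((τ j z - τ j w : ℝ) : ℂ) * (q j - P.vertex j)‖ := norm_sum_le _ _
      _ ≤ ∑ j, ((K j : ℝ) * ‖q j - P.vertex j‖) * ‖z - w‖ := by
        refine Finset.sum_le_sum fun j _ => ?_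
        rw [norm_mul, Complex.norm_real]
        have := (hτ j).dist_le_mul z w
        rw [Real.dist_eq, dist_eq_norm] at this
        calc _ ≤ (K j * ‖z - w‖) * ‖q j - P.vertex j‖ := by gcongr; exact this
          _ = _ := by ring
      _ = (∑ j, (K j : ℝ) * ‖q j - P.vertex j‖) * ‖z - w‖ := by rw [Finset.sum_mul]
      _ ≤ _ := by gcongr
  have happrox : ApproximatesLinearOn (Ψ q) ((ContinuousLinearEquiv.refl ℝ ℂ : ℂ ≃L[ℝ] ℂ) : ℂ →L[ℝ] ℂ)
      univ (1 / 2 : NNReal) := by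
    intro z _ w _
    simpa using hlip z w
  have hcond : Subsingleton ℂ ∨ (1 / 2 : NNReal) <
      ‖((ContinuousLinearEquiv.refl ℝ ℂ : ℂ ≃L[ℝ] ℂ).symm : ℂ →L[ℝ] ℂ)‖₊⁻¹ := by
    right
    have : ((ContinuousLinearEquiv.refl ℝ ℂ : ℂ ≃L[ℝ] ℂ).symm : ℂ →L[ℝ] ℂ) =
      ContinuousLinearMap.id ℝ ℂ := rfl
    rw [this, ContinuousLinearMap.nnnorm_id, inv_one]
    exact NNReal.half_lt_self one_ne_zero
  refine ⟨happrox.toHomeomorph _ hcond, fun z => rfl, fun z w => ?_, fun i s hs => ?_⟩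
  · change dist z w ≤ 2 * dist (Ψ q z) (Ψ q w)
    rw [dist_eq_norm, dist_eq_norm]
    have h1 := hlip z w
    have h2 := norm_sub_norm_le (z - w) (Ψ q z - Ψ q w)
    rw [norm_sub_rev (z - w)] at h2
    linarith
  · change Ψ q (P.point i s) = _
    have e : ∀ j, (τ j (P.point i s) : ℂ) * (q j - P.vertex j) =
        (1 - s) * (if j = i then q j - P.vertex j else 0) +
          s * (if j = finRotate n i then q j - P.vertex j else 0) := by
      intro j
      rw [hτp j i s hs]
      simp only [Pi.single_apply, eq_comm (a := i), eq_comm (a := finRotate n i)]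
      split_ifs <;> push_cast <;> ring
    simp only [Ψ]
    rw [Finset.sum_congr rfl fun j _ => e j, Finset.sum_add_distrib, ← Finset.mul_sum,
      ← Finset.mul_sum, Finset.sum_ite_eq' , Finset.sum_ite_eq', if_pos (Finset.mem_univ _),
      if_pos (Finset.mem_univ _), point_eq, AffineMap.lineMap_apply, dir, vsub_eq_sub, vadd_eq_add,
      Complex.real_smul]
    ring

/-- There are polygons with arbitrary vertices near those of `P`. -/
theorem eventually_exists_ngon (hn : 3 ≤ n) :
    ∀ᶠ q in 𝓝 P.vertex, ∃ Q : NGon n, Q.vertex = q := by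
  obtain ⟨Ψ, -, -, h⟩ := P.exists_homeomorph hn
  filter_upwards [h] with q hq
  obtain ⟨Φ, -, -, hΦ⟩ := hq
  exact ⟨P.mapHomeomorph Φ q hΦ, rfl⟩

/-- A point in the interior of `P` is in the interior of all polygons near `P`. -/
theorem eventually_mem_interior (hn : 3 ≤ n) {z : ℂ} (hz : z ∈ interior P.region) :
    ∀ᶠ p : (Fin n → ℂ) × ℂ in 𝓝 (P.vertex, z), ∀ Q : NGon n, Q.vertex = p.1 →
      p.2 ∈ interior Q.region := by
  obtain ⟨Ψ, hΨ, hid, h⟩ := P.exists_homeomorph hn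
  obtain ⟨r, hr, hb⟩ := Metric.isOpen_iff.1 isOpen_interior z hz
  have hsmall : ∀ᶠ p : (Fin n → ℂ) × ℂ in 𝓝 (P.vertex, z), 2 * dist p.2 (Ψ p.1 z) < r := by
    have hc : Continuous fun p : (Fin n → ℂ) × ℂ => 2 * dist p.2 (Ψ p.1 z) :=
      continuous_const.mul (continuous_snd.dist (hΨ.comp (continuous_fst.prodMk continuous_const)))
    exact (hc.tendsto' _ 0 (by simp [hid])).eventually (gt_mem_nhds hr)
  filter_upwards [hsmall, (continuous_fst.tendsto (P.vertex, z)).eventually h] with p hp hq Q hQ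
  obtain ⟨Φ, hΦ, hexp, hp'⟩ := hq
  -- The region of Q is the image of P, so it remains to see that the preimage of p.2 is within r of
  -- z.
  rw [← (P.mapHomeomorph Φ p.1 hp').region_eq_of_vertex_eq hn Q hQ.symm]
  change p.2 ∈ interior (Φ '' P.region)
  rw [← Φ.image_interior]
  refine ⟨Φ.symm p.2, hb ?_, Φ.apply_symm_apply _⟩
  rw [Metric.mem_ball]
  have := hexp (Φ.symm p.2) z
  rw [Φ.apply_symm_apply, hΦ z] at this
  linarith

end NGon
end
noncomputable section

/-! ### Bi-infinite increasing sequences of times -/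

/-- Translation by T permutes the times and induces an order automorphism of ℤ, which can only be a
shift. -/
theorem exists_shift {t : ℤ → ℝ} (ht : StrictMono t) {T : ℝ} (hT : 0 < T)
    (h1 : ∀ k, ∃ m, t m = t k + T) (h2 : ∀ k, ∃ m, t m + T = t k) :
    ∃ M : ℕ, 0 < M ∧ ∀ k, t (k + M) = t k + T := by
  choose σ hσ using h1
  have hmono : StrictMono σ := fun a b hab => by
    rw [← ht.lt_iff_lt, hσ, hσ]
    linarith [ht hab]
  have hsurj : Function.Surjective σ := fun k => by
    obtain ⟨m, hm⟩ := h2 k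
    exact ⟨m, ht.injective (by rw [hσ, hm])⟩
  let e : ℤ ≃o ℤ := hmono.orderIsoOfSurjective σ hsurj
  have hstep : ∀ k, σ (k + 1) = σ k + 1 := fun k => by
    have := e.map_succ k
    rw [Order.succ_eq_add_one, Order.succ_eq_add_one] at this
    exact this
  have hall : ∀ k, σ k = k + σ 0 := by
    intro k
    induction k using Int.induction_on with
    | zero => simp
    | succ i ih => rw [hstep, ih]; ring
    | pred i ih =>
      have := hstep (-(i : ℤ) - 1)
      rw [sub_add_cancel, ih] at this
      linarith
  have hpos : 0 < σ 0 := by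
    rw [← ht.lt_iff_lt, hσ]
    linarith
  refine ⟨(σ 0).toNat, by omega, fun k => ?_⟩
  rw [← hσ, hall k, Int.toNat_of_nonneg hpos.le]

section Shift

variable {t : ℤ → ℝ} {T : ℝ} {M : ℕ}

theorem shift_zsmul (h : ∀ k, t (k + M) = t k + T) (k j : ℤ) : t (k + j * M) = t k + j * T := by
  induction j using Int.induction_on with
  | zero => simp
  | succ i ih =>
    have := h (k + i * M)
    rw [ih] at this
    rw [show k + ((i : ℤ) + 1) * M = k + i * M + M by ring, this]
    push_cast
    ring
  | pred i ih =>
    have := h (k + (-(i : ℤ) - 1) * M)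
    rw [show k + (-(i : ℤ) - 1) * M + M = k + -(i : ℤ) * M by ring, ih] at this
    push_cast at this ⊢
    linarith

theorem exists_mem_Ico_of_shift (ht : StrictMono t) (hT : 0 < T)
    (h : ∀ k, t (k + M) = t k + T) (s : ℝ) : ∃ k, s ∈ Ico (t k) (t (k + 1)) := by
  obtain ⟨j, hj⟩ := exists_nat_gt ((s - t 0) / T)
  obtain ⟨i, hi⟩ := exists_nat_gt ((t 0 - s) / T)
  rw [div_lt_iff₀ hT] at hi hj
  have hub : ∀ z, t z ≤ s → z ≤ 0 + (j : ℤ) * M := fun z hz => by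
    rw [← ht.le_iff_le, shift_zsmul h]
    push_cast
    linarith
  have hne : t (0 + (-(i : ℤ)) * M) ≤ s := by
    rw [shift_zsmul h]
    push_cast
    linarith
  obtain ⟨k, hk, hmax⟩ := Int.exists_greatest_of_bdd ⟨_, hub⟩ ⟨_, hne⟩
  refine ⟨k, hk, ?_⟩
  by_contra hcon
  have := hmax _ (not_lt.1 hcon)
  omega

end Shift

/-! ### Local behaviour of billiard trajectories -/

namespace NGon

variable {n : ℕ} (P : NGon n)

open ComplexConjugate

/-- This multiplicative form turns composites of reflections into products of powers of the unit
complex numbers d / conj d. -/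
theorem edgeReflection_apply (hn : 3 ≤ n) (i : Fin n) (v : ℂ) :
    P.edgeReflection i v = P.dir i / conj (P.dir i) * conj v := by
  have hd := P.dir_ne_zero hn i
  have hd' : conj (P.dir i) ≠ 0 := (map_ne_zero _).2 hd
  rw [edgeReflection, Submodule.reflection_singleton_apply]
  change 2 • (inner ℝ (P.dir i) v / ((‖P.dir i‖ : ℝ) ^ 2 : ℝ)) • P.dir i - v = _
  have h1 : ((‖P.dir i‖ : ℝ) ^ 2 : ℂ) = P.dir i * conj (P.dir i) := by
    rw [Complex.mul_conj, Complex.normSq_eq_norm_sq]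
    push_cast
    rfl
  have h2 : ((inner ℝ (P.dir i) v : ℝ) : ℂ) = (conj (P.dir i) * v + P.dir i * conj v) / 2 := by
    rw [Complex.inner, Complex.re_eq_add_conj]
    simp
    ring
  rw [two_smul, Complex.real_smul]
  push_cast
  rw [h1, h2]
  field_simp
  ring

variable {P} {f : ℝ → ℂ}

namespace IsTrajectory

theorem mem_edge_of_mem_frontier (hf : P.IsTrajectory f) {t : ℝ} (h : f t ∈ frontier P.region) :
    ∃ i, f t ∈ P.edge i := by
  rcases P.mem_frontier_iff.1 h with h | ⟨i, hi⟩
  · exact h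
  · exact absurd hi.symm (hf.ne_vertex t i)

theorem continuous (hf : P.IsTrajectory f) : Continuous f := by
  rw [continuous_iff_continuousAt]
  intro t
  have hlin : ∀ v : ℂ, Continuous fun s : ℝ => f t + (s - t) • v := fun v => by fun_prop
  have hlim : ∀ v : ℂ, Tendsto (fun s : ℝ => f t + (s - t) • v) (𝓝 t) (𝓝 (f t)) := fun v =>
    (hlin v).tendsto' _ _ (by simp)
  rcases P.mem_interior_or_mem_frontier (hf.mem t) with h | h
  · obtain ⟨v, -, hv⟩ := hf.free t h
    exact (hlim v).congr' (hv.mono fun s hs => hs.symm)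
  · obtain ⟨i, hi⟩ := hf.mem_edge_of_mem_frontier h
    obtain ⟨v, -, h1, h2⟩ := hf.bounce t i hi
    rw [continuousAt_iff_continuous_left_right]
    exact ⟨((hlim _).mono_left nhdsWithin_le_nhds).congr' (h1.mono fun s hs => hs.symm),
      ((hlim _).mono_left nhdsWithin_le_nhds).congr' (h2.mono fun s hs => hs.symm)⟩

theorem not_forall_linear (hf : P.IsTrajectory f) {v : ℂ} (hv : v ≠ 0)
    (h : ∀ s, f s = f 0 + s • v) : False := by
  obtain ⟨R, hR⟩ := P.isCompact_region.isBounded.exists_norm_le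
  have h1 := hR _ (hf.mem ((R + ‖f 0‖ + 1) / ‖v‖))
  rw [h] at h1
  have hv' := norm_pos_iff.2 hv
  have hR0 : 0 ≤ R := (norm_nonneg _).trans h1
  have h2 := norm_sub_le (f 0 + ((R + ‖f 0‖ + 1) / ‖v‖) • v) (f 0)
  rw [add_sub_cancel_left, norm_smul, Real.norm_of_nonneg (by positivity),
    div_mul_cancel₀ _ hv'.ne'] at h2
  linarith

theorem velocity_unique {v v' : ℂ} {F : Filter ℝ} [F.NeBot] (t : ℝ) (hF : F ≤ 𝓝[≠] t)
    (h1 : ∀ᶠ s in F, f s = f t + (s - t) • v) (h2 : ∀ᶠ s in F, f s = f t + (s - t) • v') :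
    v = v' := by
  obtain ⟨s, ⟨h1, h2⟩, h3⟩ := ((h1.and h2).and (hF self_mem_nhdsWithin)).exists
  rw [h1] at h2
  exact smul_right_injective ℂ (sub_ne_zero.2 h3) (add_left_cancel h2)

theorem nhdsLT_le (t : ℝ) : 𝓝[<] t ≤ 𝓝[≠] t := nhdsWithin_mono _ fun _ h => ne_of_lt h
theorem nhdsGT_le (t : ℝ) : 𝓝[>] t ≤ 𝓝[≠] t := nhdsWithin_mono _ fun _ h => ne_of_gt h

/-- A trajectory strikes the edges transversally. -/
theorem transversal (hn : 3 ≤ n) (hf : P.IsTrajectory f) {t : ℝ} {i : Fin n} (hi : f t ∈ P.edge i)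
    {v : ℂ} (hv : v ≠ 0) (h1 : ∀ᶠ s in 𝓝[≤] t, f s = f t + (s - t) • v)
    (h2 : ∀ᶠ s in 𝓝[≥] t, f s = f t + (s - t) • P.edgeReflection i v) :
    (v / P.dir i).im ≠ 0 := by
  intro h0
  have hd := P.dir_ne_zero hn i
  have hd' : conj (P.dir i) ≠ 0 := (map_ne_zero _).2 hd
  obtain ⟨r, hr⟩ : ∃ r : ℝ, v = r * P.dir i :=
    ⟨(v / P.dir i).re, by rw [← div_eq_iff hd]; exact Complex.ext (by simp) (by simp [h0])⟩
  have hrefl : P.edgeReflection i v = v := by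
    rw [edgeReflection_apply P hn, hr, map_mul, Complex.conj_ofReal]
    field_simp
  -- These are the times at which f glides along edge i. The set is open, and it is closed because f
  -- cannot leave the edge through a vertex. So f would glide forever, which is impossible in a
  -- bounded region.
  let U : Set ℝ := {t | f t ∈ P.edge i ∧ ∀ᶠ s in 𝓝 t, f s = f t + (s - t) • v}
  have hUo : IsOpen U := by
    rw [isOpen_iff_mem_nhds]
    rintro t ⟨h1, h2⟩
    obtain ⟨x, hx, hxt⟩ := P.mem_edge.1 h1
    have h3 : ∀ᶠ s in 𝓝 t, x + (s - t) * r ∈ Ioo (0 : ℝ) 1 := by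
      have : Continuous fun s : ℝ => x + (s - t) * r := by fun_prop
      exact (this.tendsto' t x (by simp)).eventually (isOpen_Ioo.mem_nhds hx)
    filter_upwards [h2, h2.eventually_nhds, h3] with s hs hs' hs3
    refine ⟨P.mem_edge.2 ⟨_, hs3, ?_⟩, ?_⟩
    · rw [hs, ← hxt, point_eq, point_eq, hr, Complex.real_smul]
      push_cast
      ring
    · filter_upwards [hs'] with s' hs'
      rw [hs', hs, add_assoc, ← add_smul]
      congr 2
      ring
  have hUc : IsClosed U := by
    rw [← closure_subset_iff_isClosed]
    intro t ht
    have hside : f t ∈ P.side i := by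
      refine closure_minimal (s := U) (t := f ⁻¹' P.side i) (fun s hs => P.edge_subset_side i hs.1)
        ((P.isClosed_side i).preimage hf.continuous) ht
    obtain ⟨j, hj⟩ := hf.mem_edge_of_mem_frontier (P.side_subset_frontier i hside)
    obtain rfl := P.eq_of_mem_edge_of_mem_side hj hside
    obtain ⟨v', -, h1, h2⟩ := hf.bounce t i hj
    by_cases htU : t ∈ U
    · exact htU
    have hv' : v' = v := by
      have hfreq : ∃ᶠ s in 𝓝 t, s ∈ U := mem_closure_iff_frequently.1 ht
      rw [eventually_nhdsWithin_iff] at h1 h2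
      obtain ⟨s, hsU, h1, h2⟩ := (hfreq.and_eventually
        (h1.eventually_nhds.and h2.eventually_nhds)).exists
      have hst : s ≠ t := fun h => htU (h ▸ hsU)
      rcases lt_or_gt_of_ne hst with hlt | hgt
      · have h3 : ∀ᶠ x in 𝓝 s, f x = f s + (x - s) • v' := by
          filter_upwards [h1, gt_mem_nhds hlt] with x hx hxt
          rw [hx hxt.le, h1.self_of_nhds hlt.le, add_assoc, ← add_smul]
          congr 2
          ring
        exact velocity_unique s le_rfl (h3.filter_mono nhdsWithin_le_nhds)
          (hsU.2.filter_mono nhdsWithin_le_nhds)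
      · have h3 : ∀ᶠ x in 𝓝 s, f x = f s + (x - s) • P.edgeReflection i v' := by
          filter_upwards [h2, lt_mem_nhds hgt] with x hx hxt
          rw [hx hxt.le, h2.self_of_nhds hgt.le, add_assoc, ← add_smul]
          congr 2
          ring
        have := velocity_unique s le_rfl (h3.filter_mono nhdsWithin_le_nhds)
          (hsU.2.filter_mono nhdsWithin_le_nhds)
        rw [← hrefl] at this
        exact (P.edgeReflection i).injective this
    rw [hv'] at h1 h2
    rw [hrefl] at h2
    refine ⟨hj, ?_⟩
    rw [← nhdsLE_sup_nhdsGE]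
    exact eventually_sup.2 ⟨h1, h2⟩
  have htU : t ∈ U := by
    rw [hrefl] at h2
    refine ⟨hi, ?_⟩
    rw [← nhdsLE_sup_nhdsGE]
    exact eventually_sup.2 ⟨h1, h2⟩
  have huniv : U = univ := IsClopen.eq_univ ⟨hUc, hUo⟩ ⟨t, htU⟩
  have hder : ∀ s, HasDerivAt (fun s : ℝ => f s - s • v) 0 s := by
    intro s
    have hs : s ∈ U := huniv ▸ mem_univ s
    have : (fun x : ℝ => f x - x • v) =ᶠ[𝓝 s] fun _ => f s - s • v := by
      filter_upwards [hs.2] with x hx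
      rw [hx, sub_smul]
      abel
    exact (hasDerivAt_const s _).congr_of_eventuallyEq this
  have hconst := is_const_of_deriv_eq_zero (fun s => (hder s).differentiableAt)
    (fun s => (hder s).deriv)
  refine hf.not_forall_linear hv fun s => ?_
  have := hconst s 0
  simp only [zero_smul, sub_zero] at this
  rw [← this]
  abel

/-- By transversality, the coordinate normal to the edge is nonzero just before and just after a
hit, while the nearby frontier lies on the line of the edge. Hits are thus isolated. -/
theorem eventually_mem_interior (hn : 3 ≤ n) (hf : P.IsTrajectory f) (t : ℝ) :
    ∀ᶠ s in 𝓝[≠] t, f s ∈ interior P.region := by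
  rcases P.mem_interior_or_mem_frontier (hf.mem t) with h | h
  · exact nhdsWithin_le_nhds (hf.continuous.continuousAt (isOpen_interior.mem_nhds h))
  · obtain ⟨i, hi⟩ := hf.mem_edge_of_mem_frontier h
    obtain ⟨v, hv, h1, h2⟩ := hf.bounce t i hi
    have htr := hf.transversal hn hi hv h1 h2
    obtain ⟨r, hr, hb⟩ := P.exists_ball_frontier hn hi
    have hd := P.dir_ne_zero hn i
    have hd' : conj (P.dir i) ≠ 0 := (map_ne_zero _).2 hd
    have htr' : (P.edgeReflection i v / P.dir i).im ≠ 0 := by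
      rw [edgeReflection_apply P hn, div_mul_eq_mul_div, div_right_comm,
        mul_div_cancel_left₀ _ hd, ← map_div₀, Complex.conj_im]
      exact neg_ne_zero.2 htr
    have hball : ∀ᶠ s in 𝓝 t, f s ∈ Metric.ball (f t) r :=
      hf.continuous.continuousAt (Metric.ball_mem_nhds _ hr)
    have key : ∀ v : ℂ, (v / P.dir i).im ≠ 0 → ∀ s, s ≠ t → f s = f t + (s - t) • v →
        f s ∈ Metric.ball (f t) r → f s ∈ interior P.region := by
      intro v hv s hs hfs hbs
      refine (P.mem_interior_or_mem_frontier (hf.mem s)).resolve_right fun hfr => ?_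
      have h0 : (P.coord i (f s)).im = 0 := hb ⟨hbs, hfr⟩
      have e : P.coord i (f s) = P.coord i (f t) + ((s - t : ℝ) : ℂ) * (v / P.dir i) := by
        rw [hfs, coord, coord, Complex.real_smul]
        ring
      rw [e, Complex.add_im, P.coord_im_of_mem_side hn (P.edge_subset_side i hi),
        Complex.im_ofReal_mul, zero_add] at h0
      exact (mul_ne_zero (sub_ne_zero.2 hs) hv) h0
    rw [← nhdsLT_sup_nhdsGT]
    refine eventually_sup.2 ⟨?_, ?_⟩
    · filter_upwards [h1.filter_mono (nhdsWithin_mono _ Iio_subset_Iic_self),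
        nhdsWithin_le_nhds hball, self_mem_nhdsWithin] with s hs hbs hst
      exact key v htr s (ne_of_lt hst) hs hbs
    · filter_upwards [h2.filter_mono (nhdsWithin_mono _ Ioi_subset_Ici_self),
        nhdsWithin_le_nhds hball, self_mem_nhdsWithin] with s hs hbs hst
      exact key _ htr' s (ne_of_gt hst) hs hbs

theorem finite_hits (hn : 3 ≤ n) (hf : P.IsTrajectory f) (a b : ℝ) :
    ({s | f s ∈ frontier P.region} ∩ Icc a b).Finite := by
  by_contra hinf
  obtain ⟨t, -, ht⟩ := Set.Infinite.exists_accPt_of_subset_isCompact hinf isCompact_Icc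
    inter_subset_right
  rw [accPt_iff_frequently_nhdsNE] at ht
  obtain ⟨s, hs, hsi⟩ := (ht.and_eventually (hf.eventually_mem_interior hn t)).exists
  exact P.not_mem_frontier_of_mem_interior hsi hs.1

/-- Between two hits a trajectory is linear. -/
theorem linear_of_interior (hf : P.IsTrajectory f) {a b m : ℝ} (hm : m ∈ Ioo a b)
    (hint : ∀ s ∈ Ioo a b, f s ∈ interior P.region) {v : ℂ}
    (hv : ∀ᶠ s in 𝓝 m, f s = f m + (s - m) • v) :
    ∀ s ∈ Icc a b, f s = f m + (s - m) • v := by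
  have hderiv : ∀ t (v : ℂ), (∀ᶠ s in 𝓝 t, f s = f t + (s - t) • v) →
      ∀ᶠ s in 𝓝 t, HasDerivAt f v s := by
    intro t v h
    filter_upwards [h.eventually_nhds] with s hs
    have h1 : HasDerivAt (fun s : ℝ => f t + (s - t) • v) v s := by
      have := (((hasDerivAt_id s).sub_const t).smul_const v).const_add (f t)
      simpa using this
    exact h1.congr_of_eventuallyEq hs
  have hd : ∀ s ∈ Ioo a b, HasDerivAt f (deriv f s) s := fun s hs => by
    obtain ⟨v, -, h⟩ := hf.free s (hint s hs)
    exact (hderiv s v h).self_of_nhds.differentiableAt.hasDerivAt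
  have hdd : ∀ s ∈ Ioo a b, HasDerivAt (deriv f) 0 s := fun s hs => by
    obtain ⟨v, -, h⟩ := hf.free s (hint s hs)
    exact (hasDerivAt_const s v).congr_of_eventuallyEq ((hderiv s v h).mono fun x hx => hx.deriv)
  have hdv : ∀ s ∈ Ioo a b, deriv f s = v := fun s hs => by
    rw [← (hderiv m v hv).self_of_nhds.deriv]
    exact isOpen_Ioo.is_const_of_deriv_eq_zero isPreconnected_Ioo
      (fun x hx => (hdd x hx).differentiableAt.differentiableWithinAt)
      (fun x hx => (hdd x hx).deriv) hs hm
  have hlin : ∀ s ∈ Ioo a b, f s = f m + (s - m) • v := fun s hs => by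
    have hg : ∀ x ∈ Ioo a b, HasDerivAt (fun x : ℝ => f x - x • v) 0 x := fun x hx => by
      have := (hd x hx).sub ((hasDerivAt_id x).smul_const v)
      rw [hdv x hx, one_smul, sub_self] at this
      exact this
    have := isOpen_Ioo.is_const_of_deriv_eq_zero (f := fun x : ℝ => f x - x • v) isPreconnected_Ioo
      (fun x hx => (hg x hx).differentiableAt.differentiableWithinAt)
      (fun x hx => (hg x hx).deriv) hs hm
    have h3 : f s = f m - m • v + s • v := sub_eq_iff_eq_add.1 this
    rw [h3, sub_smul]
    abel
  have hab : a ≠ b := (hm.1.trans hm.2).ne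
  rw [← closure_Ioo hab]
  intro s hs
  have hcl : IsClosed {s | f s = f m + (s - m) • v} :=
    isClosed_eq hf.continuous (by fun_prop)
  exact closure_minimal hlin hcl hs

end IsTrajectory

end NGon
end
noncomputable section

namespace NGon

variable {n : ℕ} {P : NGon n} {f : ℝ → ℂ}

open ComplexConjugate

/-! ### The sequence of hits of a periodic trajectory -/

/-- `t` enumerates in increasing order the times at which `f` strikes the edges, and `w` lists the
edges that are struck. -/
structure IsHitSequence (P : NGon n) (f : ℝ → ℂ) (t : ℤ → ℝ) (w : ℤ → Fin n) : Prop where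
  strictMono : StrictMono t
  mem_edge : ∀ k, f (t k) ∈ P.edge (w k)
  exists_eq : ∀ s, f s ∈ frontier P.region → ∃ k, s = t k

theorem edge_subset_frontier (P : NGon n) (i : Fin n) : P.edge i ⊆ frontier P.region :=
  (P.edge_subset_side i).trans (P.side_subset_frontier i)

theorem IsPeriodicTrajectory.exists_hit (hf : P.IsPeriodicTrajectory f) :
    ∃ s, f s ∈ frontier P.region := by
  by_contra! hno
  have hint : ∀ s, f s ∈ interior P.region := fun s =>
    (P.mem_interior_or_mem_frontier (hf.1.mem s)).resolve_right (hno s)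
  obtain ⟨v, hv0, hv⟩ := hf.1.free 0 (hint 0)
  refine hf.1.not_forall_linear hv0 fun s => ?_
  have := hf.1.linear_of_interior (a := -|s| - 1) (b := |s| + 1) (m := 0)
    ⟨by linarith [abs_nonneg s], by linarith [abs_nonneg s]⟩ (fun x _ => hint x) hv s
    ⟨by linarith [neg_abs_le s], by linarith [le_abs_self s]⟩
  rwa [sub_zero] at this

/-- The set of hit times is nonempty, locally finite, and by periodicity without greatest or least
element, so it is order isomorphic to ℤ. -/
theorem IsPeriodicTrajectory.exists_hitSequence (hn : 3 ≤ n) (hf : P.IsPeriodicTrajectory f) :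
    ∃ t w, IsHitSequence P f t w := by
  let S : Set ℝ := {s | f s ∈ frontier P.region}
  obtain ⟨s₀, hs₀⟩ := hf.exists_hit
  have hper : ∀ s ∈ S, s + 1 ∈ S := fun s hs => by
    change f (s + 1) ∈ frontier P.region
    rw [hf.2 s]
    exact hs
  have hper' : ∀ s ∈ S, s - 1 ∈ S := fun s hs => by
    change f (s - 1) ∈ frontier P.region
    rw [hf.2.sub_eq s]
    exact hs
  have : Nonempty S := ⟨⟨s₀, hs₀⟩⟩
  have : NoMaxOrder S := ⟨fun a => ⟨⟨a + 1, hper a a.2⟩, Subtype.mk_lt_mk.2 (by simp)⟩⟩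
  have : NoMinOrder S := ⟨fun a => ⟨⟨a - 1, hper' a a.2⟩, Subtype.mk_lt_mk.2 (by simp)⟩⟩
  let : LocallyFiniteOrder S := LocallyFiniteOrder.ofFiniteIcc fun a b => by
    refine Finite.of_finite_image (f := Subtype.val) ?_ Subtype.val_injective.injOn
    refine (hf.1.finite_hits hn a b).subset ?_
    rintro _ ⟨x, hx, rfl⟩
    exact ⟨x.2, hx⟩
  let : SuccOrder S := LinearLocallyFiniteOrder.succOrder S
  let : PredOrder S := LinearLocallyFiniteOrder.predOrder S
  let e : S ≃o ℤ := orderIsoIntOfLinearSuccPredArch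
  have hedge : ∀ k, ∃ i, f (e.symm k : ℝ) ∈ P.edge i := fun k =>
    hf.1.mem_edge_of_mem_frontier (e.symm k).2
  choose w hw using hedge
  refine ⟨fun k => e.symm k, w, fun a b hab => e.symm.strictMono hab, hw, fun s hs => ?_⟩
  exact ⟨e ⟨s, hs⟩, by simp⟩

namespace IsHitSequence

variable {t : ℤ → ℝ} {w : ℤ → Fin n}

theorem exists_shift (h : IsHitSequence P f t w) {T : ℝ} (hT : 0 < T) (hf : Function.Periodic f T) :
    ∃ M : ℕ, 0 < M ∧ (∀ k, t (k + M) = t k + T) ∧ ∀ k, w (k + M) = w k := by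
  obtain ⟨M, hM, h1⟩ := _root_.exists_shift h.strictMono hT
    (fun k => by
      obtain ⟨m, hm⟩ := h.exists_eq (t k + T) (by
        rw [hf]
        exact P.edge_subset_frontier _ (h.mem_edge k))
      exact ⟨m, hm.symm⟩)
    (fun k => by
      obtain ⟨m, hm⟩ := h.exists_eq (t k - T) (by
        rw [hf.sub_eq]
        exact P.edge_subset_frontier _ (h.mem_edge k))
      exact ⟨m, by rw [← hm]; ring⟩)
  refine ⟨M, hM, h1, fun k => ?_⟩
  have := h.mem_edge (k + M)
  rw [h1, hf] at this
  exact P.edge_unique (h.mem_edge k) this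

theorem mem_interior (h : IsHitSequence P f t w) (hf : P.IsTrajectory f) {k : ℤ} {s : ℝ}
    (hs : s ∈ Ioo (t k) (t (k + 1))) : f s ∈ interior P.region := by
  refine (P.mem_interior_or_mem_frontier (hf.mem s)).resolve_right fun hfr => ?_
  obtain ⟨m, rfl⟩ := h.exists_eq s hfr
  have h1 := h.strictMono.lt_iff_lt.1 hs.1
  have h2 := h.strictMono.lt_iff_lt.1 hs.2
  omega

theorem exists_velocity (h : IsHitSequence P f t w) (hf : P.IsTrajectory f) :
    ∃ v : ℤ → ℂ, (∀ k, v k ≠ 0) ∧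
      (∀ k, ∀ s ∈ Icc (t k) (t (k + 1)), f s = f (t k) + (s - t k) • v k) ∧
      ∀ k, v (k + 1) = P.edgeReflection (w (k + 1)) (v k) := by
  have hlt : ∀ k, t k < t (k + 1) := fun k => h.strictMono (by omega)
  have hex : ∀ k, ∃ v : ℂ, v ≠ 0 ∧
      ∀ s ∈ Icc (t k) (t (k + 1)), f s = f (t k) + (s - t k) • v := by
    intro k
    have hm : (t k + t (k + 1)) / 2 ∈ Ioo (t k) (t (k + 1)) :=
      ⟨by linarith [hlt k], by linarith [hlt k]⟩
    obtain ⟨v, hv0, hv⟩ := hf.free _ (h.mem_interior hf hm)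
    have := hf.linear_of_interior hm (fun s hs => h.mem_interior hf hs) hv
    refine ⟨v, hv0, fun s hs => ?_⟩
    rw [this s hs, this (t k) ⟨le_rfl, (hlt k).le⟩, add_assoc, ← add_smul]
    congr 2
    ring
  choose v hv0 hv using hex
  refine ⟨v, hv0, hv, fun k => ?_⟩
  obtain ⟨u, -, h1, h2⟩ := hf.bounce _ _ (h.mem_edge (k + 1))
  have e1 : u = v k := by
    refine IsTrajectory.velocity_unique (t (k + 1)) (IsTrajectory.nhdsLT_le _)
      (h1.filter_mono (nhdsWithin_mono _ Iio_subset_Iic_self)) ?_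
    filter_upwards [Ioo_mem_nhdsLT (hlt k)] with s hs
    rw [hv k s ⟨hs.1.le, hs.2.le⟩, hv k (t (k + 1)) ⟨(hlt k).le, le_rfl⟩, add_assoc, ← add_smul]
    congr 2
    ring
  have e2 : P.edgeReflection (w (k + 1)) u = v (k + 1) := by
    refine IsTrajectory.velocity_unique (t (k + 1)) (IsTrajectory.nhdsGT_le _)
      (h2.filter_mono (nhdsWithin_mono _ Ioi_subset_Ici_self)) ?_
    filter_upwards [Ioo_mem_nhdsGT (hlt (k + 1))] with s hs
    exact hv (k + 1) s ⟨hs.1.le, hs.2.le⟩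
  rw [← e2, e1]

theorem transversal (hn : 3 ≤ n) (h : IsHitSequence P f t w) (hf : P.IsTrajectory f) {v : ℤ → ℂ}
    (hv : ∀ k, ∀ s ∈ Icc (t k) (t (k + 1)), f s = f (t k) + (s - t k) • v k) (k : ℤ) :
    (v k / P.dir (w k)).im ≠ 0 := by
  intro h0
  have hlt : t k < t (k + 1) := h.strictMono (by omega)
  have hcont : ∀ᶠ s in 𝓝[>] t k, f s ∈ interior P.region :=
    (hf.eventually_mem_interior hn (t k)).filter_mono (IsTrajectory.nhdsGT_le _)
  obtain ⟨x, hx, hxt⟩ := P.mem_edge.1 (h.mem_edge k)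
  have h3 : ∀ᶠ s in 𝓝[>] t k, x + (s - t k) * (v k / P.dir (w k)).re ∈ Ioo (0 : ℝ) 1 := by
    have : Continuous fun s : ℝ => x + (s - t k) * (v k / P.dir (w k)).re := by fun_prop
    exact nhdsWithin_le_nhds
      ((this.tendsto' (t k) x (by simp)).eventually (isOpen_Ioo.mem_nhds hx))
  obtain ⟨s, ⟨hs1, hs2⟩, hs3⟩ := ((hcont.and h3).and (Ioo_mem_nhdsGT hlt)).exists
  refine P.not_mem_frontier_of_mem_interior hs1 (P.edge_subset_frontier (w k)
    (P.mem_edge.2 ⟨_, hs2, ?_⟩))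
  have hd := P.dir_ne_zero hn (w k)
  have hr : v k = ((v k / P.dir (w k)).re : ℂ) * P.dir (w k) := by
    rw [← div_eq_iff hd]
    exact Complex.ext (by simp) (by simp [h0])
  rw [hv k s ⟨hs3.1.le, hs3.2.le⟩, ← hxt, point_eq, point_eq, Complex.real_smul]
  conv_rhs => rw [hr]
  push_cast
  ring

theorem transfer (h : IsHitSequence P f t w) {Q : NGon n} {g : ℝ → ℂ} (hg : Q.IsTrajectory g)
    {φ : ℝ ≃o ℝ} (hφ : ∀ t i, f t ∈ P.edge i ↔ g (φ t) ∈ Q.edge i) :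
    IsHitSequence Q g (φ ∘ t) w where
  strictMono := φ.strictMono.comp h.strictMono
  mem_edge k := (hφ _ _).1 (h.mem_edge k)
  exists_eq s hs := by
    obtain ⟨i, hi⟩ := hg.mem_edge_of_mem_frontier hs
    obtain ⟨x, rfl⟩ := φ.surjective s
    obtain ⟨k, rfl⟩ := h.exists_eq x (P.edge_subset_frontier i ((hφ _ _).2 hi))
    exact ⟨k, rfl⟩

end IsHitSequence

/-! ### Alternating counts -/

/-- The alternating number of occurrences of `i` among `w 1, ..., w N`. -/
def altSum (w : ℤ → Fin n) (N : ℕ) (i : Fin n) : ℤ :=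
  ∑ k ∈ Finset.range N, (-1) ^ k * if w (k + 1) = i then 1 else 0

/-- For even N the signs repeat from one block of length N to the next. -/
theorem altSum_mul {w : ℤ → Fin n} {N : ℕ} (hN : Even N) (hw : ∀ k, w (k + N) = w k) (j : ℕ)
    (i : Fin n) : altSum w (j * N) i = j * altSum w N i := by
  induction j with
  | zero => simp [altSum]
  | succ j ih =>
    have hs : ∀ (k : ℤ) (j : ℕ), w (k + j * N) = w k := by
      intro k j
      induction j with
      | zero => simp
      | succ j ih => rw [← ih, ← hw (k + j * N)]; congr 1; push_cast; ring
    rw [altSum, show (j + 1) * N = j * N + N by ring, Finset.sum_range_add, ← altSum, ih]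
    push_cast
    rw [add_mul, one_mul]
    congr 1
    refine Finset.sum_congr rfl fun k _ => ?_
    rw [pow_add, (hN.mul_left j).neg_one_pow, one_mul]
    congr 2
    rw [show (j : ℤ) * N + k + 1 = k + 1 + j * N by ring, hs]

/-- Counting over the common period MN gives M C_N = N C_M. -/
theorem altSum_eq_zero_iff {w : ℤ → Fin n} {N M : ℕ} (hN : Even N) (hM : Even M) (hN0 : 0 < N)
    (hM0 : 0 < M) (hwN : ∀ k, w (k + N) = w k) (hwM : ∀ k, w (k + M) = w k) :
    (∀ i, altSum w N i = 0) ↔ ∀ i, altSum w M i = 0 := by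
  refine forall_congr' fun i => ?_
  have h1 := altSum_mul hN hwN M i
  have h2 := altSum_mul hM hwM N i
  rw [mul_comm, h2] at h1
  have hN' : (N : ℤ) ≠ 0 := by exact_mod_cast hN0.ne'
  have hM' : (M : ℤ) ≠ 0 := by exact_mod_cast hM0.ne'
  constructor
  · intro h
    rw [h, mul_zero] at h1
    exact (mul_eq_zero.1 h1).resolve_left hN'
  · intro h
    rw [h, mul_zero] at h1
    exact (mul_eq_zero.1 h1.symm).resolve_left hM'

/-- A vector reflected in turn in `w 1, w 2, ...` is rotated by the alternating product of the edge
directions. -/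
theorem reflected_eq {w : ℤ → Fin n} {u : Fin n → ℂ} (hu : ∀ i, u i * conj (u i) = 1) {v : ℕ → ℂ}
    (hv : ∀ k : ℕ, v (k + 1) = u (w (k + 1)) * conj (v k)) (j : ℕ) :
    v (2 * j) * ∏ i, u i ^ altSum w (2 * j) i = v 0 := by
  induction j with
  | zero => simp [altSum]
  | succ j ih =>
    have hu0 : ∀ i, u i ≠ 0 := fun i h => by
      have := hu i
      rw [h, zero_mul] at this
      exact zero_ne_one this
    have e : ∀ i, altSum w (2 * (j + 1)) i = altSum w (2 * j) i +
        (Pi.single (w ((2 * j : ℕ) + 1)) 1 : Fin n → ℤ) i +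
        -(Pi.single (w ((2 * j + 1 : ℕ) + 1)) 1 : Fin n → ℤ) i := by
      intro i
      rw [show 2 * (j + 1) = 2 * j + 1 + 1 by ring, altSum, Finset.sum_range_succ,
        Finset.sum_range_succ, ← altSum]
      simp only [Pi.single_apply, eq_comm (a := i), pow_succ, (even_two_mul j).neg_one_pow]
      ring
    have hs : ∀ a, ∏ i, u i ^ (Pi.single a 1 : Fin n → ℤ) i = u a := by
      intro a
      rw [Finset.prod_eq_single a]
      · simp
      · intro b _ hb
        simp [hb]
      · simp
    simp only [e, zpow_add₀ (hu0 _), zpow_neg, Finset.prod_mul_distrib, Finset.prod_inv_distrib, hs]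
    rw [show 2 * (j + 1) = 2 * j + 1 + 1 by ring, hv, hv, map_mul, Complex.conj_conj]
    have h1 := hu (w ((2 * j : ℕ) + 1))
    have h2 := hu0 (w ((2 * j + 1 : ℕ) + 1))
    rw [← ih]
    field_simp
    linear_combination v (2 * j) * (∏ i, u i ^ altSum w (2 * j) i) * h1

end NGon
end
-- Stability forces the alternating counts to vanish
noncomputable section

open ComplexConjugate

/-- At real coordinates the form for -I is the conjugate of the form for I. The identity holds on a
product of real intervals, and polynomials that agree on a product of infinite sets are equal. -/
theorem exponents_eq_zero_of_eventually {n : ℕ} (hn : 3 ≤ n) (C : Fin n → ℤ) (q₀ : Fin n → ℂ)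
    (h : ∀ᶠ q in 𝓝 q₀, (∀ i, q (finRotate n i) - q i ≠ 0) ∧
      ∏ i, ((q (finRotate n i) - q i) / conj (q (finRotate n i) - q i)) ^ C i = 1) : C = 0 := by
  obtain ⟨δ, hδ, hb⟩ := Metric.eventually_nhds_iff_ball.1 h
  apply edgeForm_exponents_eq_zero hn
  let c : Fin n × Fin 2 → ℝ := fun a => if a.2 = 0 then (q₀ a.1).re else (q₀ a.1).im
  let S : Fin n × Fin 2 → Set ℂ := fun a => (fun r : ℝ => (r : ℂ)) '' Ioo (c a - δ / 2) (c a + δ / 2)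
  have hS : ∀ a, (S a).Infinite := fun a =>
    (Ioo_infinite (by linarith)).image Complex.ofReal_injective.injOn
  refine MvPolynomial.funext_set S hS fun x hx => ?_
  have hx' : ∀ a, ∃ r ∈ Ioo (c a - δ / 2) (c a + δ / 2), (r : ℂ) = x a := fun a =>
    hx a (mem_univ a)
  choose r hr hrx using hx'
  let q : Fin n → ℂ := fun i => ⟨r (i, 0), r (i, 1)⟩
  have hq : q ∈ Metric.ball q₀ δ := by
    rw [Metric.mem_ball, dist_pi_lt_iff hδ]
    intro i
    rw [dist_eq_norm]
    refine (Complex.norm_le_abs_re_add_abs_im _).trans_lt ?_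
    have h0 := hr (i, 0)
    have h1 := hr (i, 1)
    have e0 : |(q i - q₀ i).re| < δ / 2 := by
      rw [abs_lt]
      simp only [c, if_true] at h0
      simp only [q, Complex.sub_re]
      exact ⟨by linarith [h0.1], by linarith [h0.2]⟩
    have e1 : |(q i - q₀ i).im| < δ / 2 := by
      rw [abs_lt]
      simp only [c, one_ne_zero, if_false] at h1
      simp only [q, Complex.sub_im]
      exact ⟨by linarith [h1.1], by linarith [h1.2]⟩
    linarith
  obtain ⟨hne, hprod⟩ := hb q hq
  have e1 : ∀ i, MvPolynomial.eval x (edgeForm n Complex.I i) = q (finRotate n i) - q i := by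
    intro i
    simp only [edgeForm, map_add, map_sub, map_mul, MvPolynomial.eval_X, MvPolynomial.eval_C, ← hrx,
      q]
    apply Complex.ext <;> simp
  have e2 : ∀ i, MvPolynomial.eval x (edgeForm n (-Complex.I) i) =
      conj (q (finRotate n i) - q i) := by
    intro i
    simp only [edgeForm, map_add, map_sub, map_mul, MvPolynomial.eval_X, MvPolynomial.eval_C, ← hrx,
      q]
    apply Complex.ext <;> simp
    ring
  simp only [map_prod, map_mul, map_pow, e1, e2]
  exact prod_toNat_eq_of_prod_zpow _ _ hne (fun i => (map_ne_zero _).2 (hne i)) C hprod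

namespace NGon

variable {n : ℕ} {P : NGon n} {f : ℝ → ℂ}

theorem dir_div_conj (hn : 3 ≤ n) (P : NGon n) (i : Fin n) :
    P.dir i / conj (P.dir i) * conj (P.dir i / conj (P.dir i)) = 1 := by
  have hd := P.dir_ne_zero hn i
  have hd' : conj (P.dir i) ≠ 0 := (map_ne_zero _).2 hd
  rw [map_div₀, Complex.conj_conj]
  field_simp

/-- The velocity returns to itself after two periods. Two are taken since m may be odd, and only an
even number of reflections is a rotation. -/
theorem IsHitSequence.prod_eq_one (hn : 3 ≤ n) {t : ℤ → ℝ} {w : ℤ → Fin n}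
    (h : IsHitSequence P f t w) (hf : P.IsPeriodicTrajectory f) {m : ℕ}
    (ht : ∀ k, t (k + m) = t k + 1) :
    ∏ i, (P.dir i / conj (P.dir i)) ^ altSum w (2 * m) i = 1 := by
  obtain ⟨v, hv0, hv, hrefl⟩ := h.exists_velocity hf.1
  have hlt : ∀ k, t k < t (k + 1) := fun k => h.strictMono (by omega)
  have hper : ∀ k, v (k + m) = v k := by
    intro k
    have h1 := hv k (t (k + 1)) ⟨(hlt k).le, le_rfl⟩
    have h2 := hv (k + m) (t (k + m + 1)) ⟨(hlt _).le, le_rfl⟩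
    rw [show k + (m : ℤ) + 1 = k + 1 + m by ring, ht, ht, hf.2, hf.2, h1, add_sub_add_right_eq_sub]
      at h2
    exact (smul_right_injective ℂ (sub_ne_zero.2 (hlt k).ne') (add_left_cancel h2)).symm
  have key := reflected_eq (w := w) (u := fun i => P.dir i / conj (P.dir i)) (P.dir_div_conj hn)
    (v := fun k => v k) (fun k => by
      push_cast
      rw [hrefl, edgeReflection_apply P hn]) m
  have h2 : v ((2 * m : ℕ) : ℤ) = v 0 := by
    rw [← hper 0, ← hper (0 + m)]
    congr 1
    push_cast
    ring
  rw [h2] at key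
  exact mul_left_cancel₀ (hv0 0) (key.trans (mul_one _).symm)

/-- The trajectory on a nearby polygon has the same word, so the product with the same exponents
equals 1 for all nearby vertex positions. -/
theorem IsStable.altSum_eq_zero (hn : 3 ≤ n) {t : ℤ → ℝ} {w : ℤ → Fin n}
    (h : IsHitSequence P f t w) {m : ℕ} (ht : ∀ k, t (k + m) = t k + 1) (hs : P.IsStable f) :
    altSum w (2 * m) = 0 := by
  obtain ⟨ε, hε, hst⟩ := hs
  refine exponents_eq_zero_of_eventually hn _ P.vertex ?_
  filter_upwards [P.eventually_exists_ngon hn, Metric.ball_mem_nhds _ hε] with q hq hqε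
  obtain ⟨Q, rfl⟩ := hq
  obtain ⟨g, hg, φ, hφ1, hφ⟩ := hst Q fun i => (dist_le_pi_dist _ _ i).trans_lt hqε
  refine ⟨fun i => Q.dir_ne_zero hn i, ?_⟩
  refine (h.transfer hg.1 hφ).prod_eq_one hn hg fun k => ?_
  rw [Function.comp_apply, ht, hφ1]
  rfl

end NGon
end
noncomputable section

/-! ### Piecewise linear changes of parameter -/

/-- The piecewise linear function which takes the value `t k` at each integer `k`. -/
def interpolate (t : ℤ → ℝ) (x : ℝ) : ℝ := t ⌊x⌋ + Int.fract x * (t (⌊x⌋ + 1) - t ⌊x⌋)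

theorem interpolate_intCast (t : ℤ → ℝ) (k : ℤ) : interpolate t k = t k := by
  simp [interpolate]

theorem interpolate_add_natCast {t : ℤ → ℝ} {m : ℕ} {T : ℝ} (h : ∀ k, t (k + m) = t k + T) (x : ℝ) :
    interpolate t (x + m) = interpolate t x + T := by
  simp only [interpolate, Int.floor_add_natCast, Int.fract_add_natCast, h]
  rw [show ⌊x⌋ + (m : ℤ) + 1 = ⌊x⌋ + 1 + m by ring, h]
  ring

theorem interpolate_mem_Ico {t : ℤ → ℝ} (ht : StrictMono t) (x : ℝ) :
    interpolate t x ∈ Ico (t ⌊x⌋) (t (⌊x⌋ + 1)) := by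
  have h1 : t ⌊x⌋ < t (⌊x⌋ + 1) := ht (by omega)
  have h2 := Int.fract_nonneg x
  have h3 := Int.fract_lt_one x
  constructor <;> unfold interpolate <;> nlinarith

theorem interpolate_strictMono {t : ℤ → ℝ} (ht : StrictMono t) : StrictMono (interpolate t) := by
  intro x y hxy
  rcases (Int.floor_mono hxy.le).lt_or_eq with h | h
  · exact (interpolate_mem_Ico ht x).2.trans_le
      ((ht.monotone (by omega)).trans (interpolate_mem_Ico ht y).1)
  · have h1 : t ⌊x⌋ < t (⌊x⌋ + 1) := ht (by omega)
    have h2 : Int.fract x < Int.fract y := by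
      rw [Int.fract, Int.fract, h]
      linarith
    unfold interpolate
    rw [← h]
    have := mul_lt_mul_of_pos_right h2 (sub_pos.2 h1)
    linarith

theorem interpolate_surjective {t : ℤ → ℝ} (ht : StrictMono t)
    (hex : ∀ s, ∃ k, s ∈ Ico (t k) (t (k + 1))) : Function.Surjective (interpolate t) := by
  intro s
  obtain ⟨k, hk⟩ := hex s
  have h1 : 0 < t (k + 1) - t k := sub_pos.2 (ht (by omega))
  have h2 : (s - t k) / (t (k + 1) - t k) ∈ Ico (0 : ℝ) 1 :=
    ⟨div_nonneg (by linarith [hk.1]) h1.le, by rw [div_lt_one h1]; linarith [hk.2]⟩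
  refine ⟨k + (s - t k) / (t (k + 1) - t k), ?_⟩
  have h3 : ⌊(k : ℝ) + (s - t k) / (t (k + 1) - t k)⌋ = k := by
    rw [Int.floor_intCast_add, Int.floor_eq_zero_iff.2 h2, add_zero]
  rw [interpolate, h3, Int.fract, h3]
  field_simp
  ring

namespace NGon

variable {n : ℕ}

/-- The change of parameter sends t k to T k and is linear in between; it commutes with the unit
translation because both sequences advance by 1 over m steps. -/
theorem sameItinerary_of_hitSequence {P Q : NGon n} {f g : ℝ → ℂ} {t T : ℤ → ℝ} {w : ℤ → Fin n}
    (hf : IsHitSequence P f t w) (hg : IsHitSequence Q g T w) {m : ℕ}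
    (ht : ∀ k, t (k + m) = t k + 1) (hT : ∀ k, T (k + m) = T k + 1) : SameItinerary P f Q g := by
  let e₁ := (interpolate_strictMono hf.strictMono).orderIsoOfSurjective _
    (interpolate_surjective hf.strictMono (exists_mem_Ico_of_shift hf.strictMono one_pos ht))
  let e₂ := (interpolate_strictMono hg.strictMono).orderIsoOfSurjective _
    (interpolate_surjective hg.strictMono (exists_mem_Ico_of_shift hg.strictMono one_pos hT))
  have h1 : ∀ x, e₁ x = interpolate t x := fun x => rfl
  have h2 : ∀ x, e₂ x = interpolate T x := fun x => rfl
  let φ := e₁.symm.trans e₂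
  have hφ : ∀ k, φ (t k) = T k := by
    intro k
    rw [← interpolate_intCast t k, ← h1]
    change e₂ (e₁.symm (e₁ k)) = T k
    rw [e₁.symm_apply_apply, h2, interpolate_intCast]
  refine ⟨φ, fun s => ?_, fun s i => ⟨fun hs => ?_, fun hs => ?_⟩⟩
  · obtain ⟨x, rfl⟩ := e₁.surjective s
    have : e₁ x + 1 = e₁ (x + m) := by rw [h1, h1, interpolate_add_natCast ht]
    rw [this]
    change e₂ (e₁.symm (e₁ (x + m))) = e₂ (e₁.symm (e₁ x)) + 1
    rw [e₁.symm_apply_apply, e₁.symm_apply_apply, h2, h2, interpolate_add_natCast hT]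
  · obtain ⟨k, rfl⟩ := hf.exists_eq s (P.edge_subset_frontier i hs)
    rw [hφ, P.edge_unique (hf.mem_edge k) hs]
    exact hg.mem_edge k
  · obtain ⟨k, hk⟩ := hg.exists_eq _ (Q.edge_subset_frontier i hs)
    rw [← hφ] at hk
    obtain rfl := φ.injective hk
    rw [hφ] at hs
    rw [Q.edge_unique (hg.mem_edge k) hs]
    exact hf.mem_edge k

/-- Linear pieces which satisfy the law of reflection form a trajectory. -/
theorem exists_trajectory_of_pieces (Q : NGon n) {T : ℤ → ℝ} {w : ℤ → Fin n} {p τ : ℤ → ℂ} {m : ℕ}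
    (hT : StrictMono T) (hTm : ∀ k, T (k + m) = T k + 1)
    (hedge : ∀ k, p k + T k • τ k ∈ Q.edge (w k))
    (hint : ∀ k, ∀ s ∈ Ioo (T k) (T (k + 1)), p k + s • τ k ∈ interior Q.region)
    (hτ : ∀ k, τ k ≠ 0) (hτs : ∀ k, τ (k + 1) = Q.edgeReflection (w (k + 1)) (τ k))
    (hps : ∀ k, p k + T (k + 1) • τ k = p (k + 1) + T (k + 1) • τ (k + 1))
    (hpm : ∀ k, p (k + m) = p k - τ k) (hτm : ∀ k, τ (k + m) = τ k) :
    ∃ g, Q.IsPeriodicTrajectory g ∧ IsHitSequence Q g T w := by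
  choose κ hκ using exists_mem_Ico_of_shift hT one_pos hTm
  have hκu : ∀ s k, s ∈ Ico (T k) (T (k + 1)) → κ s = k := by
    intro s k hs
    have h1 := hT.lt_iff_lt.1 ((hκ s).1.trans_lt hs.2)
    have h2 := hT.lt_iff_lt.1 (hs.1.trans_lt (hκ s).2)
    omega
  have hlt : ∀ k, T k < T (k + 1) := fun k => hT (by omega)
  let g : ℝ → ℂ := fun s => p (κ s) + s • τ (κ s)
  have hg : ∀ k, ∀ s ∈ Icc (T k) (T (k + 1)), g s = p k + s • τ k := by
    intro k s hs
    rcases hs.2.lt_or_eq with h | rfl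
    · simp only [g, hκu s k ⟨hs.1, h⟩]
    · simp only [g]
      rw [hκu _ (k + 1) ⟨le_rfl, hlt _⟩, hps]
  have hgT : ∀ k, g (T k) ∈ Q.edge (w k) := fun k => by
    rw [hg k _ ⟨le_rfl, (hlt k).le⟩]
    exact hedge k
  have hcases : ∀ s, (∃ k, s ∈ Ioo (T k) (T (k + 1))) ∨ ∃ k, s = T k := fun s => by
    rcases (hκ s).1.lt_or_eq with h | h
    · exact Or.inl ⟨_, h, (hκ s).2⟩
    · exact Or.inr ⟨_, h.symm⟩
  have hgint : ∀ k, ∀ s ∈ Ioo (T k) (T (k + 1)), g s ∈ interior Q.region := fun k s hs => by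
    rw [hg k s ⟨hs.1.le, hs.2.le⟩]
    exact hint k s hs
  have hseq : IsHitSequence Q g T w := by
    refine ⟨hT, hgT, fun s hs => ?_⟩
    rcases hcases s with ⟨k, hk⟩ | h
    · exact absurd hs (Q.not_mem_frontier_of_mem_interior (hgint k s hk))
    · exact h
  have hper : Function.Periodic g 1 := by
    intro s
    have h1 := hκ s
    rw [hg (κ s + m) (s + 1) ⟨by rw [hTm]; linarith [h1.1], by
      rw [show κ s + (m : ℤ) + 1 = κ s + 1 + m by ring, hTm]; linarith [h1.2]⟩, hpm, hτm,
      hg (κ s) s ⟨h1.1, h1.2.le⟩, add_smul, one_smul]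
    abel
  refine ⟨g, ⟨⟨fun s => ?_, fun s i h => ?_, fun s hs => ?_, fun s i hs => ?_⟩, hper⟩, hseq⟩
  · rcases hcases s with ⟨k, hk⟩ | ⟨k, rfl⟩
    · exact interior_subset (hgint k s hk)
    · exact Q.frontier_subset_region (Q.edge_subset_frontier _ (hgT k))
  · rcases hcases s with ⟨k, hk⟩ | ⟨k, rfl⟩
    · refine Q.not_mem_frontier_of_mem_interior (hgint k s hk) ?_
      rw [h]
      exact Q.mem_frontier_iff.2 (Or.inr ⟨i, rfl⟩)
    · exact Q.vertex_not_mem_edge (h ▸ hgT k)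
  · rcases hcases s with ⟨k, hk⟩ | ⟨k, rfl⟩
    · refine ⟨τ k, hτ k, ?_⟩
      filter_upwards [Ioo_mem_nhds hk.1 hk.2] with x hx
      rw [hg k x ⟨hx.1.le, hx.2.le⟩, hg k s ⟨hk.1.le, hk.2.le⟩, sub_smul]
      abel
    · exact absurd (Q.edge_subset_frontier _ (hgT k)) (fun h => h.2 hs)
  · obtain ⟨k, rfl⟩ := hseq.exists_eq s (Q.edge_subset_frontier i hs)
    obtain rfl := Q.edge_unique (hgT k) hs
    obtain ⟨l, rfl⟩ : ∃ l, k = l + 1 := ⟨k - 1, by ring⟩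
    refine ⟨τ l, hτ l, ?_, ?_⟩
    · filter_upwards [Ioc_mem_nhdsLE (hlt l)] with x hx
      rw [hg l x ⟨hx.1.le, hx.2⟩, hg l _ ⟨(hlt l).le, le_rfl⟩, sub_smul]
      abel
    · filter_upwards [Ico_mem_nhdsGE (hlt (l + 1))] with x hx
      rw [hg (l + 1) x ⟨hx.1, hx.2.le⟩, hg (l + 1) _ ⟨le_rfl, (hlt _).le⟩, sub_smul, hτs]
      abel

end NGon
end
noncomputable section

open ComplexConjugate

/-! ### Folding a line along a sequence of edges -/

section Fold

variable {n : ℕ}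

/-- The linear reflection in the direction of the `i`-th edge of the closed polygonal curve `q`. -/
def foldLin (q : Fin n → ℂ) (i : Fin n) (z : ℂ) : ℂ :=
  (q (finRotate n i) - q i) / conj (q (finRotate n i) - q i) * conj z

/-- The reflection in the line carrying the `i`-th edge of the closed polygonal curve `q`. -/
def foldRefl (q : Fin n → ℂ) (i : Fin n) (z : ℂ) : ℂ := q i + foldLin q i (z - q i)

/-- The successive reflections in the edges `w 1, ..., w k`. -/
def foldPt (q : Fin n → ℂ) (w : ℤ → Fin n) : ℕ → ℂ → ℂ
  | 0, z => z
  | k + 1, z => foldRefl q (w (k + 1)) (foldPt q w k z)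

/-- The linear part of `foldPt`. -/
def foldVec (q : Fin n → ℂ) (w : ℤ → Fin n) : ℕ → ℂ → ℂ
  | 0, z => z
  | k + 1, z => foldLin q (w (k + 1)) (foldVec q w k z)

/-- The time at which the line `s ↦ X.1 + s X.2` meets the line carrying the `i`-th edge. -/
def hitTime (q : Fin n → ℂ) (i : Fin n) (X : ℂ × ℂ) : ℝ :=
  -((X.1 - q i) / (q (finRotate n i) - q i)).im / (X.2 / (q (finRotate n i) - q i)).im

variable {q : Fin n → ℂ} {w : ℤ → Fin n}

theorem foldLin_add (i : Fin n) (y z : ℂ) : foldLin q i (y + z) = foldLin q i y + foldLin q i z := by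
  simp only [foldLin, map_add, mul_add]

theorem foldRefl_add (i : Fin n) (y z : ℂ) :
    foldRefl q i (y + z) = foldRefl q i y + foldLin q i z := by
  rw [foldRefl, foldRefl, add_sub_right_comm, foldLin_add, add_assoc]

theorem foldLin_smul (i : Fin n) (r : ℝ) (z : ℂ) : foldLin q i (r • z) = r • foldLin q i z := by
  simp only [foldLin, Complex.real_smul, map_mul, Complex.conj_ofReal]
  ring

theorem foldPt_add (k : ℕ) (y z : ℂ) : foldPt q w k (y + z) = foldPt q w k y + foldVec q w k z := by
  induction k with
  | zero => rfl
  | succ k ih => rw [foldPt, foldPt, foldVec, ih, foldRefl_add]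

theorem foldVec_smul (k : ℕ) (r : ℝ) (z : ℂ) : foldVec q w k (r • z) = r • foldVec q w k z := by
  induction k with
  | zero => rfl
  | succ k ih => rw [foldVec, foldVec, ih, foldLin_smul]

theorem foldPt_add_index {m : ℕ} (hw : ∀ k, w (k + m) = w k) (k : ℕ) (z : ℂ) :
    foldPt q w (k + m) z = foldPt q w k (foldPt q w m z) := by
  induction k with
  | zero => rw [Nat.zero_add]; rfl
  | succ k ih =>
    rw [show k + 1 + m = k + m + 1 by ring, foldPt, foldPt, ih]
    congr 1
    rw [← hw (k + 1)]
    congr 1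
    push_cast
    ring

theorem foldVec_eq_self (hq : ∀ i, q (finRotate n i) - q i ≠ 0) {m : ℕ}
    (hC : NGon.altSum w (2 * m) = 0) (z : ℂ) : foldVec q w (2 * m) z = z := by
  have h := NGon.reflected_eq (w := w)
    (u := fun i => (q (finRotate n i) - q i) / conj (q (finRotate n i) - q i)) (fun i => by
      have hd := hq i
      have hd' : conj (q (finRotate n i) - q i) ≠ 0 := (map_ne_zero _).2 hd
      rw [map_div₀, Complex.conj_conj]
      field_simp) (v := fun k => foldVec q w k z) (fun k => rfl) m
  simpa [hC, foldVec] using h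

/-- Let A be the composite of m reflections. Its square is the translation by -2τ and commutes with
A, so the linear part of A fixes τ. The midpoint of x and A x is moved by -τ; if A is a glide
reflection, this midpoint lies on its axis. The further shift by τ / 2 makes p equal to x when A x =
x - τ already holds. -/
theorem foldPt_closed (hq : ∀ i, q (finRotate n i) - q i ≠ 0) {m : ℕ} (hw : ∀ k, w (k + m) = w k)
    (hC : NGon.altSum w (2 * m) = 0) (x : ℂ) {τ p : ℂ}
    (hτ : τ = (1 / 2 : ℝ) • (x - foldPt q w m (foldPt q w m x)))
    (hp : p = (1 / 2 : ℝ) • (x + foldPt q w m x + τ)) :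
    foldVec q w m τ = τ ∧ foldPt q w m p = p - τ := by
  have hsq : ∀ z, foldPt q w m (foldPt q w m (x + z)) = foldPt q w m (foldPt q w m x) + z := by
    intro z
    rw [← foldPt_add_index hw, ← foldPt_add_index hw, ← two_mul, foldPt_add, foldVec_eq_self hq hC]
  set a := foldPt q w m x with ha
  set b := foldPt q w m a with hb
  have hba : foldPt q w m b = a - x + b := by
    have := hsq (a - x)
    rw [add_sub_cancel, ← hb] at this
    rw [this]
    ring
  have hsub : ∀ y z, foldVec q w m (y - z) = foldPt q w m y - foldPt q w m z := by
    intro y z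
    have := foldPt_add (q := q) (w := w) m z (y - z)
    rw [add_sub_cancel] at this
    rw [this]
    ring
  have h1 : foldVec q w m τ = τ := by
    rw [hτ, foldVec_smul, hsub, ← ha, hba]
    simp only [Complex.real_smul]
    ring
  refine ⟨h1, ?_⟩
  have e : p = x + (1 / 2 : ℝ) • ((a - x) + τ) := by
    rw [hp]
    simp only [Complex.real_smul]
    push_cast
    ring
  have hadd : ∀ y z, foldVec q w m (y + z) = foldVec q w m y + foldVec q w m z := by
    intro y z
    have h1 := foldPt_add (q := q) (w := w) m 0 (y + z)
    rw [← add_assoc, foldPt_add, foldPt_add, add_assoc] at h1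
    exact (add_left_cancel h1).symm
  rw [e, foldPt_add, foldVec_smul, hadd, hsub, h1, ← ha, ← hb]
  have h2 : b = x - 2 * τ := by
    rw [hτ, Complex.real_smul]
    push_cast
    ring
  rw [h2]
  simp only [Complex.real_smul]
  push_cast
  ring

theorem continuousAt_foldLin {q₀ : Fin n → ℂ} (hq : ∀ i, q₀ (finRotate n i) - q₀ i ≠ 0) (i : Fin n)
    {z : (Fin n → ℂ) → ℂ} (hz : ContinuousAt z q₀) : ContinuousAt (fun q => foldLin q i (z q)) q₀ := by
  have hd : ContinuousAt (fun q : Fin n → ℂ => q (finRotate n i) - q i) q₀ := by fun_prop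
  unfold foldLin
  exact (hd.div (Complex.continuous_conj.continuousAt.comp hd)
    ((map_ne_zero _).2 (hq i))).mul (Complex.continuous_conj.continuousAt.comp hz)

theorem continuousAt_foldPt {q₀ : Fin n → ℂ} (hq : ∀ i, q₀ (finRotate n i) - q₀ i ≠ 0) (k : ℕ)
    {z : (Fin n → ℂ) → ℂ} (hz : ContinuousAt z q₀) :
    ContinuousAt (fun q => foldPt q w k (z q)) q₀ := by
  induction k with
  | zero => exact hz
  | succ k ih =>
    simp only [foldPt, foldRefl]
    have hi : ContinuousAt (fun q : Fin n → ℂ => q (w (k + 1))) q₀ :=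
      (continuous_apply _).continuousAt
    exact hi.add (continuousAt_foldLin hq _ (ih.sub hi))

theorem continuousAt_foldVec {q₀ : Fin n → ℂ} (hq : ∀ i, q₀ (finRotate n i) - q₀ i ≠ 0) (k : ℕ)
    {z : (Fin n → ℂ) → ℂ} (hz : ContinuousAt z q₀) :
    ContinuousAt (fun q => foldVec q w k (z q)) q₀ := by
  induction k with
  | zero => exact hz
  | succ k ih => exact continuousAt_foldLin hq _ ih

theorem hitTime_spec {i : Fin n} {X : ℂ × ℂ} (h : (X.2 / (q (finRotate n i) - q i)).im ≠ 0) (s : ℝ) :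
    ((X.1 + s • X.2 - q i) / (q (finRotate n i) - q i)).im =
      (s - hitTime q i X) * (X.2 / (q (finRotate n i) - q i)).im := by
  have e : (X.1 + s • X.2 - q i) / (q (finRotate n i) - q i) =
      (X.1 - q i) / (q (finRotate n i) - q i) + (s : ℂ) * (X.2 / (q (finRotate n i) - q i)) := by
    rw [Complex.real_smul]
    ring
  rw [e, Complex.add_im, Complex.im_ofReal_mul, hitTime, sub_mul, div_mul_cancel₀ _ h]
  ring

theorem fold_div (hq : ∀ i, q (finRotate n i) - q i ≠ 0) (i : Fin n) (z : ℂ) :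
    foldLin q i z / (q (finRotate n i) - q i) = conj (z / (q (finRotate n i) - q i)) := by
  have hd := hq i
  have hd' : conj (q (finRotate n i) - q i) ≠ 0 := (map_ne_zero _).2 hd
  rw [foldLin, map_div₀]
  field_simp

theorem hitTime_fold (hq : ∀ i, q (finRotate n i) - q i ≠ 0) (i : Fin n) (X : ℂ × ℂ) :
    hitTime q i (foldRefl q i X.1, foldLin q i X.2) = hitTime q i X := by
  simp only [hitTime, foldRefl, add_sub_cancel_left, fold_div hq, Complex.conj_im,
    neg_neg]
  rw [neg_div, div_neg]

theorem hitTime_shift {i : Fin n} {X : ℂ × ℂ} (h : (X.2 / (q (finRotate n i) - q i)).im ≠ 0) :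
    hitTime q i (X.1 - X.2, X.2) = hitTime q i X + 1 := by
  have e : (X.1 - X.2 - q i) / (q (finRotate n i) - q i) =
      (X.1 - q i) / (q (finRotate n i) - q i) - X.2 / (q (finRotate n i) - q i) := by ring
  simp only [hitTime, e, Complex.sub_im]
  field_simp
  ring

/-- The fold of a point of the line carrying the edge is this point. -/
theorem fold_eq_of_hit (hq : ∀ i, q (finRotate n i) - q i ≠ 0) {i : Fin n} {z : ℂ}
    (h : ((z - q i) / (q (finRotate n i) - q i)).im = 0) : foldRefl q i z = z := by
  have h1 := fold_div hq i (z - q i)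
  rw [Complex.conj_eq_iff_im.2 h, div_left_inj' (hq i)] at h1
  rw [foldRefl, h1]
  ring

theorem continuousAt_hitTime {q₀ : Fin n → ℂ} (hq : ∀ i, q₀ (finRotate n i) - q₀ i ≠ 0) (i : Fin n)
    {X : (Fin n → ℂ) → ℂ × ℂ} (hX : ContinuousAt X q₀)
    (h : ((X q₀).2 / (q₀ (finRotate n i) - q₀ i)).im ≠ 0) :
    ContinuousAt (fun q => hitTime q i (X q)) q₀ := by
  have hd : ContinuousAt (fun q : Fin n → ℂ => q (finRotate n i) - q i) q₀ := by fun_prop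
  have hi : ContinuousAt (fun q : Fin n → ℂ => q i) q₀ := (continuous_apply i).continuousAt
  unfold hitTime
  exact (Complex.continuous_im.continuousAt.comp ((hX.fst.sub hi).div hd (hq i))).neg.div
    (Complex.continuous_im.continuousAt.comp (hX.snd.div hd (hq i))) h

end Fold

/-- Disjointness is an open condition on each pair of parameters, and the pairs range over a compact
square. -/
theorem eventually_disjoint_segments {α : Type*} [TopologicalSpace α] {x₀ : α} {a b c d : α → ℂ}
    (ha : ContinuousAt a x₀) (hb : ContinuousAt b x₀) (hc : ContinuousAt c x₀)
    (hd : ContinuousAt d x₀) (h : Disjoint (segment ℝ (a x₀) (b x₀)) (segment ℝ (c x₀) (d x₀))) :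
    ∀ᶠ x in 𝓝 x₀, Disjoint (segment ℝ (a x) (b x)) (segment ℝ (c x) (d x)) := by
  have hK : IsCompact (Icc (0 : ℝ) 1 ×ˢ Icc (0 : ℝ) 1) := isCompact_Icc.prod isCompact_Icc
  have hline : ∀ {a b : α → ℂ}, ContinuousAt a x₀ → ContinuousAt b x₀ → ∀ g : ℝ × ℝ → ℝ,
      Continuous g → ∀ y : ℝ × ℝ, ContinuousAt (fun p : α × (ℝ × ℝ) =>
        AffineMap.lineMap (a p.1) (b p.1) (g p.2) : α × (ℝ × ℝ) → ℂ) (x₀, y) := by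
    intro a b ha hb g hg y
    simp only [AffineMap.lineMap_apply, vsub_eq_sub, vadd_eq_add]
    have ha' : ContinuousAt (fun p : α × (ℝ × ℝ) => a p.1) (x₀, y) :=
      ContinuousAt.comp (x := (x₀, y)) (g := a) ha continuousAt_fst
    have hb' : ContinuousAt (fun p : α × (ℝ × ℝ) => b p.1) (x₀, y) :=
      ContinuousAt.comp (x := (x₀, y)) (g := b) hb continuousAt_fst
    exact ((hg.comp continuous_snd).continuousAt.smul (hb'.sub ha')).add ha'
  have hev := hK.eventually_forall_of_forall_eventually (x₀ := x₀)
    (P := fun x y => (AffineMap.lineMap (a x) (b x) y.1 : ℂ) ≠ AffineMap.lineMap (c x) (d x) y.2)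
    (fun y hy => by
      refine ((hline ha hb _ continuous_fst y).prodMk (hline hc hd _ continuous_snd y)).eventually
        (isOpen_ne_fun continuous_fst continuous_snd |>.mem_nhds ?_)
      rw [segment_eq_image_lineMap, segment_eq_image_lineMap] at h
      exact fun he => disjoint_left.1 h ⟨y.1, hy.1, rfl⟩ ⟨y.2, hy.2, he.symm⟩)
  filter_upwards [hev] with x hx
  rw [segment_eq_image_lineMap, segment_eq_image_lineMap, disjoint_left]
  rintro _ ⟨s, hs, rfl⟩ ⟨t, ht, he⟩
  exact hx (s, t) ⟨hs, ht⟩ he.symm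

/-! ### Chords of a polygon and their persistence -/

namespace NGon

variable {n : ℕ}

/-- The line `X` crosses the polygon along a chord from the `i`-th to the `j`-th edge. -/
structure IsChord (Q : NGon n) (i j : Fin n) (X : ℂ × ℂ) : Prop where
  start_im : (X.2 / Q.dir i).im ≠ 0
  end_im : (X.2 / Q.dir j).im ≠ 0
  lt : hitTime Q.vertex i X < hitTime Q.vertex j X
  mem_edge : X.1 + hitTime Q.vertex i X • X.2 ∈ Q.edge i
  mem_interior : ∀ s ∈ Ioo (hitTime Q.vertex i X) (hitTime Q.vertex j X),
    X.1 + s • X.2 ∈ interior Q.region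

/-- Both pairs parametrize the same line with times differing by 1; this reduces all chords to those
of one period. -/
theorem isChord_shift {Q : NGon n} {i j : Fin n} {X : ℂ × ℂ} :
    Q.IsChord i j (X.1 - X.2, X.2) ↔ Q.IsChord i j X := by
  have key : ∀ s : ℝ, X.1 - X.2 + s • X.2 = X.1 + (s - 1) • X.2 := fun s => by
    rw [sub_smul, one_smul]; ring
  constructor <;> rintro ⟨h1, h2, h3, h4, h5⟩
  · have e1 : hitTime Q.vertex i (X.1 - X.2, X.2) = _ := hitTime_shift h1
    have e2 : hitTime Q.vertex j (X.1 - X.2, X.2) = _ := hitTime_shift h2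
    rw [e1, e2] at h3 h5
    rw [e1, key, add_sub_cancel_right] at h4
    refine ⟨h1, h2, by linarith, h4, fun s hs => ?_⟩
    have := h5 (s + 1) ⟨by linarith [hs.1], by linarith [hs.2]⟩
    rwa [key, add_sub_cancel_right] at this
  · have e1 : hitTime Q.vertex i (X.1 - X.2, X.2) = _ := hitTime_shift h1
    have e2 : hitTime Q.vertex j (X.1 - X.2, X.2) = _ := hitTime_shift h2
    refine ⟨h1, h2, by rw [e1, e2]; linarith, by rw [e1, key, add_sub_cancel_right]; exact h4,
      fun s hs => ?_⟩
    rw [e1, e2] at hs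
    rw [key]
    exact h5 _ ⟨by linarith [hs.1], by linarith [hs.2]⟩

/-- A chord of `P` persists on the polygons near `P`. -/
theorem eventually_isChord (hn : 3 ≤ n) (P : NGon n) {X : (Fin n → ℂ) → ℂ × ℂ}
    (hX : ContinuousAt X P.vertex) {i j : Fin n} {a b : ℝ} (hab : a < b)
    (ha : (X P.vertex).1 + a • (X P.vertex).2 ∈ P.edge i)
    (hb : (X P.vertex).1 + b • (X P.vertex).2 ∈ P.edge j)
    (hint : ∀ s ∈ Ioo a b, (X P.vertex).1 + s • (X P.vertex).2 ∈ interior P.region)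
    (hi : ((X P.vertex).2 / P.dir i).im ≠ 0) (hj : ((X P.vertex).2 / P.dir j).im ≠ 0) :
    ∀ᶠ q in 𝓝 P.vertex, ∀ Q : NGon n, Q.vertex = q → Q.IsChord i j (X q) := by
  have hq : ∀ i, P.vertex (finRotate n i) - P.vertex i ≠ 0 := P.dir_ne_zero hn
  have hd : ∀ i, ContinuousAt (fun q : Fin n → ℂ => q (finRotate n i) - q i) P.vertex := fun i => by
    fun_prop
  have hv : ∀ i, ContinuousAt (fun q : Fin n → ℂ => q i) P.vertex := fun i =>
    (continuous_apply i).continuousAt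
  have hta : hitTime P.vertex i (X P.vertex) = a := by
    have h0 : (P.coord i _).im = 0 := P.coord_im_of_mem_side hn (P.edge_subset_side i ha)
    rw [coord, dir, hitTime_spec hi] at h0
    have := (mul_eq_zero.1 h0).resolve_right hi
    linarith
  have htb : hitTime P.vertex j (X P.vertex) = b := by
    have h0 : (P.coord j _).im = 0 := P.coord_im_of_mem_side hn (P.edge_subset_side j hb)
    rw [coord, dir, hitTime_spec hj] at h0
    have := (mul_eq_zero.1 h0).resolve_right hj
    linarith
  have hci := continuousAt_hitTime hq i hX hi
  have hcj := continuousAt_hitTime hq j hX hj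
  have hEi : ContinuousAt (fun q => (X q).1 + hitTime q i (X q) • (X q).2) P.vertex :=
    hX.fst.add (hci.smul hX.snd)
  have hEj : ContinuousAt (fun q => (X q).1 + hitTime q j (X q) • (X q).2) P.vertex :=
    hX.fst.add (hcj.smul hX.snd)
  have h1 : ∀ᶠ q in 𝓝 P.vertex, ((X q).2 / (q (finRotate n i) - q i)).im ≠ 0 :=
    (Complex.continuous_im.continuousAt.comp (hX.snd.div (hd i) (hq i))).eventually_ne hi
  have h2 : ∀ᶠ q in 𝓝 P.vertex, ((X q).2 / (q (finRotate n j) - q j)).im ≠ 0 :=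
    (Complex.continuous_im.continuousAt.comp (hX.snd.div (hd j) (hq j))).eventually_ne hj
  have h3 : ∀ᶠ q in 𝓝 P.vertex, hitTime q i (X q) < hitTime q j (X q) :=
    hci.eventually_lt hcj (by rw [hta, htb]; exact hab)
  have h4 : ∀ᶠ q in 𝓝 P.vertex, (((X q).1 + hitTime q i (X q) • (X q).2 - q i) /
      (q (finRotate n i) - q i)).re ∈ Ioo (0 : ℝ) 1 := by
    refine (Complex.continuous_re.continuousAt.comp ((hEi.sub (hv i)).div (hd i) (hq i))).eventually
      (isOpen_Ioo.mem_nhds ?_)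
    obtain ⟨s, hs, he⟩ := P.mem_edge.1 ha
    change (P.coord i ((X P.vertex).1 + hitTime P.vertex i (X P.vertex) • (X P.vertex).2)).re ∈ _
    rw [hta, ← he, P.coord_point hn, Complex.ofReal_re]
    exact hs
  -- One interior point of the chord suffices, since the open chord is connected and will be shown
  -- to avoid the frontier.
  have hmid : ∀ᶠ q in 𝓝 P.vertex, ∀ Q : NGon n, Q.vertex = q →
      (X q).1 + ((hitTime q i (X q) + hitTime q j (X q)) / 2) • (X q).2 ∈ interior Q.region := by
    have hc : ContinuousAt (fun q => (q, (X q).1 +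
        ((hitTime q i (X q) + hitTime q j (X q)) / 2) • (X q).2)) P.vertex :=
      continuousAt_id.prodMk (hX.fst.add (((hci.add hcj).div_const 2).smul hX.snd))
    refine hc.eventually (P.eventually_mem_interior hn (hint _ ?_))
    rw [hta, htb]
    exact ⟨by linarith, by linarith⟩
  have hdis : ∀ᶠ q in 𝓝 P.vertex, ∀ l : Fin n, l ≠ i → l ≠ j →
      Disjoint (segment ℝ ((X q).1 + hitTime q i (X q) • (X q).2)
        ((X q).1 + hitTime q j (X q) • (X q).2)) (segment ℝ (q l) (q (finRotate n l))) := by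
    rw [eventually_all]
    intro l
    by_cases hli : l = i
    · exact Eventually.of_forall fun q h => absurd hli h
    by_cases hlj : l = j
    · exact Eventually.of_forall fun q _ h => absurd hlj h
    refine (eventually_disjoint_segments hEi hEj (hv l) (hv (finRotate n l)) ?_).mono
      fun q h _ _ => h
    rw [hta, htb, disjoint_left]
    intro z hz hzl
    rw [segment_eq_image_lineMap] at hz
    obtain ⟨σ, hσ, rfl⟩ := hz
    have e : (AffineMap.lineMap ((X P.vertex).1 + a • (X P.vertex).2)
        ((X P.vertex).1 + b • (X P.vertex).2) σ : ℂ) =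
        (X P.vertex).1 + (a + σ * (b - a)) • (X P.vertex).2 := by
      rw [AffineMap.lineMap_apply, vsub_eq_sub, vadd_eq_add]
      simp only [Complex.real_smul]
      push_cast
      ring
    rw [e] at hzl
    rcases hσ.1.lt_or_eq with h0 | rfl
    · rcases hσ.2.lt_or_eq with h1 | rfl
      · refine P.not_mem_frontier_of_mem_interior (hint _ ⟨?_, ?_⟩) (P.side_subset_frontier l hzl)
        · nlinarith
        · nlinarith
      · rw [one_mul, add_sub_cancel] at hzl
        exact hlj (P.eq_of_mem_edge_of_mem_side hb hzl)
    · rw [zero_mul, add_zero] at hzl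
      exact hli (P.eq_of_mem_edge_of_mem_side ha hzl)
  filter_upwards [h1, h2, h3, h4, hmid, hdis] with q h1 h2 h3 h4 hmid hdis
  rintro Q rfl
  refine ⟨h1, h2, h3, ?_, fun s hs => ?_⟩
  · refine Q.mem_edge.2 ⟨_, h4, ?_⟩
    have h0 := hitTime_spec h1 (hitTime Q.vertex i (X Q.vertex))
    rw [sub_self, zero_mul] at h0
    exact (Q.eq_point_of_coord_im hn h0).symm
  -- The lines of edges i and j are met only at the two end times, and the other edges are disjoint
  -- from the closed chord by `hdis`.
  · have hsub : (fun s : ℝ => (X Q.vertex).1 + s • (X Q.vertex).2) ''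
        Ioo (hitTime Q.vertex i (X Q.vertex)) (hitTime Q.vertex j (X Q.vertex)) ⊆
        interior Q.region := by
      refine Q.subset_interior_of_disjoint_frontier
        (isPreconnected_Ioo.image _ (by fun_prop)) ?_
        ⟨_, ⟨_, ⟨?_, ?_⟩, rfl⟩, hmid Q rfl⟩
      · rw [disjoint_left]
        rintro _ ⟨s, hs, rfl⟩ hfr
        rw [frontier_eq_iUnion_side] at hfr
        obtain ⟨l, hl⟩ := mem_iUnion.1 hfr
        have hl0 : (Q.coord l _).im = 0 := Q.coord_im_of_mem_side hn hl
        by_cases hli : l = i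
        · subst hli
          rw [coord, dir, hitTime_spec h1] at hl0
          exact mul_ne_zero (sub_ne_zero.2 hs.1.ne') h1 hl0
        by_cases hlj : l = j
        · subst hlj
          rw [coord, dir, hitTime_spec h2] at hl0
          exact mul_ne_zero (sub_ne_zero.2 hs.2.ne) h2 hl0
        refine disjoint_left.1 (hdis l hli hlj) ?_ hl
        rw [segment_eq_image_lineMap]
        have hpos := sub_pos.2 h3
        refine ⟨(s - hitTime Q.vertex i (X Q.vertex)) /
          (hitTime Q.vertex j (X Q.vertex) - hitTime Q.vertex i (X Q.vertex)),
          ⟨div_nonneg (by linarith [hs.1]) hpos.le, by rw [div_le_one hpos]; linarith [hs.2]⟩, ?_⟩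
        rw [AffineMap.lineMap_apply, vsub_eq_sub, vadd_eq_add, add_sub_add_left_eq_sub, ← sub_smul,
          smul_smul, div_mul_cancel₀ _ hpos.ne', add_left_comm, ← add_smul, sub_add_cancel]
      · linarith
      · linarith
    exact hsub ⟨s, hs, rfl⟩

end NGon
end
noncomputable section

/-! ### Extension of quasi-periodic sequences to the integers -/

theorem forall_int_of_forall_nat {m : ℕ} (hm : 0 < m) {p : ℤ → Prop} (h : ∀ k : ℕ, p k)
    (hs : ∀ k, p (k + m) → p k) (k : ℤ) : p k := by
  have key : ∀ (N : ℕ) (k : ℤ), p (k + N * m) → p k := by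
    intro N
    induction N with
    | zero => intro k hk; simpa using hk
    | succ N ih =>
      intro k hk
      refine ih k (hs _ ?_)
      convert hk using 1
      push_cast
      ring
  refine key k.natAbs k ?_
  have h0 : 0 ≤ k + k.natAbs * m := by
    have h1 : (1 : ℤ) ≤ m := by exact_mod_cast hm
    have h2 : (k.natAbs : ℤ) * 1 ≤ k.natAbs * m := mul_le_mul_of_nonneg_left h1 (by omega)
    omega
  obtain ⟨l, hl⟩ := Int.eq_ofNat_of_zero_le h0
  rw [hl]
  exact h l

theorem forall_int_of_forall_lt {m : ℕ} (hm : 0 < m) {p : ℤ → Prop} (h : ∀ k : ℕ, k < m → p k)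
    (hs : ∀ k, p (k + m) ↔ p k) (k : ℤ) : p k := by
  refine forall_int_of_forall_nat hm (fun k => ?_) (fun k => (hs k).1) k
  induction k using Nat.strong_induction_on with
  | _ k ih =>
    rcases lt_or_ge k m with hk | hk
    · exact h k hk
    · obtain ⟨l, rfl⟩ := Nat.exists_eq_add_of_le' hk
      push_cast
      exact (hs l).2 (ih l (by omega))

/-- Division by m with remainder: the remainder selects a value of Y and the quotient a power of σ.
-/
theorem exists_int_extension {α : Type*} (σ : Equiv.Perm α) {m : ℕ} (hm : 0 < m) (Y : ℕ → α)
    (hY : ∀ k, Y (k + m) = σ (Y k)) :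
    ∃ X : ℤ → α, (∀ k : ℕ, X k = Y k) ∧ ∀ k, X (k + m) = σ (X k) := by
  have hm' : (m : ℤ) ≠ 0 := by exact_mod_cast hm.ne'
  let X : ℤ → α := fun k => (σ ^ (k / m)) (Y (k % m).toNat)
  have hX : ∀ k, X (k + m) = σ (X k) := fun k => by
    simp only [X]
    rw [Int.add_emod_right, Int.add_ediv_of_dvd_right (dvd_refl _), Int.ediv_self hm', add_comm,
      zpow_add, zpow_one, Equiv.Perm.mul_apply]
  refine ⟨X, fun k => ?_, hX⟩
  induction k using Nat.strong_induction_on with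
  | _ k ih =>
    rcases lt_or_ge k m with hk | hk
    · simp only [X]
      rw [Int.ediv_eq_zero_of_lt (by omega) (by omega), Int.emod_eq_of_lt (by omega) (by omega)]
      simp
    · obtain ⟨l, rfl⟩ := Nat.exists_eq_add_of_le' hk
      rw [hY, ← ih l (by omega), ← hX]
      push_cast
      rfl

/-! ### Vanishing alternating counts give stability -/

namespace NGon

variable {n : ℕ} {P : NGon n} {f : ℝ → ℂ}

open ComplexConjugate

theorem edgeReflection_eq_foldLin (hn : 3 ≤ n) (Q : NGon n) (i : Fin n) (z : ℂ) :
    Q.edgeReflection i z = foldLin Q.vertex i z := Q.edgeReflection_apply hn i z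

/-- A line which is closed up to translation after `m` reflections, and which crosses the polygon
in chords between consecutive edges, folds to a periodic trajectory. -/
theorem exists_trajectory_of_chords (hn : 3 ≤ n) (Q : NGon n) {w : ℤ → Fin n} {m : ℕ} (hm : 0 < m)
    (hw : ∀ k, w (k + m) = w k) {p τ : ℂ} (hτ : foldVec Q.vertex w m τ = τ)
    (hp : foldPt Q.vertex w m p = p - τ)
    (hchord : ∀ k < m, Q.IsChord (w k) (w (k + 1))
      (foldPt Q.vertex w k p, foldVec Q.vertex w k τ)) :
    ∃ g T, Q.IsPeriodicTrajectory g ∧ IsHitSequence Q g T w ∧ ∀ k, T (k + m) = T k + 1 := by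
  have hq : ∀ i, Q.vertex (finRotate n i) - Q.vertex i ≠ 0 := Q.dir_ne_zero hn
  -- In terms of starting point and velocity, σ is the delay of a line by one unit of time. The
  -- folded lines are quasi-periodic under it and so extend to negative indices.
  let σ : Equiv.Perm (ℂ × ℂ) :=
    { toFun := fun X => (X.1 - X.2, X.2)
      invFun := fun X => (X.1 + X.2, X.2)
      left_inv := fun X => by simp
      right_inv := fun X => by simp }
  have hσ : ∀ X, σ X = (X.1 - X.2, X.2) := fun X => rfl
  have hsubfold : ∀ k y z, foldPt Q.vertex w k (y - z) =
      foldPt Q.vertex w k y - foldVec Q.vertex w k z := by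
    intro k y z
    have := foldPt_add (q := Q.vertex) (w := w) k (y - z) z
    rw [sub_add_cancel] at this
    rw [this]
    ring
  have hvec : ∀ k, foldVec Q.vertex w (k + m) τ = foldVec Q.vertex w k τ := by
    intro k
    have h1 := foldPt_add_index (q := Q.vertex) hw k (0 + τ)
    rw [foldPt_add, foldPt_add (k := m), foldPt_add (k := k), foldPt_add_index hw, hτ] at h1
    exact add_left_cancel h1
  obtain ⟨X, hXnat, hXm⟩ := exists_int_extension σ hm
    (fun k => (foldPt Q.vertex w k p, foldVec Q.vertex w k τ)) (fun k => by
      rw [hσ, foldPt_add_index hw, hp, hsubfold, hvec])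
  have hXs : ∀ k, X (k + 1) =
      (foldRefl Q.vertex (w (k + 1)) (X k).1, foldLin Q.vertex (w (k + 1)) (X k).2) := by
    refine forall_int_of_forall_nat hm (fun k => ?_) fun k hk => ?_
    · have := hXnat (k + 1)
      push_cast at this
      rw [this, hXnat, foldPt, foldVec]
    · apply σ.injective
      rw [← hXm, show k + 1 + (m : ℤ) = k + m + 1 by ring, hk, hXm, hσ, hσ,
        show k + (m : ℤ) + 1 = k + 1 + m by ring, hw]
      have := foldRefl_add (q := Q.vertex) (w (k + 1)) ((X k).1 - (X k).2) (X k).2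
      rw [sub_add_cancel] at this
      simp only [this, add_sub_cancel_right]
  have hall : ∀ k, Q.IsChord (w k) (w (k + 1)) (X k) := by
    refine forall_int_of_forall_lt hm (fun k hk => ?_) fun k => ?_
    · rw [hXnat]
      exact hchord k hk
    · rw [hXm, hσ, isChord_shift, hw, show k + (m : ℤ) + 1 = k + 1 + m by ring, hw]
  let T : ℤ → ℝ := fun k => hitTime Q.vertex (w k) (X k)
  have hT1 : ∀ k, hitTime Q.vertex (w (k + 1)) (X k) = T (k + 1) := fun k => by
    simp only [T]
    rw [hXs, hitTime_fold hq]
  have hTm : ∀ k, T (k + m) = T k + 1 := fun k => by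
    simp only [T]
    rw [hXm, hσ, hw]
    exact hitTime_shift (hall k).start_im
  have hTmono : StrictMono T := strictMono_int_of_lt_succ fun k => by
    rw [← hT1]
    exact (hall k).lt
  obtain ⟨g, hg, hseq⟩ := Q.exists_trajectory_of_pieces (p := fun k => (X k).1)
    (τ := fun k => (X k).2) (w := w) hTmono hTm (fun k => (hall k).mem_edge)
    (fun k s hs => (hall k).mem_interior s ⟨hs.1, by rw [hT1]; exact hs.2⟩)
    (fun k h0 => (hall k).start_im (by rw [h0]; simp))
    (fun k => by rw [hXs, edgeReflection_eq_foldLin hn])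
    (fun k => by
      -- Consecutive pieces match because the point of impact lies on the line of reflection and is
      -- fixed.
      have h0 := hitTime_spec (hall k).end_im (T (k + 1))
      rw [hT1, sub_self, zero_mul] at h0
      have h1 := fold_eq_of_hit hq h0
      rw [foldRefl_add, foldLin_smul] at h1
      rw [hXs]
      exact h1.symm)
    (fun k => by rw [hXm, hσ]) (fun k => by rw [hXm, hσ])
  exact ⟨g, T, hg, hseq, hTm⟩

/-- For q near P, `foldPt_closed` yields a line (p q, τ q) that depends continuously on q, closes up
after m reflections, and is the original line (c 0, v 0) at P. Each of its m chords persists, and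
together they fold to a trajectory with the word of f. -/
theorem IsHitSequence.isStable (hn : 3 ≤ n) {t : ℤ → ℝ} {w : ℤ → Fin n}
    (h : IsHitSequence P f t w) (hf : P.IsPeriodicTrajectory f) {m : ℕ} (hm : 0 < m)
    (ht : ∀ k, t (k + m) = t k + 1) (hw : ∀ k, w (k + m) = w k) (hC : altSum w (2 * m) = 0) :
    P.IsStable f := by
  obtain ⟨v, hv0, hv, hrefl⟩ := h.exists_velocity hf.1
  have htr := h.transversal hn hf.1 hv
  have hlt : ∀ k, t k < t (k + 1) := fun k => h.strictMono (by omega)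
  have hq : ∀ i, P.vertex (finRotate n i) - P.vertex i ≠ 0 := P.dir_ne_zero hn
  have hfold : ∀ i z, foldLin P.vertex i z = P.edgeReflection i z := fun i z =>
    (edgeReflection_eq_foldLin hn P i z).symm
  -- The value at time 0 of the line that extends the k-th piece of f.
  let c : ℤ → ℂ := fun k => f (t k) - t k • v k
  have hline : ∀ k, ∀ s ∈ Icc (t k) (t (k + 1)), c k + s • v k = f s := fun k s hs => by
    rw [hv k s hs, sub_smul]
    simp only [c]
    abel
  have hvper : ∀ k, v (k + m) = v k := by
    intro k
    have h1 := hv k (t (k + 1)) ⟨(hlt k).le, le_rfl⟩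
    have h2 := hv (k + m) (t (k + m + 1)) ⟨(hlt _).le, le_rfl⟩
    rw [show k + (m : ℤ) + 1 = k + 1 + m by ring, ht, ht, hf.2, hf.2, h1, add_sub_add_right_eq_sub]
      at h2
    exact (smul_right_injective ℂ (sub_ne_zero.2 (hlt k).ne') (add_left_cancel h2)).symm
  have hcper : ∀ k, c (k + m) = c k - v k := fun k => by
    simp only [c]
    rw [ht, hf.2, hvper, add_smul, one_smul]
    abel
  have hcs : ∀ k, c (k + 1) = foldRefl P.vertex (w (k + 1)) (c k) := by
    intro k
    have h1 := hline k (t (k + 1)) ⟨(hlt k).le, le_rfl⟩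
    have h2 := hline (k + 1) (t (k + 1)) ⟨le_rfl, (hlt _).le⟩
    have h3 : (P.coord (w (k + 1)) (f (t (k + 1)))).im = 0 :=
      P.coord_im_of_mem_side hn (P.edge_subset_side _ (h.mem_edge _))
    have h4 := fold_eq_of_hit hq h3
    rw [← h1, foldRefl_add, foldLin_smul, hfold, ← hrefl, h1, ← h2] at h4
    exact (add_right_cancel h4).symm
  have hfp : ∀ k : ℕ, foldPt P.vertex w k (c 0) = c k := by
    intro k
    induction k with
    | zero => rfl
    | succ k ih => rw [foldPt, ih, Nat.cast_succ, hcs]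
  have hfv : ∀ k : ℕ, foldVec P.vertex w k (v 0) = v k := by
    intro k
    induction k with
    | zero => rfl
    | succ k ih => rw [foldVec, ih, Nat.cast_succ, hrefl, hfold]
  let A : (Fin n → ℂ) → ℂ → ℂ := fun q => foldPt q w m
  let τ : (Fin n → ℂ) → ℂ := fun q => (1 / 2 : ℝ) • (c 0 - A q (A q (c 0)))
  let p : (Fin n → ℂ) → ℂ := fun q => (1 / 2 : ℝ) • (c 0 + A q (c 0) + τ q)
  have hA1 : A P.vertex (c 0) = c 0 - v 0 := by
    simp only [A]
    rw [hfp, ← hcper, zero_add]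
  have hA2 : A P.vertex (A P.vertex (c 0)) = c 0 - 2 * v 0 := by
    simp only [A]
    rw [← foldPt_add_index hw, hfp]
    push_cast
    rw [hcper]
    have h1 := hcper 0
    have h2 := hvper 0
    rw [zero_add] at h1 h2
    rw [h1, h2]
    ring
  have hτP : τ P.vertex = v 0 := by
    simp only [τ]
    rw [hA2, Complex.real_smul]
    push_cast
    ring
  have hpP : p P.vertex = c 0 := by
    simp only [p]
    rw [hA1, hτP, Complex.real_smul]
    push_cast
    ring
  have hA1c : ContinuousAt (fun q => A q (c 0)) P.vertex :=
    continuousAt_foldPt hq m continuousAt_const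
  have hA2c : ContinuousAt (fun q => A q (A q (c 0))) P.vertex := continuousAt_foldPt hq m hA1c
  have hτc : ContinuousAt τ P.vertex :=
    (by fun_prop : Continuous fun z : ℂ => (1 / 2 : ℝ) • (c 0 - z)).continuousAt.comp
      (f := fun q => A q (A q (c 0))) hA2c
  have hpc : ContinuousAt p P.vertex :=
    (by fun_prop : Continuous fun z : ℂ × ℂ => (1 / 2 : ℝ) • (c 0 + z.1 + z.2)).continuousAt.comp
      (f := fun q => (A q (c 0), τ q)) (hA1c.prodMk hτc)
  have hev : ∀ᶠ q in 𝓝 P.vertex, ∀ k ∈ Finset.range m, ∀ Q : NGon n, Q.vertex = q →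
      Q.IsChord (w k) (w (k + 1)) (foldPt q w k (p q), foldVec q w k (τ q)) := by
    rw [Filter.eventually_all_finset]
    intro k _
    have hX : ContinuousAt (fun q => (foldPt q w k (p q), foldVec q w k (τ q))) P.vertex :=
      (continuousAt_foldPt hq k hpc).prodMk (continuousAt_foldVec hq k hτc)
    refine eventually_isChord hn P hX (hlt k) ?_ ?_ ?_ ?_ ?_ <;> simp only [hpP, hτP, hfp, hfv]
    · rw [hline k _ ⟨le_rfl, (hlt k).le⟩]
      exact h.mem_edge k
    · rw [hline k _ ⟨(hlt k).le, le_rfl⟩]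
      exact h.mem_edge (k + 1)
    · intro s hs
      rw [hline k s ⟨hs.1.le, hs.2.le⟩]
      exact h.mem_interior hf.1 hs
    · exact htr k
    · intro h0
      have h1 := fold_div hq (w (k + 1)) (v k)
      rw [hfold, ← hrefl] at h1
      apply htr (k + 1)
      change (v (k + 1) / (P.vertex (finRotate n (w (k + 1))) - P.vertex (w (k + 1)))).im = 0
      rw [h1, Complex.conj_im]
      exact neg_eq_zero.2 h0
  obtain ⟨ε, hε, hb⟩ := Metric.eventually_nhds_iff_ball.1 hev
  refine ⟨ε, hε, fun Q hQ => ?_⟩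
  have hQb : Q.vertex ∈ Metric.ball P.vertex ε := by
    rw [Metric.mem_ball, dist_pi_lt_iff hε]
    exact hQ
  obtain ⟨h1, h2⟩ := foldPt_closed (Q.dir_ne_zero hn) hw hC (c 0) (τ := τ Q.vertex)
    (p := p Q.vertex) rfl rfl
  obtain ⟨g, T, hg, hseq, hT⟩ := exists_trajectory_of_chords hn Q hm hw h1 h2
    fun k hk => hb _ hQb k (Finset.mem_range.2 hk) Q rfl
  exact ⟨g, hg, sameItinerary_of_hitSequence h hseq ht hT⟩

end NGon
end
noncomputable section

namespace NGon

variable {n : ℕ} {P : NGon n} {f : ℝ → ℂ}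

/-! ### The two sheets of the double -/

/-- The inclusion of one of the two copies of the punctured polygon in the double. -/
def sheetMap (P : NGon n) (b : Bool) : C(P.punctured, P.Double) :=
  ⟨fun x => P.toDouble (x, b),
    continuous_quotient_mk'.comp (continuous_id.prodMk continuous_const)⟩

theorem sheetMap_eq_iff {b c : Bool} {x y : P.punctured} :
    P.sheetMap b x = P.sheetMap c y ↔ x = y ∧ (b = c ∨ (x : ℂ) ∈ frontier P.region) :=
  Quotient.eq (r := P.gluing)

theorem mem_punctured_of_mem_edge {i : Fin n} {z : ℂ} (hz : z ∈ P.edge i) : z ∈ P.punctured :=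
  ⟨P.frontier_subset_region (P.edge_subset_frontier i hz), by
    rintro ⟨j, rfl⟩
    exact P.vertex_not_mem_edge hz⟩

/-- The class of a path in a sheet of the double is the difference of a potential. -/
theorem exists_homClass_potential (P : NGon n) (b : Bool) :
    ∃ A : P.punctured → SingularChains P.Double 1 ⧸ LinearMap.range (singularBoundary P.Double 1),
      ∀ γ : C(stdSimplex ℝ (Fin 2), P.punctured), homClass ((P.sheetMap b).comp γ) =
        A (γ (stdSimplex.vertex 1)) - A (γ (stdSimplex.vertex 0)) := by
  obtain ⟨h, hh⟩ := P.disc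
  -- The disc without the circle points that go to vertices. It stays convex, since by strict
  -- convexity of the disc a removed point is never inside a segment.
  let K : Set ℂ := {z | ∃ hz : z ∈ Metric.closedBall (0 : ℂ) 1, (h ⟨z, hz⟩ : ℂ) ∉ range P.vertex}
  have hK : Convex ℝ K := by
    rw [convex_iff_openSegment_subset]
    rintro x ⟨hx, hx'⟩ y ⟨hy, hy'⟩ z hz
    by_cases hxy : x = y
    · subst hxy
      rw [openSegment_same, mem_singleton_iff] at hz
      subst hz
      exact ⟨hx, hx'⟩
    · have h1 : z ∈ interior (Metric.closedBall (0 : ℂ) 1) :=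
        (strictConvex_closedBall ℝ (0 : ℂ) 1).openSegment_subset hx hy hxy hz
      refine ⟨interior_subset h1, fun ⟨i, hi⟩ => ?_⟩
      have h2 : ‖z‖ < 1 := by rwa [interior_closedBall _ one_ne_zero, mem_ball_zero_iff] at h1
      refine h2.ne ((hh ⟨z, interior_subset h1⟩).1 ?_)
      rw [← hi]
      exact P.side_subset_frontier i (P.vertex_mem_side i)
  let G : C(K, P.punctured) := ⟨fun z => ⟨h ⟨z, z.2.choose⟩, (h _).2, z.2.choose_spec⟩, by
    fun_prop⟩
  let E : C(P.punctured, K) := ⟨fun x => ⟨h.symm ⟨x, x.2.1⟩, (h.symm _).2, by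
    simpa using x.2.2⟩, by fun_prop⟩
  have hGE : ∀ x, G (E x) = x := fun x => Subtype.ext (by simp [G, E])
  rcases isEmpty_or_nonempty P.punctured with he | ⟨⟨x₀⟩⟩
  · exact ⟨fun _ => 0, fun γ => (he.false (γ (stdSimplex.vertex 0))).elim⟩
  -- The potential is the class of the straight segment from a base point, in the disc model.
  refine ⟨fun x => homClass (segSimplex hK ((P.sheetMap b).comp G) (E x₀) (E x)), fun γ => ?_⟩
  have h1 : (P.sheetMap b).comp γ = ((P.sheetMap b).comp G).comp (E.comp γ) := by
    ext x
    simp [hGE]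
  rw [h1, homClass_comp_path hK, eq_sub_iff_add_eq]
  exact (add_comm (G := _ ⧸ _) _ _).trans (homClass_seg_add hK _ _ _ _)

/-- The values at a point of an edge of the potentials of the two sheets have a difference that
depends on the edge only. -/
theorem exists_edge_class
    {A : Bool → P.punctured →
      SingularChains P.Double 1 ⧸ LinearMap.range (singularBoundary P.Double 1)}
    (hA : ∀ b, ∀ γ : C(stdSimplex ℝ (Fin 2), P.punctured), homClass ((P.sheetMap b).comp γ) =
      A b (γ (stdSimplex.vertex 1)) - A b (γ (stdSimplex.vertex 0))) :
    ∃ δ : Fin n → SingularChains P.Double 1 ⧸ LinearMap.range (singularBoundary P.Double 1),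
      ∀ i, ∀ x : P.punctured, (x : ℂ) ∈ P.edge i → A false x - A true x = δ i := by
  have hp : ∀ i, P.point i (1 / 2) ∈ P.edge i := fun i => P.mem_edge.2 ⟨_, by norm_num, rfl⟩
  refine ⟨fun i => A false ⟨_, mem_punctured_of_mem_edge (hp i)⟩ -
    A true ⟨_, mem_punctured_of_mem_edge (hp i)⟩, fun i x hx => ?_⟩
  let ι : C(P.edge i, P.punctured) := ⟨fun z => ⟨z, mem_punctured_of_mem_edge z.2⟩, by fun_prop⟩
  have hconv : Convex ℝ (P.edge i) := convex_openSegment _ _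
  let γ := segSimplex hconv ι ⟨_, hp i⟩ ⟨x, hx⟩
  -- A segment inside the edge is the same path in both sheets, so both potentials change equally
  -- along it.
  have hγ : (P.sheetMap false).comp γ = (P.sheetMap true).comp γ := by
    ext s
    exact sheetMap_eq_iff.2 ⟨rfl, Or.inr (P.edge_subset_frontier i
      (affineSimplex hconv ![⟨_, hp i⟩, ⟨x, hx⟩] s).2)⟩
  have h0 : γ (stdSimplex.vertex 0) = ⟨_, mem_punctured_of_mem_edge (hp i)⟩ :=
    Subtype.ext (by simp [γ, ι, segSimplex, affineSimplex])
  have h1 : γ (stdSimplex.vertex 1) = x :=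
    Subtype.ext (by simp [γ, ι, segSimplex, affineSimplex])
  have h2 := hA false γ
  rw [hγ, hA true γ, h0, h1] at h2
  rw [sub_eq_sub_iff_add_eq_add] at h2 ⊢
  rw [← h2.symm.trans (add_comm _ _)]

/-- A homomorphism from the first homology of the double that sees only the crossings of one
edge. -/
theorem exists_edge_cocycle (P : NGon n) (j : Fin n) :
    ∃ (a : P.punctured → ℝ)
      (D : (SingularChains P.Double 1 ⧸ LinearMap.range (singularBoundary P.Double 1)) →ₗ[ℤ] ℝ),
      (∀ i, ∀ x : P.punctured, (x : ℂ) ∈ P.edge i → a x = if i = j then 1 / 2 else 0) ∧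
      ∀ (b : Bool) (γ : C(stdSimplex ℝ (Fin 2), P.punctured)),
        D (homClass ((P.sheetMap b).comp γ)) = (if b then 1 else -1) *
          (a (γ (stdSimplex.vertex 1)) - a (γ (stdSimplex.vertex 0))) := by
  let E : Fin n → Set P.punctured := fun i => Subtype.val ⁻¹' P.side i
  have hE : ∀ i, IsClosed (E i) := fun i => (P.isClosed_side i).preimage continuous_subtype_val
  have hside : ∀ {i} {x : P.punctured}, x ∈ E i → (x : ℂ) ∈ P.edge i := by
    intro i x hx
    rcases P.mem_frontier_iff.1 (P.side_subset_frontier i hx) with ⟨k, hk⟩ | hv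
    · rwa [P.eq_of_mem_edge_of_mem_side hk hx]
    · exact (x.2.2 hv).elim
  -- Once the vertices are removed, the sides are disjoint closed sets, and a Urysohn function
  -- separates side j from the others.
  obtain ⟨g, hg0, hg1, -⟩ := exists_continuous_zero_one_of_isClosed
    (s := ⋃ i : {i // i ≠ j}, E i) (t := E j) (isClosed_iUnion_of_finite fun i => hE i) (hE j) (by
      rw [disjoint_left]
      intro x hx hxj
      obtain ⟨⟨i, hi⟩, hxi⟩ := mem_iUnion.1 hx
      exact hi (P.edge_unique (hside hxj) (hside hxi)))
  let a : C(P.punctured, ℝ) := ⟨fun x => g x / 2, by fun_prop⟩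
  have ha : ∀ i, ∀ x : P.punctured, (x : ℂ) ∈ P.edge i → a x = if i = j then 1 / 2 else 0 := by
    intro i x hx
    have hxi : x ∈ E i := P.edge_subset_side i hx
    split_ifs with h
    · subst h
      simp [a, hg1 hxi]
    · simp [a, hg0 (mem_iUnion.2 ⟨⟨i, h⟩, hxi⟩)]
  let σ : Bool → ℝ := fun b => if b then 1 else -1
  -- The function a enters with opposite signs on the two sheets. The values agree modulo 1 along
  -- the gluing: they are 1/2 and -1/2 on edge j, and 0 on the other edges.
  let θ : C(P.Double, AddCircle (1 : ℝ)) :=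
    ⟨Quotient.lift (s := P.gluing) (fun p => ((σ p.2 * a p.1 : ℝ) : AddCircle (1 : ℝ))) (by
      rintro ⟨x, b⟩ ⟨y, c⟩ ⟨hxy, hbc⟩
      obtain rfl : x = y := hxy
      rcases hbc with hbc | hfr
      · obtain rfl : b = c := hbc
        rfl
      · obtain ⟨i, hi⟩ := (P.mem_frontier_iff.1 hfr).resolve_right x.2.2
        have h1 : ((-(1 / 2 : ℝ) : ℝ) : AddCircle (1 : ℝ)) = ((1 / 2 : ℝ) : AddCircle (1 : ℝ)) := by
          rw [← AddCircle.coe_add_period (1 : ℝ) (-(1 / 2))]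
          norm_num
        have h2 := ha i x hi
        cases b <;> cases c <;> split_ifs at h2 <;> simp [σ, h2] <;>
          first | simpa using h1 | simpa using h1.symm),
      Continuous.quotient_lift (AddCircle.continuous_mk' 1 |>.comp
        (((continuous_of_discreteTopology (f := σ)).comp continuous_snd).mul
          (a.continuous.comp continuous_fst))) _⟩
  obtain ⟨D, hD⟩ := exists_degree_cocycle θ
  refine ⟨a, D, ha, fun b γ => ?_⟩
  rw [hD, circleChange_eq ⟨fun s => σ b * a (γ s), by fun_prop⟩ fun s => rfl, mul_sub]
  rfl

end NGon
end
noncomputable section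

namespace NGon

variable {n : ℕ} {P : NGon n} {f : ℝ → ℂ} {t : ℤ → ℝ} {w : ℤ → Fin n}

/-! ### Lifts of a periodic trajectory -/

theorem IsTrajectory.mem_punctured (hf : P.IsTrajectory f) (s : ℝ) : f s ∈ P.punctured :=
  ⟨hf.mem s, fun ⟨i, hi⟩ => hf.ne_vertex s i hi.symm⟩

/-- A trajectory as a path in the punctured polygon. -/
def IsTrajectory.path (hf : P.IsTrajectory f) : C(ℝ, P.punctured) :=
  ⟨fun s => ⟨f s, hf.mem_punctured s⟩, hf.continuous.subtype_mk _⟩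

theorem IsHitSequence.mem_frontier (h : IsHitSequence P f t w) (k : ℤ) :
    f (t k) ∈ frontier P.region := P.edge_subset_frontier _ (h.mem_edge k)

/-- A lift runs through the two sheets alternately. -/
theorem IsLift.exists_sheet (hf : P.IsTrajectory f) (h : IsHitSequence P f t w)
    {F : C(ℝ, P.Double)} (hF : P.IsLift f F) :
    ∃ b : ℤ → Bool, (∀ k, b (k + 1) = !b k) ∧
      ∀ k, ∀ s ∈ Icc (t k) (t (k + 1)), F s = P.sheetMap (b k) (hf.path s) := by
  obtain ⟨σ, hσ1, hσ2, hσ3⟩ := hF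
  have hlt : ∀ k, t k < t (k + 1) := fun k => h.strictMono (by omega)
  have hm : ∀ k, (t k + t (k + 1)) / 2 ∈ Ioo (t k) (t (k + 1)) := fun k =>
    ⟨by linarith [hlt k], by linarith [hlt k]⟩
  have hconst : ∀ k, ∀ s ∈ Ioo (t k) (t (k + 1)), σ s = σ ((t k + t (k + 1)) / 2) := by
    intro k s hs
    refine isPreconnected_Ioo.constant (fun x hx => ?_) hs (hm k)
    refine ContinuousAt.continuousWithinAt ?_
    exact tendsto_nhds_of_eventually_eq (hσ1 x (h.mem_interior hf hx))
  have hlift : ∀ s, F s = P.sheetMap (σ s) (hf.path s) := fun s => (hσ3 s).choose_spec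
  refine ⟨fun k => σ ((t k + t (k + 1)) / 2), fun k => ?_, fun k s hs => ?_⟩
  · obtain ⟨c, h1, h2⟩ := hσ2 _ (h.mem_frontier (k + 1))
    obtain ⟨x, hx, hx'⟩ := (h1.and (Ioo_mem_nhdsLT (hlt k))).exists
    obtain ⟨y, hy, hy'⟩ := (h2.and (Ioo_mem_nhdsGT (hlt (k + 1)))).exists
    exact (hconst _ y hy').symm.trans (hy.trans (congrArg not (hx.symm.trans (hconst _ x hx'))))
  · rw [hlift, sheetMap_eq_iff]
    refine ⟨rfl, ?_⟩
    rcases hs.1.eq_or_lt with rfl | h1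
    · exact Or.inr (h.mem_frontier k)
    rcases hs.2.eq_or_lt with rfl | h2
    · exact Or.inr (h.mem_frontier (k + 1))
    · exact Or.inl (hconst k s ⟨h1, h2⟩)

/-- A periodic trajectory has a lift to the double whose period is twice as large. -/
theorem IsHitSequence.exists_lift (h : IsHitSequence P f t w) (hf : P.IsPeriodicTrajectory f)
    {m : ℕ} (ht : ∀ k, t (k + m) = t k + 1) :
    ∃ F : C(ℝ, P.Double), P.IsLift f F ∧ Function.Periodic F 2 := by
  have hlt : ∀ k, t k < t (k + 1) := fun k => h.strictMono (by omega)
  choose κ hκ using exists_mem_Ico_of_shift h.strictMono one_pos ht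
  have hκe : ∀ k, ∀ s ∈ Ico (t k) (t (k + 1)), κ s = k := by
    intro k s hs
    have h1 := h.strictMono.lt_iff_lt.1 (hs.1.trans_lt (hκ s).2)
    have h2 := h.strictMono.lt_iff_lt.1 ((hκ s).1.trans_lt hs.2)
    omega
  let b : ℤ → Bool := fun k => decide (Even k)
  have hb : ∀ k, b (k + 1) = !b k := fun k => by
    rw [show b (k + 1) = decide ¬Even k from decide_eq_decide.2 Int.even_add_one, decide_not]
  let F : ℝ → P.Double := fun s => P.sheetMap (b (κ s)) (hf.1.path s)
  have hF : ∀ k, ∀ s ∈ Icc (t k) (t (k + 1)), F s = P.sheetMap (b k) (hf.1.path s) := by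
    intro k s hs
    rcases hs.2.eq_or_lt with rfl | h2
    · exact sheetMap_eq_iff.2 ⟨rfl, Or.inr (h.mem_frontier (k + 1))⟩
    · simp only [F]
      rw [hκe k s ⟨hs.1, h2⟩]
  have hFc : Continuous F := by
    have hon : ∀ k, ContinuousOn F (Icc (t k) (t (k + 1))) := fun k =>
      (ContinuousMap.continuous ((P.sheetMap (b k)).comp hf.1.path)).continuousOn.congr (hF k)
    rw [continuous_iff_continuousAt]
    intro s
    have h1 := hon (κ s - 1)
    rw [sub_add_cancel] at h1
    have h2 := h1.union_of_isClosed (hon (κ s)) isClosed_Icc isClosed_Icc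
    have h3 : t (κ s - 1) < t (κ s) := h.strictMono (by omega)
    rw [Icc_union_Icc_eq_Icc h3.le (hlt _).le] at h2
    exact h2.continuousAt (Icc_mem_nhds (h3.trans_le (hκ s).1) (hκ s).2)
  refine ⟨⟨F, hFc⟩, ⟨fun s => b (κ s), fun s hs => ?_, fun s hs => ?_, fun s =>
    ⟨hf.1.mem_punctured s, rfl⟩⟩, fun s => ?_⟩
  · have h1 : t (κ s) ≠ s := by
      intro h1
      rw [← h1] at hs
      exact P.not_mem_frontier_of_mem_interior hs (h.mem_frontier _)
    filter_upwards [Ioo_mem_nhds ((hκ s).1.lt_of_ne h1) (hκ s).2] with x hx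
    rw [hκe _ x ⟨hx.1.le, hx.2⟩]
  · obtain ⟨k, rfl⟩ := h.exists_eq s hs
    have h3 : t (k - 1) < t k := h.strictMono (by omega)
    refine ⟨b (k - 1), ?_, ?_⟩
    · filter_upwards [Ioo_mem_nhdsLT h3] with x hx
      rw [hκe (k - 1) x ⟨hx.1.le, by simpa using hx.2⟩]
    · filter_upwards [Ioo_mem_nhdsGT (hlt k)] with x hx
      rw [hκe k x ⟨hx.1.le, hx.2⟩, ← hb, sub_add_cancel]
  · have ht2 : ∀ k, t (k + 2 * m) = t k + 2 := fun k => by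
      rw [two_mul, ← add_assoc, ht, ht]
      ring
    have h1 := hκ s
    have h2 : s + 2 ∈ Icc (t (κ s + 2 * m)) (t (κ s + 2 * m + 1)) := by
      rw [add_right_comm, ht2, ht2]
      exact ⟨by linarith [h1.1], by linarith [h1.2]⟩
    change F (s + 2) = F s
    rw [hF _ _ h2, hF _ s ⟨h1.1, h1.2.le⟩]
    have h4 : f (s + 2) = f s := by
      have := hf.2.nat_mul 2 s
      simpa using this
    -- Time 2 contains 2m hits, an even number whatever the parity of m, so the sheet is restored.
    have h5 : b (κ s + 2 * m) = b (κ s) := by simp [b, Int.even_add]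
    rw [h5]
    congr 1
    exact Subtype.ext h4

/-! ### The homology class of a lift -/

/-- Summation by parts: subtracting the telescoping sum of B (b k) k, which vanishes by `hM`, leaves
at each hit the jump between the two sheets. -/
theorem sum_alternate {G : Type*} [AddCommGroup G] (B : Bool → ℤ → G) {b : ℤ → Bool}
    (hb : ∀ k, b (k + 1) = !b k) {M : ℕ} (hM : B (b M) M = B (b 0) 0) :
    ∑ k ∈ Finset.range M, (B (b k) (k + 1) - B (b k) k) =
      (if b 0 then (-1 : ℤ) else 1) • ∑ k ∈ Finset.range M,
        (-1 : ℤ) ^ k • (B false (k + 1) - B true (k + 1)) := by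
  have h1 := Finset.sum_range_sub (fun k : ℕ => B (b k) k) M
  push_cast at h1
  rw [hM, sub_self] at h1
  rw [← sub_zero (∑ k ∈ Finset.range M, (B (b k) (k + 1) - B (b k) k)), ← h1,
    ← Finset.sum_sub_distrib, Finset.smul_sum]
  have hbk : ∀ k : ℕ, (if b k then (-1 : ℤ) else 1) = (if b 0 then (-1 : ℤ) else 1) * (-1) ^ k := by
    intro k
    induction k with
    | zero => simp
    | succ k ih =>
      push_cast
      rw [hb, pow_succ, ← mul_assoc, ← ih]
      cases b k <;> simp
  refine Finset.sum_congr rfl fun k _ => ?_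
  rw [smul_smul, ← hbk, hb]
  cases b k <;> simp

theorem sum_altSum {G : Type*} [AddCommGroup G] (w : ℤ → Fin n) (M : ℕ) (δ : Fin n → G) :
    ∑ k ∈ Finset.range M, (-1 : ℤ) ^ k • δ (w (k + 1)) = ∑ i, altSum w M i • δ i := by
  simp only [altSum, Finset.sum_smul]
  rw [Finset.sum_comm]
  refine Finset.sum_congr rfl fun k _ => ?_
  rw [Finset.sum_eq_single (w (k + 1))]
  · simp
  · intro i _ hi
    simp [hi.symm]
  · simp

/-- A lift is null-homologous if and only if the alternating numbers of hits of all edges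
vanish. -/
theorem IsLift.isNullHomologous_iff (h : IsHitSequence P f t w) (hf : P.IsTrajectory f)
    {F : C(ℝ, P.Double)} (hF : P.IsLift f F) {T : ℝ} (hT : 0 < T) (hFT : Function.Periodic F T) :
    ∃ M : ℕ, 0 < M ∧ Even M ∧ (∀ k, w (k + M) = w k) ∧
      (IsNullHomologous F T ↔ altSum w M = 0) := by
  obtain ⟨b, hb, hFb⟩ := hF.exists_sheet hf h
  have hlt : ∀ k, t k < t (k + 1) := fun k => h.strictMono (by omega)
  have hfT : Function.Periodic f T := by
    intro s
    obtain ⟨σ, -, -, h3⟩ := hF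
    obtain ⟨_, e1⟩ := h3 (s + T)
    obtain ⟨_, e2⟩ := h3 s
    have := hFT s
    rw [e1, e2] at this
    exact congrArg Subtype.val (sheetMap_eq_iff.1 this).1
  obtain ⟨M, hM, htM, hwM⟩ := h.exists_shift hT hfT
  -- Read off at an interior time, where a point of the double determines its sheet. As sheets
  -- alternate, M must be even.
  have hbM : ∀ k, b (k + M) = b k := by
    intro k
    have hm : (t k + t (k + 1)) / 2 ∈ Ioo (t k) (t (k + 1)) :=
      ⟨by linarith [hlt k], by linarith [hlt k]⟩
    have h1 := hFT ((t k + t (k + 1)) / 2)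
    rw [hFb k _ ⟨hm.1.le, hm.2.le⟩, hFb (k + M) _ (by
      rw [add_right_comm, htM, htM]
      exact ⟨by linarith [hm.1], by linarith [hm.2]⟩)] at h1
    refine (sheetMap_eq_iff.1 h1).2.resolve_right fun hfr => ?_
    refine P.not_mem_frontier_of_mem_interior (h.mem_interior hf hm) ?_
    rw [← hfT]
    exact hfr
  have hbE : ∀ k : ℕ, b k = (if Even k then b 0 else !b 0) := by
    intro k
    induction k with
    | zero => simp
    | succ k ih =>
      push_cast
      rw [hb, ih]
      by_cases hk : Even k <;> simp [hk, Nat.even_add_one]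
  have hME : Even M := by
    by_contra hodd
    have h1 := hbE M
    rw [if_neg hodd] at h1
    have h2 := hbM 0
    rw [zero_add, h1] at h2
    simp at h2
  have hxM : hf.path (t M) = hf.path (t 0) := by
    refine Subtype.ext ?_
    change f (t M) = f (t 0)
    rw [← hfT (t 0), ← htM, zero_add]
  have hclass : homClass (pathSimplex F T) = ∑ k ∈ Finset.range M,
      homClass ((P.sheetMap (b k)).comp (arcSimplex hf.path (t k) (t (k + 1)))) := by
    rw [← homClass_arc_shift F hFT (t 0), ← htM 0, zero_add]
    refine (homClass_arc_sum F (fun k => t k) M).trans (Finset.sum_congr rfl fun k _ => ?_)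
    congr 1
    ext s
    push_cast
    refine hFb k _ ?_
    have h0 := s.2.1 0
    have h1 := s.2.1 1
    have h2 := s.2.2
    rw [Fin.sum_univ_two] at h2
    have h3 := hlt k
    simp only [ContinuousMap.coe_mk]
    rw [eq_sub_of_add_eq h2] at h0 ⊢
    constructor <;> nlinarith
  have hv0 : ∀ k : ℤ, arcSimplex hf.path (t k) (t (k + 1)) (stdSimplex.vertex 0) =
      hf.path (t k) := fun k => by simp [arcSimplex]
  have hv1 : ∀ k : ℤ, arcSimplex hf.path (t k) (t (k + 1)) (stdSimplex.vertex 1) =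
      hf.path (t (k + 1)) := fun k => by simp [arcSimplex]
  refine ⟨M, hM, hME, hwM, ?_⟩
  rw [_root_.isNullHomologous_iff]
  constructor
  · intro h0
    funext j
    obtain ⟨a, D, ha, hD⟩ := P.exists_edge_cocycle j
    have h1 := congrArg D (hclass.symm.trans h0)
    rw [map_sum, map_zero] at h1
    let B : Bool → ℤ → ℝ := fun c k => (if c then 1 else -1) * a (hf.path (t k))
    have h2 := sum_alternate B hb (M := M) (by
      have := hbM 0
      rw [zero_add] at this
      simp only [B, hxM, this])
    simp only [hD, hv0, hv1] at h1
    replace h1 := h2.symm.trans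
      ((Finset.sum_congr rfl fun k _ => (mul_sub _ _ _).symm).trans h1)
    -- At a hit of edge j the jump is -1/2 - 1/2 = -1, and at any other hit it is 0.
    have h3 : ∑ k ∈ Finset.range M, (-1 : ℤ) ^ k • (B false (k + 1) - B true (k + 1)) =
        -(altSum w M j : ℝ) := by
      rw [altSum, Int.cast_sum, ← Finset.sum_neg_distrib]
      refine Finset.sum_congr rfl fun k _ => ?_
      simp only [B]
      rw [ha (w (k + 1)) _ (h.mem_edge (k + 1))]
      rw [zsmul_eq_mul]
      by_cases hj : w (k + 1) = j
      · rw [if_pos hj, if_pos hj, if_neg Bool.false_ne_true, if_pos trivial]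
        push_cast
        ring
      · rw [if_neg hj, if_neg hj]
        push_cast
        ring
    rw [h3] at h1
    have h4 : (altSum w M j : ℝ) = 0 := by
      split_ifs at h1 <;> simpa using h1
    simpa using h4
  · intro h0
    -- With the potentials of the two sheets, the jump at a hit of edge i is δ i, so the class is ±
    -- Σ C_i δ_i.
    choose A hA using P.exists_homClass_potential
    obtain ⟨δ, hδ⟩ := exists_edge_class hA
    rw [hclass]
    simp only [hA, hv0, hv1]
    have h2 := sum_alternate (fun c k => A c (hf.path (t k))) hb (M := M) (by
      have := hbM 0
      rw [zero_add] at this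
      simp only [hxM, this])
    refine h2.trans ?_
    have h3 : ∀ k, A false (hf.path (t (k + 1))) - A true (hf.path (t (k + 1))) =
        δ (w (k + 1)) := fun k => hδ _ _ (h.mem_edge (k + 1))
    simp [h3, sum_altSum, h0]

end NGon
end

/-! ### The Stability Lemma -/

theorem mainTheorem2 (n : ℕ) (hn : 3 ≤ n) :
    (∀ (P : NGon n) (f : ℝ → ℂ), P.IsPeriodicTrajectory f →
      (∃ F : C(ℝ, P.Double), P.IsLift f F ∧ Function.Periodic F 2) ∧
      ∀ (F : C(ℝ, P.Double)) (T : ℝ), P.IsLift f F → 0 < T → Function.Periodic F T →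
        (P.IsStable f ↔ IsNullHomologous F T)) ∧
    genericTau n = ⁅genericH n, genericH n⁆ := by
  refine ⟨fun P f hf => ?_, genericTau_eq_commutator hn⟩
  obtain ⟨t, w, h⟩ := hf.exists_hitSequence hn
  obtain ⟨m, hm, ht, hw⟩ := h.exists_shift one_pos hf.2
  refine ⟨h.exists_lift hf ht, fun F T hF hT hFT => ?_⟩
  obtain ⟨M, hM, hME, hwM, hiff⟩ := hF.isNullHomologous_iff h hf.1 hT hFT
  have hstable : P.IsStable f ↔ NGon.altSum w (2 * m) = 0 :=
    ⟨NGon.IsStable.altSum_eq_zero hn h ht, h.isStable hn hf hm ht hw⟩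
  rw [hstable, hiff, funext_iff, funext_iff]
  -- Stability counts hits over two periods of f, homology over the given period of F; both numbers
  -- of hits are even periods of the same word.
  refine NGon.altSum_eq_zero_iff (even_two_mul m) hME (by omega) hM (fun k => ?_) hwM
  push_cast
  rw [two_mul, ← add_assoc, hw, hw]
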